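/- **Weak–strong uniqueness for reaction–diffusion systems with cut-off.** Let $d\ge 2$, $h>1$ and $\max\{\tfrac{d(h-1)}{2},2\}<q<\infty$. There is $\xi_0=\xi_0(q,h,d)\in(q,\infty)$ such that the following holds whenever either $d\ge 3$ and $\xi=\frac{dq}{d-2}$, or $d=2$ and $\xi\in[\xi_0,\infty)$. Let $\ell\ge1$, $T\in(0,\infty)$, $\gamma\in(0,1)$, $R,r\in(1,\infty)$, $\mu_1,\dots,\mu_\ell>0$, $v_0\in L^q(\mathbb T^d;\mathbb R^\ell)$, where $\mathbb T^d=(\mathbb R/\mathbb Z)^d$, and let $\phi\in C^\infty(\mathbb R)$ satisfy $\phi=1$ on $[0,1]$ and $\phi=0$ on $[2,\infty)$. Let $f_i:(0,\infty)\times\mathbb T^d\times\mathbb R^\ell\to\mathbb R$ and $F_i:(0,\infty)\times\mathbb T^d\times\mathbb R^\ell\to\mathbb R^d$ ($1\le i\le\ell$) be Borel measurable and such that: 1. (Polynomial growth) for some constant $C$, for a.e. $(t,x)$, all $i$ and all $y,y'\in\mathbb R^\ell$: $|f_i(t,x,y)|\le C(1+|y|^h)$, $|F_i(t,x,y)|\le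 C(1+|y|^{\frac{h+1}2})$, $|f_i(t,x,y)-f_i(t,x,y')|\le C(1+|y|^{h-1}+|y'|^{h-1})|y-y'|$ and $|F_i(t,x,y)-F_i(t,x,y')|\le C(1+|y|^{\frac{h-1}2}+|y'|^{\frac{h-1}2})|y-y'|$; 2. (Positivity) there are measurable $c_i:(0,\infty)\to\mathbb R^d$ such that for a.e. $(t,x)$, all $i$ and all $y\in[0,\infty)^\ell$ with $y_i=0$: $f_i(t,x,y)\ge0$ and $F_i(t,x,y)=c_i(t)$; 3. (Mass control) there are $\alpha_1,\dots,\alpha_\ell>0$ and $a_0,a_1\in\mathbb R$ such that $\sum_i\alpha_if_i(t,x,y)\le a_0+a_1\sum_iy_i$ for all $t>0$, $x\in\mathbb T^d$ and $y\in[0,\infty)^\ell$. Set $$\mathcal X=L^2(0,T;H^{1-\gamma})\cap C([0,T];H^{-\gamma})\cap L^\infty(0,T;L^q)\cap L^q(0,T;L^\xi),$$ the spaces in $x$ consisting of $\mathbb R^\ell$-valued functions or distributions on $\mathbb T^d$ and $H^s=H^{s,2}$, and let $\phi_{R,r}(t,v)=\phi\big(R^{-1}\|v\|_{L^r(0,t;L^q)}\big)$.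 Let $v^{(1)}\in\mathcal X$ be a weak solution of $\partial_tv_i=\mu_i\Delta v_i+\operatorname{div}(F_i(\cdot,v))+f_i(\cdot,v)$, $v_i(0)=v_{0,i}$, i.e. for all $\eta\in C^\infty(\mathbb T^d;\mathbb R^\ell)$ and $t\in[0,T]$ $$\langle v^{(1)}(t),\eta\rangle=\int_{\mathbb T^d}v_0\cdot\eta\,dx+\sum_{i=1}^\ell\int_0^t\!\int_{\mathbb T^d}\Big(\mu_iv^{(1)}_i\Delta\eta_i+f_i(\cdot,v^{(1)})\eta_i-F_i(\cdot,v^{(1)})\cdot\nabla\eta_i\Big)dx\,ds,$$ where $\langle\cdot,\cdot\rangle$ is the duality pairing $H^{-\gamma}\times H^{\gamma}$, and assume that $$\|v^{(1)}\|_{L^r(0,T;L^q)}\le R-1 .$$ Let $v^{(2)}\in\mathcal X$ be a weak solution of the system with cut-off, i.e. for all $\eta\in C^\infty(\mathbb T^d;\mathbb R^\ell)$ and $t\in[0,T]$ $$\langle v^{(2)}(t),\eta\rangle=\int_{\mathbb T^d}v_0\cdot\eta\,dx+\sum_{i=1}^\ell\int_0^t\!\int_{\mathbb T^d}\Big(\mu_iv^{(2)}_i\Delta\eta_i+\phi_{R,r}(s,v^{(2)})\big[f_i(\cdot,v^{(2)})\eta_i-F_i(\cdot,v^{(2)})\cdot\nabla\eta_i\big]\Big)dx\,ds.$$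 Then $v^{(1)}=v^{(2)}$, i.e. $v^{(1)}=v^{(2)}$ a.e. on $(0,T)\times\mathbb T^d$ and $v^{(1)}(t)=v^{(2)}(t)$ in $H^{-\gamma}$ for all $t\in[0,T]$. -/

import Mathlib

open MeasureTheory Set Filter Topology

/-- The torus `𝕋ᵈ = (ℝ/ℤ)ᵈ`, with its Lebesgue measure `volume` of total mass one. -/
abbrev Torus (d : ℕ) := UnitAddTorus (Fin d)

/-- The state space `ℝˡ` with the Euclidean norm. -/
abbrev State (l : ℕ) := EuclideanSpace ℝ (Fin l)

/-- `j`-th partial derivative of a function on the torus. -/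
noncomputable def torusPartial {d : ℕ} (j : Fin d) (g : Torus d → ℝ) (x : Torus d) : ℝ :=
  deriv (fun s : ℝ => g (x + Pi.single j (s : UnitAddCircle))) 0

/-- Laplacian of a function on the torus. -/
noncomputable def torusLaplacian {d : ℕ} (g : Torus d → ℝ) (x : Torus d) : ℝ :=
  ∑ j, torusPartial j (torusPartial j g) x

/-- `η ∈ C^∞(𝕋ᵈ; ℝˡ)`: the periodic lift of `η` to `ℝᵈ` is smooth. -/
def TorusSmooth {d l : ℕ} (η : Torus d → State l) : Prop :=
  ContDiff ℝ ((⊤ : ℕ∞) : WithTop ℕ∞)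
    (fun y : Fin d → ℝ => η (fun j => (y j : UnitAddCircle)))

/-- Families of (vector-valued) Fourier coefficients indexed by `ℤᵈ`. -/
abbrev FourierFamily (d l : ℕ) := (Fin d → ℤ) → EuclideanSpace ℂ (Fin l)

/-- The Fourier coefficients of a function `g : 𝕋ᵈ → ℝˡ`. -/
noncomputable def torusFourier {d l : ℕ} (g : Torus d → State l) : FourierFamily d l :=
  fun k => WithLp.toLp 2 fun i => UnitAddTorus.mFourierCoeff (fun x => ((g x i : ℝ) : ℂ)) k

/-- The square of the `H^s` norm, `∑ₖ (1 + |k|²)^s |â(k)|²`, as an extended nonnegative real. -/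
noncomputable def sobolevNormSq {d l : ℕ} (s : ℝ) (a : FourierFamily d l) : ENNReal :=
  ∑' k, ENNReal.ofReal ((1 + ∑ j, (k j : ℝ) ^ 2) ^ s * ‖a k‖ ^ 2)

/-- The Bessel potential space `H^s(𝕋ᵈ; ℝˡ) = H^{s,2}(𝕋ᵈ; ℝˡ)`, `s ∈ ℝ`. A periodic distribution is
identified with the family of its Fourier coefficients; the symmetry condition says that the
distribution is real-valued. -/
def torusSobolev (d l : ℕ) (s : ℝ) : Set (FourierFamily d l) :=
  {a | (∀ k i, a (-k) i = (starRingEnd ℂ) (a k i)) ∧ sobolevNormSq s a < ⊤}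

/-- The duality pairing `⟨a, η⟩ = ∑ₖ â(k) · conj η̂(k)` of a real-valued distribution `a` with a smooth
function `η` (this sum is real; for `a` an integrable function it is `∫ a · η`). -/
noncomputable def torusPairing {d l : ℕ} (a : FourierFamily d l) (η : Torus d → State l) : ℝ :=
  (∑' k, inner ℂ (torusFourier η k) (a k)).re

/-- The norm of `v` in `L^p(0,t; L^q(𝕋ᵈ; ℝˡ))`, `1 ≤ p, q < ∞`, as an extended nonnegative real. -/
noncomputable def mixedNorm {d l : ℕ} (p q t : ℝ) (v : ℝ → Torus d → State l) : ENNReal :=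
  (∫⁻ s in Ioo 0 t, eLpNorm (v s) (ENNReal.ofReal q) volume ^ p) ^ (1 / p)

/-- An element of
`L²(0,T; H^{1-γ}) ∩ C([0,T]; H^{-γ}) ∩ L^∞(0,T; L^q) ∩ L^q(0,T; L^ξ)`.
The field `toFun` is a representative, up to null sets of `(0,T) × 𝕋ᵈ`, of the function; the field
`trace` is its representative in `C([0,T]; H^{-γ})`, giving the value at every time `t ∈ [0,T]`. -/
structure SolutionClass (d l : ℕ) (T γ q ξ : ℝ) where
  toFun : ℝ → Torus d → State l
  trace : ℝ → FourierFamily d l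
  aestronglyMeasurable : AEStronglyMeasurable (Function.uncurry toFun)
    ((volume.restrict (Ioo 0 T)).prod volume)
  trace_eq : ∀ᵐ t ∂(volume.restrict (Ioo (0 : ℝ) T)), trace t = torusFourier (toFun t)
  memL2H : ∫⁻ t in Ioo 0 T, sobolevNormSq (1 - γ) (torusFourier (toFun t)) < ⊤
  trace_mem : ∀ t ∈ Icc 0 T, trace t ∈ torusSobolev d l (-γ)
  trace_continuous : ∀ t ∈ Icc 0 T,
    Tendsto (fun s => sobolevNormSq (-γ) (trace s - trace t)) (𝓝[Icc 0 T] t) (𝓝 0)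
  memLinftyLq : essSup (fun t => eLpNorm (toFun t) (ENNReal.ofReal q) volume)
    (volume.restrict (Ioo 0 T)) < ⊤
  memLqLxi : mixedNorm q ξ T toFun < ⊤

/-- The structural assumptions on the reaction `f` and the flux `F` with growth exponent `h`.
Only the values at times `t > 0` matter. -/
structure ReactionAssumption {d l : ℕ} (h : ℝ)
    (f : Fin l → ℝ → Torus d → State l → ℝ)
    (F : Fin l → ℝ → Torus d → State l → EuclideanSpace ℝ (Fin d)) : Prop where
  measurable_f : ∀ i, Measurable
    (fun z : Ioi (0 : ℝ) × Torus d × State l => f i z.1 z.2.1 z.2.2)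
  measurable_F : ∀ i, Measurable
    (fun z : Ioi (0 : ℝ) × Torus d × State l => F i z.1 z.2.1 z.2.2)
  /-- Polynomial growth -/
  growth : ∃ C : ℝ, ∀ᵐ z ∂((volume.restrict (Ioi (0 : ℝ))).prod (volume : Measure (Torus d))),
    ∀ (i : Fin l) (y y' : State l),
      |f i z.1 z.2 y| ≤ C * (1 + ‖y‖ ^ h) ∧
      ‖F i z.1 z.2 y‖ ≤ C * (1 + ‖y‖ ^ ((h + 1) / 2)) ∧
      |f i z.1 z.2 y - f i z.1 z.2 y'| ≤
        C * (1 + ‖y‖ ^ (h - 1) + ‖y'‖ ^ (h - 1)) * ‖y - y'‖ ∧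
      ‖F i z.1 z.2 y - F i z.1 z.2 y'‖ ≤
        C * (1 + ‖y‖ ^ ((h - 1) / 2) + ‖y'‖ ^ ((h - 1) / 2)) * ‖y - y'‖
  /-- Positivity -/
  positivity : ∃ c : Fin l → ℝ → EuclideanSpace ℝ (Fin d),
    (∀ i, Measurable (fun t : Ioi (0 : ℝ) => c i t)) ∧
    ∀ᵐ z ∂((volume.restrict (Ioi (0 : ℝ))).prod (volume : Measure (Torus d))),
      ∀ (i : Fin l) (y : State l), (∀ j, 0 ≤ y j) → y i = 0 →
        0 ≤ f i z.1 z.2 y ∧ F i z.1 z.2 y = c i z.1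
  /-- Mass control -/
  mass : ∃ (α : Fin l → ℝ) (a₀ a₁ : ℝ), (∀ i, 0 < α i) ∧
    ∀ (t : ℝ), 0 < t → ∀ (x : Torus d) (y : State l), (∀ j, 0 ≤ y j) →
      ∑ i, α i * f i t x y ≤ a₀ + a₁ * ∑ i, y i

/-- The weak formulation on `[0,T]` of
`∂ₜ vᵢ = μᵢ Δ vᵢ + ρ(t) [div Fᵢ(·,v) + fᵢ(·,v)]`, `v(0) = v₀`, for a scalar function of time `ρ`:
for all smooth `η` and all `t ∈ [0,T]`,
`⟨v(t),η⟩ = ∫ v₀·η + ∑ᵢ ∫₀ᵗ ∫ (μᵢ vᵢ Δηᵢ + ρ(s) [fᵢ(s,x,v) ηᵢ - Fᵢ(s,x,v)·∇ηᵢ]) dx ds`. -/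
def WeakFormulation {d l : ℕ} {T γ q ξ : ℝ} (μ : Fin l → ℝ)
    (f : Fin l → ℝ → Torus d → State l → ℝ)
    (F : Fin l → ℝ → Torus d → State l → EuclideanSpace ℝ (Fin d))
    (v₀ : Torus d → State l) (ρ : ℝ → ℝ) (v : SolutionClass d l T γ q ξ) : Prop :=
  ∀ η : Torus d → State l, TorusSmooth η → ∀ t ∈ Icc 0 T,
    torusPairing (v.trace t) η =
      (∫ x, inner ℝ (v₀ x) (η x)) +
      ∑ i, ∫ s in (0 : ℝ)..t, ∫ x : Torus d,
        (μ i * v.toFun s x i * torusLaplacian (fun z => η z i) x +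
          ρ s * (f i s x (v.toFun s x) * η x i -
            ∑ j, F i s x (v.toFun s x) j * torusPartial j (fun z => η z i) x))

/-- Weak solutions of the deterministic reaction-diffusion system. -/
def IsWeakSolution {d l : ℕ} {T γ q ξ : ℝ} (μ : Fin l → ℝ)
    (f : Fin l → ℝ → Torus d → State l → ℝ)
    (F : Fin l → ℝ → Torus d → State l → EuclideanSpace ℝ (Fin d))
    (v₀ : Torus d → State l) (v : SolutionClass d l T γ q ξ) : Prop :=
  WeakFormulation μ f F v₀ (fun _ => 1) v

/-- The profiles `φ` used for cut-offs. -/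
def IsCutoffProfile (φ : ℝ → ℝ) : Prop :=
  ContDiff ℝ ((⊤ : ℕ∞) : WithTop ℕ∞) φ ∧ (∀ x ∈ Icc (0 : ℝ) 1, φ x = 1) ∧ ∀ x ∈ Ici (2 : ℝ), φ x = 0

/-- The cut-off `φ_{R,r}(t,v) = φ(R⁻¹ ‖v‖_{L^r(0,t;L^q)})`. -/
noncomputable def cutoff {d l : ℕ} (φ : ℝ → ℝ) (R r q : ℝ) (v : ℝ → Torus d → State l) (t : ℝ) : ℝ :=
  φ (R⁻¹ * (mixedNorm r q t v).toReal)

/-- Weak solutions of the reaction-diffusion system with cut-off. -/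
def IsCutoffWeakSolution {d l : ℕ} {T γ q ξ : ℝ} (φ : ℝ → ℝ) (R r : ℝ) (μ : Fin l → ℝ)
    (f : Fin l → ℝ → Torus d → State l → ℝ)
    (F : Fin l → ℝ → Torus d → State l → EuclideanSpace ℝ (Fin d))
    (v₀ : Torus d → State l) (v : SolutionClass d l T γ q ξ) : Prop :=
  WeakFormulation μ f F v₀ (cutoff φ R r q v.toFun) v

/-! As long as the cut-off equals one on `(0, S)`, both functions solve the same system there, and
the difference `w = v₁ - v₂` is governed by Duhamel's formula: `wᵢ` is the space-time convolution of
the heat kernel with `fᵢ(v₁) - fᵢ(v₂)`, plus that of its partial derivatives with the components of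
`Fᵢ(v₁) - Fᵢ(v₂)` (`sub_ae_eq_duhamel`). To reach it from the weak formulation, one tests with
trigonometric monomials. Each Fourier coefficient of `w` then satisfies a scalar linear integral
equation, solved by variation of constants, and the exponentials that appear are the Fourier
multipliers of the heat kernel.

Put `m = 1 + |v₁| + |v₂|`, which is bounded in `L^∞(0,T; L^q)`. The local Lipschitz bounds give
`|f(v₁) - f(v₂)| ≲ m^{h-1}|w|` and `|F(v₁) - F(v₂)| ≲ m^{(h-1)/2}|w|`. A kernel with `L¹` norm
`τ^{-β}` and sup norm `τ^{-β-d/2}` satisfies, by Hölder with three factors, `‖k(τ) * (m^{qθ} w)‖_ξ ≲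
τ^{-(β+dθ/2)} ‖m‖_q^{qθ} ‖w‖_ξ`. Here `β = 0`, `θ = (h-1)/q` for the reaction and `β = 1/2`, `θ =
(h-1)/(2q)` for the flux. Both time singularities are integrable exactly when `q > d(h-1)/2`, and a
singular Gronwall lemma then yields `w = 0` on `(0, S)` (`ae_eq_of_weakFormulation`). The exponent
`ξ` matters through `(h-1)/q ≤ 1 - 1/ξ`, which is the room Hölder needs and also makes `|v|^h`
integrable in space-time.

It remains to see that the cut-off never acts. If `v₁ = v₂` on `(0, S)`, then the `r`-th power of
`‖v₂‖_{L^r(0,S+δ;L^q)}` is at most `(R-1)^r + e^r δ`, where `e` bounds `v₂` in `L^∞(0,T; L^q)`. This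
stays below `R^r` for a `δ` that does not depend on `S`, so finitely many steps cover `[0, T]`.
Equality of the traces at every time follows from the integrated Fourier identity. -/

/-! ### Fourier coefficients on the torus. -/

theorem volume_unitAddCircle_eq_haar :
    (volume : Measure UnitAddCircle) = AddCircle.haarAddCircle := by
  rw [AddCircle.volume_eq_smul_haarAddCircle]; simp

instance isProbabilityMeasure_volume_unitAddCircle :
    IsProbabilityMeasure (volume : Measure UnitAddCircle) := by
  rw [volume_unitAddCircle_eq_haar]; infer_instance

instance isAddHaarMeasure_volume_unitAddCircle :
    (volume : Measure UnitAddCircle).IsAddHaarMeasure := by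
  rw [volume_unitAddCircle_eq_haar]; infer_instance

instance isNegInvariant_volume_unitAddCircle :
    (volume : Measure UnitAddCircle).IsNegInvariant := by
  infer_instance

instance isProbabilityMeasure_volume_torus (d : ℕ) :
    IsProbabilityMeasure (volume : Measure (Torus d)) :=
  inferInstanceAs (IsProbabilityMeasure (Measure.pi fun _ : Fin d => volume))

theorem mFourierCoeff_eq_integral_volume {d : ℕ} (f : Torus d → ℂ) (n : Fin d → ℤ) :
    UnitAddTorus.mFourierCoeff f n = ∫ x : Torus d, UnitAddTorus.mFourier (-n) x * f x := by
  have h : (volume : Measure (Torus d)) =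
      Measure.pi (fun _ : Fin d => (AddCircle.haarAddCircle : Measure UnitAddCircle)) := by
    rw [← volume_unitAddCircle_eq_haar]; rfl
  rw [h]; rfl

theorem norm_mFourier_apply {d : ℕ} (n : Fin d → ℤ) (x : Torus d) :
    ‖UnitAddTorus.mFourier n x‖ = 1 := by
  simp [UnitAddTorus.mFourier, fourier_apply, Circle.norm_coe]

theorem mFourier_add_apply {d : ℕ} (n : Fin d → ℤ) (x y : Torus d) :
    UnitAddTorus.mFourier n (x + y) = UnitAddTorus.mFourier n x * UnitAddTorus.mFourier n y := by
  simp [UnitAddTorus.mFourier, fourier_apply, Finset.prod_mul_distrib, smul_add,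
    AddCircle.toCircle_add]

theorem integrable_mFourier_mul {d : ℕ} (n : Fin d → ℤ) {f : Torus d → ℂ}
    (hf : Integrable f) : Integrable (fun x => UnitAddTorus.mFourier n x * f x) := by
  refine hf.bdd_mul (c := 1) ?_ ?_
  · exact (UnitAddTorus.mFourier n).continuous.aestronglyMeasurable
  · exact Eventually.of_forall fun x => (norm_mFourier_apply n x).le

theorem mFourierCoeff_sub {d : ℕ} {f g : Torus d → ℂ} (hf : Integrable f) (hg : Integrable g)
    (n : Fin d → ℤ) : UnitAddTorus.mFourierCoeff (fun x => f x - g x) n =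
      UnitAddTorus.mFourierCoeff f n - UnitAddTorus.mFourierCoeff g n := by
  simp only [mFourierCoeff_eq_integral_volume, mul_sub]
  exact integral_sub (integrable_mFourier_mul _ hf) (integrable_mFourier_mul _ hg)

theorem mFourierCoeff_add {d : ℕ} {f g : Torus d → ℂ} (hf : Integrable f) (hg : Integrable g)
    (n : Fin d → ℤ) : UnitAddTorus.mFourierCoeff (fun x => f x + g x) n =
      UnitAddTorus.mFourierCoeff f n + UnitAddTorus.mFourierCoeff g n := by
  simp only [mFourierCoeff_eq_integral_volume, mul_add]
  exact integral_add (integrable_mFourier_mul _ hf) (integrable_mFourier_mul _ hg)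

theorem mFourierCoeff_sum {d : ℕ} {ι : Type*} (s : Finset ι) {f : ι → Torus d → ℂ}
    (hf : ∀ i ∈ s, Integrable (f i)) (n : Fin d → ℤ) :
    UnitAddTorus.mFourierCoeff (fun x => ∑ i ∈ s, f i x) n =
      ∑ i ∈ s, UnitAddTorus.mFourierCoeff (f i) n := by
  simp only [mFourierCoeff_eq_integral_volume, Finset.mul_sum]
  exact integral_finsetSum _ fun i hi => integrable_mFourier_mul _ (hf i hi)

/-- An integrable function on the torus whose Fourier coefficients vanish is orthogonal to all
continuous functions. -/
theorem integral_mul_continuous_eq_zero_of_mFourierCoeff_eq_zero {d : ℕ} {u : Torus d → ℂ}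
    (hu : Integrable u) (h : ∀ n, UnitAddTorus.mFourierCoeff u n = 0) (φ : C(Torus d, ℂ)) :
    ∫ x, φ x * u x = 0 := by
  have hint : ∀ φ : C(Torus d, ℂ), Integrable (fun x => φ x * u x) := fun φ =>
    hu.bdd_mul (c := ‖φ‖) φ.continuous.aestronglyMeasurable
      (Eventually.of_forall fun x => φ.norm_coe_le_norm x)
  let L : C(Torus d, ℂ) →ₗ[ℂ] ℂ :=
    { toFun := fun φ => ∫ x, φ x * u x
      map_add' := fun φ ψ => by
        simp only [ContinuousMap.add_apply, add_mul]
        exact integral_add (hint φ) (hint ψ)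
      map_smul' := fun c φ => by
        simp only [ContinuousMap.smul_apply, smul_eq_mul, mul_assoc, RingHom.id_apply]
        exact integral_const_mul _ _ }
  let L' : C(Torus d, ℂ) →L[ℂ] ℂ := L.mkContinuous (∫ x, ‖u x‖) fun φ => by
    calc ‖∫ x, φ x * u x‖ ≤ ∫ x, ‖φ x * u x‖ := norm_integral_le_integral_norm _
      _ ≤ ∫ x, ‖φ‖ * ‖u x‖ := by
          refine integral_mono (hint φ).norm (hu.norm.const_mul _) fun x => ?_
          simp only [norm_mul]
          gcongr
          exact φ.norm_coe_le_norm x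
      _ = _ := by rw [integral_const_mul, mul_comm]
  -- The kernel of `L'` is closed and contains every monomial, and trigonometric polynomials are
  -- uniformly dense in the continuous functions.
  have hker : (Submodule.span ℂ (range UnitAddTorus.mFourier)).topologicalClosure ≤
      LinearMap.ker (L' : C(Torus d, ℂ) →ₗ[ℂ] ℂ) := by
    refine Submodule.topologicalClosure_minimal _ ?_ L'.isClosed_ker
    rw [Submodule.span_le]
    rintro _ ⟨n, rfl⟩
    have := h (-n)
    rw [mFourierCoeff_eq_integral_volume, neg_neg] at this
    exact this
  rw [UnitAddTorus.span_mFourier_closure_eq_top] at hker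
  exact hker (Submodule.mem_top (x := φ))

/-- An integrable real function on the torus is determined by its Fourier coefficients. -/
theorem ae_eq_zero_of_mFourierCoeff_eq_zero {d : ℕ} {u : Torus d → ℝ}
    (hu : Integrable u) (h : ∀ n, UnitAddTorus.mFourierCoeff (fun x => (u x : ℂ)) n = 0) :
    u =ᵐ[volume] 0 := by
  have key : ∀ φ : BoundedContinuousFunction (Torus d) ℝ, ∫ x, φ x * u x = 0 := by
    intro φ
    have := integral_mul_continuous_eq_zero_of_mFourierCoeff_eq_zero
      (u := fun x => (u x : ℂ)) hu.ofReal h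
      ⟨fun x => (φ x : ℂ), Complex.continuous_ofReal.comp φ.continuous⟩
    simp only [ContinuousMap.coe_mk] at this
    have h2 : ∫ x, (φ x : ℂ) * (u x : ℂ) = ((∫ x, φ x * u x : ℝ) : ℂ) := by
      rw [← integral_complex_ofReal]; simp
    rw [h2] at this
    exact_mod_cast this
  have hm : ∀ w : Torus d → ℝ, Integrable w →
      IsFiniteMeasure ((volume : Measure (Torus d)).withDensity fun x => ENNReal.ofReal (w x)) :=
    fun w hw => isFiniteMeasure_withDensity_ofReal hw.2
  have hdens : ∀ w : Torus d → ℝ, Integrable w → ∀ φ : BoundedContinuousFunction (Torus d) ℝ,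
      ∫ x, φ x ∂((volume : Measure (Torus d)).withDensity fun x => ENNReal.ofReal (w x)) =
        ∫ x, φ x * max (w x) 0 := by
    intro w hw φ
    rw [integral_withDensity_eq_integral_toReal_smul₀ hw.aemeasurable.ennreal_ofReal
      (Eventually.of_forall fun x => ENNReal.ofReal_lt_top)]
    refine integral_congr_ae (Eventually.of_forall fun x => ?_)
    simp [ENNReal.toReal_ofReal', mul_comm]
  have := hm _ hu
  have := hm _ hu.neg
  -- The positive and negative parts of `u` are densities of finite measures with the same integrals
  -- against bounded continuous functions. Hence the measures coincide, the two parts agree almost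
  -- everywhere, and both vanish since at most one is nonzero at each point.
  have heq : (volume : Measure (Torus d)).withDensity (fun x => ENNReal.ofReal (u x)) =
      (volume : Measure (Torus d)).withDensity (fun x => ENNReal.ofReal ((-u) x)) := by
    refine ext_of_forall_integral_eq_of_IsFiniteMeasure fun φ => ?_
    rw [hdens _ hu, hdens _ hu.neg, ← sub_eq_zero, ← integral_sub]
    · refine Eq.trans ?_ (key φ)
      refine integral_congr_ae (Eventually.of_forall fun x => ?_)
      simp only [Pi.neg_apply]
      rcases le_total (u x) 0 with h | h
      · simp [h]
      · simp [h]
    · exact hu.pos_part.bdd_mul (c := ‖φ‖) φ.continuous.aestronglyMeasurable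
        (Eventually.of_forall fun x => φ.norm_coe_le_norm x)
    · exact hu.neg.pos_part.bdd_mul (c := ‖φ‖) φ.continuous.aestronglyMeasurable
        (Eventually.of_forall fun x => φ.norm_coe_le_norm x)
  have hae := (withDensity_eq_iff hu.aemeasurable.ennreal_ofReal
    hu.neg.aemeasurable.ennreal_ofReal hu.lintegral_lt_top.ne).1 heq
  filter_upwards [hae] with x hx
  simp only [Pi.neg_apply, Pi.zero_apply] at hx ⊢
  rcases le_total (u x) 0 with h | h
  · rw [ENNReal.ofReal_of_nonpos h, eq_comm, ENNReal.ofReal_eq_zero] at hx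
    linarith
  · rw [ENNReal.ofReal_of_nonpos (by linarith : -u x ≤ 0), ENNReal.ofReal_eq_zero] at hx
    linarith

theorem integral_fourier (n : ℤ) :
    ∫ x : UnitAddCircle, (fourier n x : ℂ) = if n = 0 then 1 else 0 := by
  have h := (orthonormal_iff_ite.mp (orthonormal_fourier (T := 1))) 0 n
  simp only [ContinuousMap.inner_toLp, fourier_zero, map_one, mul_one] at h
  rw [volume_unitAddCircle_eq_haar, h]
  simp [eq_comm]

/-- The Fourier coefficients of an absolutely convergent Fourier series. -/
theorem integral_fourier_neg_mul_of_hasSum {c : ℤ → ℂ} (hc : Summable fun n => ‖c n‖)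
    {f : UnitAddCircle → ℂ} (hf : ∀ x, HasSum (fun n => c n * fourier n x) (f x)) (n : ℤ) :
    ∫ x : UnitAddCircle, fourier (-n) x * f x = c n := by
  have hterm : ∀ m : ℤ, ∀ x : UnitAddCircle,
      fourier (-n) x * (c m * fourier m x) = c m * fourier (m - n) x := fun m x => by
    rw [sub_eq_add_neg, fourier_add]; ring
  have hnorm : ∀ (m : ℤ) (x : UnitAddCircle), ‖(fourier m x : ℂ)‖ = 1 := fun m x => by
    simp [fourier_apply, Circle.norm_coe]
  have h := hasSum_integral_of_summable_integral_norm (μ := (volume : Measure UnitAddCircle))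
    (F := fun m x => c m * (fourier (m - n) x : ℂ)) (fun m => by
      refine Integrable.const_mul ?_ _
      exact Integrable.of_bound (fourier (m - n)).continuous.aestronglyMeasurable 1
        (Eventually.of_forall fun x => (hnorm _ x).le)) (by
      simpa [hnorm, -fourier_apply] using hc)
  have hsum : ∀ x, ∑' m, c m * (fourier (m - n) x : ℂ) = fourier (-n) x * f x := fun x => by
    simp only [← hterm]
    rw [tsum_mul_left, (hf x).tsum_eq]
  simp only [hsum] at h
  refine h.unique ?_
  have : ∀ m, ∫ x : UnitAddCircle, c m * (fourier (m - n) x : ℂ) = if m = n then c n else 0 := by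
    intro m
    rw [integral_const_mul, integral_fourier]
    by_cases hm : m = n
    · simp [hm]
    · simp [hm, sub_eq_zero]
  simp only [this]
  exact hasSum_ite_eq n (c n)

/-! ### The heat kernel of the circle. -/

/-- Joint measurability of a family of functions on the circle given by a lift which is continuous
for positive times and vanishes otherwise. -/
theorem measurable_of_lift_unitAddCircle {k : ℝ × UnitAddCircle → ℝ} {G : ℂ → ℂ → ℂ}
    (hG : ∀ z τ : ℂ, 0 < τ.im → ContinuousAt (fun p : ℂ × ℂ => G p.1 p.2) (z, τ))
    (hG0 : ∀ z τ : ℂ, τ.im ≤ 0 → G z τ = 0)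
    (hk : ∀ t a : ℝ, (k (t, (a : UnitAddCircle)) : ℂ) = G a (Complex.I * t)) :
    Measurable k := by
  have h1 : Measurable fun z : ℝ × ℝ => (G z.2 (Complex.I * z.1)).re := by
    classical
    have hs : MeasurableSet {z : ℝ × ℝ | 0 < z.1} := measurableSet_lt measurable_const measurable_fst
    have : (fun z : ℝ × ℝ => (G z.2 (Complex.I * z.1)).re) =
        Set.piecewise {z : ℝ × ℝ | 0 < z.1}
          (fun z : ℝ × ℝ => (G z.2 (Complex.I * z.1)).re) (fun _ => 0) := by
      funext z
      by_cases hz : 0 < z.1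
      · rw [Set.piecewise_eq_of_mem {z : ℝ × ℝ | 0 < z.1} _ _ hz]
      · rw [Set.piecewise_eq_of_notMem {z : ℝ × ℝ | 0 < z.1} _ _ hz,
          hG0 _ _ (by simpa using hz)]
        simp
    rw [this]
    refine ContinuousOn.measurable_piecewise ?_ continuousOn_const hs
    intro z hz
    refine ContinuousAt.continuousWithinAt ?_
    refine Complex.continuous_re.continuousAt.comp ?_
    have h2 : ContinuousAt (fun p : ℂ × ℂ => G p.1 p.2)
        ((z.2 : ℂ), Complex.I * z.1) := hG _ _ (by simpa using hz)
    exact h2.comp (f := fun z : ℝ × ℝ => ((z.2 : ℂ), Complex.I * (z.1 : ℂ))) (by fun_prop)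
  -- The fundamental interval `(0, 1]` gives a measurable section of `ℝ → ℝ/ℤ`, through which `k`
  -- factors.
  have h2 : Measurable fun z : ℝ × UnitAddCircle =>
      (z.1, ((AddCircle.measurableEquivIoc 1 0 z.2 : Ioc (0 : ℝ) (0 + 1)) : ℝ)) :=
    measurable_fst.prodMk (measurable_subtype_coe.comp
      ((AddCircle.measurableEquivIoc 1 0).measurable.comp measurable_snd))
  have h3 : k = (fun z : ℝ × ℝ => (G z.2 (Complex.I * z.1)).re) ∘
      fun z => (z.1, ((AddCircle.measurableEquivIoc 1 0 z.2 : Ioc (0 : ℝ) (0 + 1)) : ℝ)) := by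
    funext z
    have hz : ((AddCircle.measurableEquivIoc 1 0 z.2 : Ioc (0 : ℝ) (0 + 1)) : UnitAddCircle) =
      z.2 := AddCircle.coe_equivIoc
    rw [Function.comp_apply, ← hk, Complex.ofReal_re, hz]
  rw [h3]
  exact h1.comp h2

/-- The heat kernel of the circle `ℝ/ℤ`. -/
noncomputable def circleHeat (τ : ℝ) (x : UnitAddCircle) : ℝ :=
  -- The theta series has coefficients `exp(-πn²t)`; at `t = 4πτ` these are the heat multipliers
  -- `exp(-4π²n²τ)`.
  HurwitzZeta.cosKernel x (4 * Real.pi * τ)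

/-- The space derivative of the heat kernel of the circle `ℝ/ℤ`. -/
noncomputable def circleHeatDeriv (τ : ℝ) (x : UnitAddCircle) : ℝ :=
  -- The sine kernel has Fourier coefficients `-i n exp(-πn²t)`, so the factor `-2π` produces the
  -- symbol `2πi n` of the derivative.
  -2 * Real.pi * HurwitzZeta.sinKernel x (4 * Real.pi * τ)

theorem measurable_circleHeat : Measurable fun z : ℝ × UnitAddCircle => circleHeat z.1 z.2 := by
  have h : Measurable fun z : ℝ × UnitAddCircle => HurwitzZeta.cosKernel z.2 z.1 :=
    measurable_of_lift_unitAddCircle (G := jacobiTheta₂) (fun z τ h => continuousAt_jacobiTheta₂ z h)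
      (fun z τ h => jacobiTheta₂_undef z h) (fun t a => HurwitzZeta.cosKernel_def a t)
  exact h.comp (g := fun z : ℝ × UnitAddCircle => HurwitzZeta.cosKernel z.2 z.1)
    (f := fun z : ℝ × UnitAddCircle => (4 * Real.pi * z.1, z.2))
    ((measurable_const.mul measurable_fst).prodMk measurable_snd)

theorem measurable_circleHeatDeriv :
    Measurable fun z : ℝ × UnitAddCircle => circleHeatDeriv z.1 z.2 := by
  have h : Measurable fun z : ℝ × UnitAddCircle =>
      -2 * Real.pi * HurwitzZeta.sinKernel z.2 z.1 := by
    refine measurable_of_lift_unitAddCircle (G := jacobiTheta₂')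
      (fun z τ h => continuousAt_jacobiTheta₂' z h) (fun z τ h => jacobiTheta₂'_undef z h)
      (fun t a => ?_)
    rw [Complex.ofReal_mul, HurwitzZeta.sinKernel_def]
    push_cast
    exact mul_div_cancel₀ _ (by simp [Real.pi_ne_zero])
  exact h.comp (g := fun z : ℝ × UnitAddCircle => -2 * Real.pi * HurwitzZeta.sinKernel z.2 z.1)
    (f := fun z : ℝ × UnitAddCircle => (4 * Real.pi * z.1, z.2))
    ((measurable_const.mul measurable_fst).prodMk measurable_snd)

/-- The value zero is the convention for the theta kernel outside its domain. It makes the kernel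
causal, so a convolution over all of `(0, T)` only sees times `s < t`. -/
theorem circleHeat_of_nonpos {τ : ℝ} (h : τ ≤ 0) (x : UnitAddCircle) : circleHeat τ x = 0 :=
  HurwitzZeta.cosKernel_undef x (mul_nonpos_of_nonneg_of_nonpos (by positivity) h)

theorem circleHeatDeriv_of_nonpos {τ : ℝ} (h : τ ≤ 0) (x : UnitAddCircle) :
    circleHeatDeriv τ x = 0 := by
  rw [circleHeatDeriv,
    HurwitzZeta.sinKernel_undef x (mul_nonpos_of_nonneg_of_nonpos (by positivity) h), mul_zero]

theorem integral_fourier_mul_circleHeat {τ : ℝ} (hτ : 0 < τ) (n : ℤ) :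
    ∫ x : UnitAddCircle, fourier (-n) x * (circleHeat τ x : ℂ) =
      (Real.exp (-(4 * Real.pi ^ 2 * n ^ 2 * τ)) : ℝ) := by
  have ht : 0 < 4 * Real.pi * τ := by positivity
  refine integral_fourier_neg_mul_of_hasSum
    (c := fun n => ((Real.exp (-(4 * Real.pi ^ 2 * n ^ 2 * τ)) : ℝ) : ℂ)) ?_ ?_ n
  · have := (HurwitzZeta.hasSum_int_evenKernel 0 ht).summable.norm
    refine this.congr fun n => ?_
    rw [Complex.norm_real]
    congr 2
    ring_nf
  · intro x
    induction x using QuotientAddGroup.induction_on with | H a =>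
    have := HurwitzZeta.hasSum_int_cosKernel a ht
    refine this.congr_fun fun n => ?_
    erw [fourier_coe_apply]
    rw [mul_comm]
    congr 2
    · push_cast; ring
    · ring_nf

theorem integral_fourier_mul_circleHeatDeriv {τ : ℝ} (hτ : 0 < τ) (n : ℤ) :
    ∫ x : UnitAddCircle, fourier (-n) x * (circleHeatDeriv τ x : ℂ) =
      2 * Real.pi * Complex.I * n * (Real.exp (-(4 * Real.pi ^ 2 * n ^ 2 * τ)) : ℝ) := by
  have ht : 0 < 4 * Real.pi * τ := by positivity
  refine integral_fourier_neg_mul_of_hasSum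
    (c := fun n => 2 * Real.pi * Complex.I * n *
      ((Real.exp (-(4 * Real.pi ^ 2 * n ^ 2 * τ)) : ℝ) : ℂ)) ?_ ?_ n
  · have := ((HurwitzZeta.hasSum_int_oddKernel 0 ht).summable.norm).mul_left (2 * Real.pi)
    refine this.congr fun n => ?_
    simp only [norm_mul, Complex.norm_real, Complex.norm_I, Complex.norm_intCast, add_zero,
      Complex.norm_ofNat, Real.norm_eq_abs, abs_of_pos Real.pi_pos, mul_one]
    rw [show -Real.pi * (n : ℝ) ^ 2 * (4 * Real.pi * τ) = -(4 * Real.pi ^ 2 * n ^ 2 * τ) by ring]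
    ring
  · intro x
    induction x using QuotientAddGroup.induction_on with | H a =>
    have := (HurwitzZeta.hasSum_int_sinKernel a ht).mul_left ((-2 * Real.pi : ℝ) : ℂ)
    unfold circleHeatDeriv
    rw [Complex.ofReal_mul]
    refine this.congr_fun fun n => ?_
    erw [fourier_coe_apply]
    push_cast
    rw [show (2 * Real.pi * Complex.I * n * a / 1 : ℂ) = 2 * Real.pi * Complex.I * a * n by ring, show (-(4 * Real.pi ^ 2 * n ^ 2 * τ) : ℂ) =
      -Real.pi * n ^ 2 * (4 * Real.pi * τ) by ring]
    ring

/-- Poisson summation, in the form of the theta functional equation, turns the Fourier series into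
the periodised Gaussian `∑ exp(-(x+n)²/(4τ))`. Positivity, monotonicity and small-time size are
visible only in this form. -/
theorem circleHeat_eq_evenKernel {τ : ℝ} (hτ : 0 < τ) (x : UnitAddCircle) :
    circleHeat τ x = (4 * Real.pi * τ) ^ (-(1 / 2) : ℝ) *
      HurwitzZeta.evenKernel x (1 / (4 * Real.pi * τ)) := by
  have ht : 0 < 4 * Real.pi * τ := by positivity
  rw [HurwitzZeta.evenKernel_functional_equation, one_div_one_div, circleHeat, one_div (4 * _ * _),
    Real.inv_rpow ht.le, Real.rpow_neg ht.le]
  field_simp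

theorem circleHeat_nonneg (τ : ℝ) (x : UnitAddCircle) : 0 ≤ circleHeat τ x := by
  rcases le_or_gt τ 0 with h | h
  · exact (circleHeat_of_nonpos h x).ge
  · rw [circleHeat_eq_evenKernel h]
    refine mul_nonneg (by positivity) ?_
    induction x using QuotientAddGroup.induction_on with | H a =>
    exact (HurwitzZeta.hasSum_int_evenKernel a (by positivity)).nonneg fun n => by positivity

theorem evenKernel_antitone (x : UnitAddCircle) {s t : ℝ} (hs : 0 < s) (hst : s ≤ t) :
    HurwitzZeta.evenKernel x t ≤ HurwitzZeta.evenKernel x s := by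
  induction x using QuotientAddGroup.induction_on with | H a =>
  refine hasSum_le (fun n => ?_) (HurwitzZeta.hasSum_int_evenKernel a (hs.trans_le hst))
    (HurwitzZeta.hasSum_int_evenKernel a hs)
  refine Real.exp_le_exp.2 ?_
  have : 0 ≤ Real.pi * (n + a) ^ 2 := by positivity
  nlinarith

/-- All Fourier coefficients are positive, so the triangle inequality for the series is an equality
at the origin. -/
theorem circleHeat_le_circleHeat_zero {τ : ℝ} (hτ : 0 < τ) (x : UnitAddCircle) :
    circleHeat τ x ≤ circleHeat τ 0 := by
  have ht : 0 < 4 * Real.pi * τ := by positivity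
  induction x using QuotientAddGroup.induction_on with | H a =>
  have h1 := HurwitzZeta.hasSum_int_cosKernel a ht
  have h2 := HurwitzZeta.hasSum_int_evenKernel 0 ht
  have h3 : (circleHeat τ 0) = HurwitzZeta.evenKernel (0 : ℝ) (4 * Real.pi * τ) := by
    rw [show ((0 : ℝ) : UnitAddCircle) = 0 from rfl, HurwitzZeta.evenKernel_eq_cosKernel_of_zero, circleHeat]
  rw [h3, ← h2.tsum_eq]
  refine (le_abs_self _).trans ?_
  have h4 : |circleHeat τ a| = ‖((HurwitzZeta.cosKernel a (4 * Real.pi * τ) : ℝ) : ℂ)‖ := by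
    rw [Complex.norm_real]; rfl
  refine h4.le.trans ?_
  rw [← h1.tsum_eq]
  refine tsum_of_norm_bounded h2.summable.hasSum fun n => ?_
  rw [norm_mul, Complex.norm_real, Real.norm_eq_abs, abs_of_pos (Real.exp_pos _),
    show (2 * Real.pi * Complex.I * a * n : ℂ) = ((2 * Real.pi * a * n : ℝ) : ℂ) * Complex.I by
      push_cast; ring, Complex.norm_exp_ofReal_mul_I, one_mul, add_zero]

/-- Small-time bound for the heat kernel of the circle. -/
theorem exists_circleHeat_le (T : ℝ) (hT : 0 < T) :
    ∃ C, 0 < C ∧ ∀ τ, 0 < τ → τ ≤ T → ∀ x, circleHeat τ x ≤ C * τ ^ (-(1 / 2) : ℝ) := by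
  refine ⟨(4 * Real.pi) ^ (-(1 / 2) : ℝ) *
    (1 + |HurwitzZeta.evenKernel 0 (1 / (4 * Real.pi * T))|), by positivity, fun τ hτ hτT x => ?_⟩
  refine (circleHeat_le_circleHeat_zero hτ x).trans ?_
  -- For `τ ≤ T` the Gaussian sum at time `τ` is at most the one at time `T`; the only blow-up left
  -- is the prefactor `τ^{-1/2}`.
  have h := evenKernel_antitone 0 (s := 1 / (4 * Real.pi * T)) (t := 1 / (4 * Real.pi * τ))
    (by positivity) (by gcongr)
  rw [circleHeat_eq_evenKernel hτ, Real.mul_rpow (x := 4 * Real.pi) (by positivity) hτ.le]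
  calc _ ≤ (4 * Real.pi) ^ (-(1 / 2) : ℝ) * τ ^ (-(1 / 2) : ℝ) *
        (1 + |HurwitzZeta.evenKernel 0 (1 / (4 * Real.pi * T))|) := by
        gcongr
        linarith [le_abs_self (HurwitzZeta.evenKernel 0 (1 / (4 * Real.pi * T)))]
    _ = _ := by ring

/-- Each Gaussian widens as time doubles, while the prefactor loses only `√2`. This moves the
undifferentiated factors of a product kernel to the time `2τ` that occurs in the derivative bound.
-/
theorem circleHeat_le_circleHeat_two_mul {τ : ℝ} (hτ : 0 < τ) (x : UnitAddCircle) :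
    circleHeat τ x ≤ 2 * circleHeat (2 * τ) x := by
  rw [circleHeat_eq_evenKernel hτ, circleHeat_eq_evenKernel (by positivity : 0 < 2 * τ)]
  have h := evenKernel_antitone x (s := 1 / (4 * Real.pi * (2 * τ))) (t := 1 / (4 * Real.pi * τ))
    (by positivity) (by gcongr; linarith)
  have h0 : 0 ≤ HurwitzZeta.evenKernel x (1 / (4 * Real.pi * τ)) := by
    have := circleHeat_nonneg τ x
    rw [circleHeat_eq_evenKernel hτ] at this
    exact nonneg_of_mul_nonneg_right this (by positivity)
  rw [show 4 * Real.pi * (2 * τ) = 2 * (4 * Real.pi * τ) by ring] at h ⊢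
  rw [Real.mul_rpow (x := 2) (by positivity) (by positivity)]
  have h2 : (1 : ℝ) ≤ 2 * 2 ^ (-(1 / 2) : ℝ) := by
    rw [← Real.rpow_one_add' (by norm_num) (by norm_num)]
    exact Real.one_le_rpow (by norm_num) (by norm_num)
  calc _ ≤ (4 * Real.pi * τ) ^ (-(1 / 2) : ℝ) *
        HurwitzZeta.evenKernel x (1 / (2 * (4 * Real.pi * τ))) := by gcongr
    _ ≤ (2 * 2 ^ (-(1 / 2) : ℝ)) * ((4 * Real.pi * τ) ^ (-(1 / 2) : ℝ) *
        HurwitzZeta.evenKernel x (1 / (2 * (4 * Real.pi * τ)))) := by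
        refine le_mul_of_one_le_left ?_ h2
        exact mul_nonneg (by positivity) (h0.trans h)
    _ = _ := by ring

/-- Term by term, half of the Gaussian absorbs the linear factor: `|y| exp(-πy²s/2) ≤ s^{-1/2}`. -/
theorem abs_oddKernel_le (x : UnitAddCircle) {s : ℝ} (hs : 0 < s) :
    |HurwitzZeta.oddKernel x s| ≤ s ^ (-(1 / 2) : ℝ) * HurwitzZeta.evenKernel x (s / 2) := by
  induction x using QuotientAddGroup.induction_on with | H a =>
  have h1 := HurwitzZeta.hasSum_int_oddKernel a hs
  have h2 := HurwitzZeta.hasSum_int_evenKernel a (half_pos hs)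
  rw [← Real.norm_eq_abs]
  refine le_of_eq_of_le (by rw [← h1.tsum_eq]) (tsum_of_norm_bounded (h2.mul_left _) fun n => ?_)
  rw [norm_mul, Real.norm_eq_abs, Real.norm_eq_abs, abs_of_pos (Real.exp_pos _),
    show -Real.pi * (n + a) ^ 2 * s = -Real.pi * (n + a) ^ 2 * (s / 2) +
      -(Real.pi * (n + a) ^ 2 * (s / 2)) by ring, Real.exp_add, mul_left_comm,
    mul_comm (s ^ _)]
  refine mul_le_mul_of_nonneg_left ?_ (Real.exp_pos _).le
  rw [Real.exp_neg, ← div_eq_mul_inv, div_le_iff₀ (Real.exp_pos _), Real.rpow_neg hs.le,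
    ← Real.sqrt_eq_rpow, inv_mul_eq_div, le_div_iff₀ (Real.sqrt_pos.2 hs)]
  have h3 : (|n + a| * √s) ^ 2 = (n + a) ^ 2 * s := by
    rw [mul_pow, sq_abs, Real.sq_sqrt hs.le]
  have h4 := Real.add_one_le_exp (Real.pi * (n + a) ^ 2 * (s / 2))
  have h5 : 0 ≤ (n + a) ^ 2 * s := by positivity
  nlinarith [Real.pi_gt_three, sq_nonneg (|n + a| * √s - 1)]

/-- The odd functional equation gives a Gaussian-type sum at `s = 1/(4πτ)`. Halving `s` in
`abs_oddKernel_le` means doubling the time, and the powers of `s` combine to `s^{1/2}`, a multiple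
of `τ^{-1/2}`. -/
theorem abs_circleHeatDeriv_le {τ : ℝ} (hτ : 0 < τ) (x : UnitAddCircle) :
    |circleHeatDeriv τ x| ≤ 8 * τ ^ (-(1 / 2) : ℝ) * circleHeat (2 * τ) x := by
  have ht : 0 < 4 * Real.pi * τ := by positivity
  set s := 1 / (4 * Real.pi * τ) with hs
  have hs0 : 0 < s := by positivity
  have hst : 4 * Real.pi * τ = 1 / s := by rw [hs, one_div_one_div]
  have h1 : HurwitzZeta.sinKernel x (4 * Real.pi * τ) =
      s ^ (3 / 2 : ℝ) * HurwitzZeta.oddKernel x s := by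
    rw [HurwitzZeta.oddKernel_functional_equation, ← hst]
    field_simp
  have h2 : HurwitzZeta.evenKernel x (s / 2) = (s / 2) ^ (-(1 / 2) : ℝ) * circleHeat (2 * τ) x := by
    rw [HurwitzZeta.evenKernel_functional_equation, Real.rpow_neg (by positivity), circleHeat,
      show 1 / (s / 2) = 2 * (1 / s) by field_simp, ← hst, one_div]
    ring_nf
  have h3 := abs_oddKernel_le x hs0
  rw [h2] at h3
  rw [circleHeatDeriv, h1, abs_mul (-2 * Real.pi), abs_mul (s ^ _), abs_of_nonneg (Real.rpow_nonneg hs0.le _)]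
  have h4 : s ^ (3 / 2 : ℝ) * (s ^ (-(1 / 2) : ℝ) * (s / 2) ^ (-(1 / 2) : ℝ)) =
      2 ^ (1 / 2 : ℝ) * (4 * Real.pi) ^ (-(1 / 2) : ℝ) * τ ^ (-(1 / 2) : ℝ) := by
    have e1 : (s / 2) ^ (-(1 / 2) : ℝ) = s ^ (-(1 / 2) : ℝ) * 2 ^ (1 / 2 : ℝ) := by
      rw [Real.div_rpow hs0.le (by norm_num), div_eq_mul_inv, Real.rpow_neg (x := 2) (by norm_num),
        inv_inv]
    have e2 : s ^ (1 / 2 : ℝ) = (4 * Real.pi) ^ (-(1 / 2) : ℝ) * τ ^ (-(1 / 2) : ℝ) := by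
      rw [← Real.mul_rpow (by positivity) hτ.le, hs, one_div, Real.inv_rpow ht.le,
        Real.rpow_neg ht.le]
    have e3 : s ^ (3 / 2 : ℝ) * (s ^ (-(1 / 2) : ℝ) * s ^ (-(1 / 2) : ℝ)) = s ^ (1 / 2 : ℝ) := by
      rw [← Real.rpow_add hs0, ← Real.rpow_add hs0]; norm_num
    rw [e1, ← mul_assoc (s ^ (-(1 / 2) : ℝ)), ← mul_assoc, e3, e2]
    ring
  have h5 : |-2 * Real.pi| * (2 ^ (1 / 2 : ℝ) * (4 * Real.pi) ^ (-(1 / 2) : ℝ)) ≤ 8 := by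
    rw [abs_mul, abs_of_pos Real.pi_pos, abs_neg, abs_two]
    have a1 : (2 : ℝ) ^ (1 / 2 : ℝ) ≤ 2 := by
      conv_rhs => rw [← Real.rpow_one 2]
      exact Real.rpow_le_rpow_of_exponent_le (by norm_num) (by norm_num)
    have a2 : (4 * Real.pi) ^ (-(1 / 2) : ℝ) ≤ 1 / 2 := by
      have : (4 * Real.pi) ^ (-(1 / 2) : ℝ) ≤ (4 : ℝ) ^ (-(1 / 2) : ℝ) :=
        Real.rpow_le_rpow_of_nonpos (by norm_num) (by linarith [Real.pi_gt_three]) (by norm_num)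
      refine this.trans_eq ?_
      rw [Real.rpow_neg (by norm_num), ← Real.sqrt_eq_rpow, show (4 : ℝ) = 2 ^ 2 by norm_num,
        Real.sqrt_sq (by norm_num)]
      norm_num
    have a3 : (2 : ℝ) ^ (1 / 2 : ℝ) * (4 * Real.pi) ^ (-(1 / 2) : ℝ) ≤ 2 * (1 / 2) := by gcongr
    nlinarith [Real.pi_lt_four, Real.pi_pos]
  calc |-2 * Real.pi| * (s ^ (3 / 2 : ℝ) * |HurwitzZeta.oddKernel x s|)
      ≤ |-2 * Real.pi| * (s ^ (3 / 2 : ℝ) *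
        (s ^ (-(1 / 2) : ℝ) * ((s / 2) ^ (-(1 / 2) : ℝ) * circleHeat (2 * τ) x))) := by gcongr
    _ = |-2 * Real.pi| * (s ^ (3 / 2 : ℝ) *
        (s ^ (-(1 / 2) : ℝ) * (s / 2) ^ (-(1 / 2) : ℝ))) * circleHeat (2 * τ) x := by ring
    _ = |-2 * Real.pi| * (2 ^ (1 / 2 : ℝ) * (4 * Real.pi) ^ (-(1 / 2) : ℝ)) * τ ^ (-(1 / 2) : ℝ)
        * circleHeat (2 * τ) x := by rw [h4]; ring
    _ ≤ _ := by
        have := circleHeat_nonneg (2 * τ) x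
        gcongr

/-! ### The heat kernel of the torus. -/

/-- The heat kernel of the torus. -/
noncomputable def torusHeat {d : ℕ} (τ : ℝ) (x : Torus d) : ℝ := ∏ i, circleHeat τ (x i)

/-- The `j`-th partial derivative of the heat kernel of the torus. -/
noncomputable def torusHeatDeriv {d : ℕ} (j : Fin d) (τ : ℝ) (x : Torus d) : ℝ :=
  ∏ i, if i = j then circleHeatDeriv τ (x i) else circleHeat τ (x i)

theorem measurable_torusHeat {d : ℕ} : Measurable fun z : ℝ × Torus d => torusHeat z.1 z.2 :=
  Finset.measurable_fun_prod _ fun i _ => measurable_circleHeat.comp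
    (f := fun z : ℝ × Torus d => (z.1, z.2 i)) (by fun_prop)

theorem measurable_torusHeatDeriv {d : ℕ} (j : Fin d) :
    Measurable fun z : ℝ × Torus d => torusHeatDeriv j z.1 z.2 := by
  refine Finset.measurable_fun_prod _ fun i _ => ?_
  split_ifs
  · exact measurable_circleHeatDeriv.comp (f := fun z : ℝ × Torus d => (z.1, z.2 i)) (by fun_prop)
  · exact measurable_circleHeat.comp (f := fun z : ℝ × Torus d => (z.1, z.2 i)) (by fun_prop)

/-- Positive dimension matters: for `d = 0` the empty product would be one. -/
theorem torusHeat_of_nonpos {d : ℕ} (hd : 0 < d) {τ : ℝ} (h : τ ≤ 0) (x : Torus d) :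
    torusHeat τ x = 0 :=
  Finset.prod_eq_zero (Finset.mem_univ ⟨0, hd⟩) (circleHeat_of_nonpos h _)

theorem torusHeatDeriv_of_nonpos {d : ℕ} (j : Fin d) {τ : ℝ} (h : τ ≤ 0) (x : Torus d) :
    torusHeatDeriv j τ x = 0 :=
  Finset.prod_eq_zero (Finset.mem_univ j) (by simp [circleHeatDeriv_of_nonpos h])

theorem torusHeat_nonneg {d : ℕ} (τ : ℝ) (x : Torus d) : 0 ≤ torusHeat τ x :=
  Finset.prod_nonneg fun _ _ => circleHeat_nonneg _ _

theorem exists_torusHeat_le (d : ℕ) (T : ℝ) (hT : 0 < T) :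
    ∃ C, 0 < C ∧ ∀ τ, 0 < τ → τ ≤ T → ∀ x : Torus d,
      torusHeat τ x ≤ C * τ ^ (-((d : ℝ) / 2)) := by
  obtain ⟨C, hC, h⟩ := exists_circleHeat_le T hT
  refine ⟨C ^ d, by positivity, fun τ hτ hτT x => ?_⟩
  calc torusHeat τ x ≤ ∏ _i : Fin d, (C * τ ^ (-(1 / 2) : ℝ)) :=
        Finset.prod_le_prod (fun i _ => circleHeat_nonneg _ _) fun i _ => h τ hτ hτT _
    _ = C ^ d * τ ^ (-((d : ℝ) / 2)) := by
        rw [Finset.prod_const, Finset.card_univ, Fintype.card_fin, mul_pow, ← Real.rpow_mul_natCast hτ.le]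
        congr 2
        ring

/-- Only the `j`-th factor is differentiated and costs `τ^{-1/2}`. Moving all factors to time `2τ`
recreates a torus heat kernel, whose mass and supremum are already controlled. -/
theorem abs_torusHeatDeriv_le {d : ℕ} (j : Fin d) {τ : ℝ} (hτ : 0 < τ) (x : Torus d) :
    |torusHeatDeriv j τ x| ≤ 8 ^ d * τ ^ (-(1 / 2) : ℝ) * torusHeat (2 * τ) x := by
  rw [torusHeatDeriv, Finset.abs_prod]
  calc ∏ i, |if i = j then circleHeatDeriv τ (x i) else circleHeat τ (x i)|
      ≤ ∏ i, (8 * (if i = j then τ ^ (-(1 / 2) : ℝ) else 1) * circleHeat (2 * τ) (x i)) := by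
        refine Finset.prod_le_prod (fun i _ => abs_nonneg _) fun i _ => ?_
        split_ifs
        · exact abs_circleHeatDeriv_le hτ _
        · rw [abs_of_nonneg (circleHeat_nonneg _ _)]
          linarith [circleHeat_le_circleHeat_two_mul hτ (x i), circleHeat_nonneg (2 * τ) (x i)]
    _ = _ := by
        rw [Finset.prod_mul_distrib, Finset.prod_mul_distrib, Finset.prod_ite_eq' Finset.univ j]
        simp [torusHeat]

theorem mFourierCoeff_prod {d : ℕ} (f : Fin d → UnitAddCircle → ℂ) (n : Fin d → ℤ) :
    UnitAddTorus.mFourierCoeff (fun x : Torus d => ∏ i, f i (x i)) n =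
      ∏ i, ∫ x : UnitAddCircle, fourier (-(n i)) x * f i x := by
  rw [mFourierCoeff_eq_integral_volume]
  have := integral_fintype_prod_volume_eq_prod (𝕜 := ℂ)
    (fun i (x : UnitAddCircle) => fourier (-(n i)) x * f i x)
  rw [← this]
  refine integral_congr_ae (Eventually.of_forall fun x => ?_)
  simp only [Finset.prod_mul_distrib]
  rfl

/-- The Fourier symbol `4π²|n|²` of the negative Laplacian. -/
noncomputable def laplaceSymbol {d : ℕ} (n : Fin d → ℤ) : ℝ :=
  4 * Real.pi ^ 2 * ∑ i, (n i : ℝ) ^ 2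

theorem prod_exp_eq_laplaceSymbol {d : ℕ} (n : Fin d → ℤ) (τ : ℝ) :
    ∏ i, Real.exp (-(4 * Real.pi ^ 2 * n i ^ 2 * τ)) = Real.exp (-(laplaceSymbol n * τ)) := by
  rw [← Real.exp_sum, laplaceSymbol, Finset.mul_sum, Finset.sum_mul, Finset.sum_neg_distrib]

theorem mFourierCoeff_torusHeat {d : ℕ} {τ : ℝ} (hτ : 0 < τ) (n : Fin d → ℤ) :
    UnitAddTorus.mFourierCoeff (fun x : Torus d => (torusHeat τ x : ℂ)) n =
      (Real.exp (-(laplaceSymbol n * τ)) : ℝ) := by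
  simp only [torusHeat, Complex.ofReal_prod]
  rw [mFourierCoeff_prod (fun _ x => (circleHeat τ x : ℂ))]
  simp only [integral_fourier_mul_circleHeat hτ]
  rw [← prod_exp_eq_laplaceSymbol, Complex.ofReal_prod]

theorem mFourierCoeff_torusHeatDeriv {d : ℕ} (j : Fin d) {τ : ℝ} (hτ : 0 < τ) (n : Fin d → ℤ) :
    UnitAddTorus.mFourierCoeff (fun x : Torus d => (torusHeatDeriv j τ x : ℂ)) n =
      2 * Real.pi * Complex.I * n j * (Real.exp (-(laplaceSymbol n * τ)) : ℝ) := by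
  simp only [torusHeatDeriv, Complex.ofReal_prod]
  rw [mFourierCoeff_prod
    (fun i x => ((if i = j then circleHeatDeriv τ x else circleHeat τ x : ℝ) : ℂ))]
  have : ∀ i, ∫ x : UnitAddCircle, fourier (-(n i)) x *
      ((if i = j then circleHeatDeriv τ x else circleHeat τ x : ℝ) : ℂ) =
      (if i = j then 2 * Real.pi * Complex.I * n i else 1) *
        ((Real.exp (-(4 * Real.pi ^ 2 * n i ^ 2 * τ)) : ℝ) : ℂ) := by
    intro i
    split_ifs
    · exact integral_fourier_mul_circleHeatDeriv hτ _
    · rw [one_mul]; exact integral_fourier_mul_circleHeat hτ _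
  simp only [this]
  rw [Finset.prod_mul_distrib, Finset.prod_ite_eq' Finset.univ j, ← Complex.ofReal_prod,
    prod_exp_eq_laplaceSymbol]
  simp

theorem integral_torusHeat {d : ℕ} {τ : ℝ} (hτ : 0 < τ) :
    ∫ x : Torus d, torusHeat τ x = 1 := by
  have h := mFourierCoeff_torusHeat (d := d) hτ 0
  rw [mFourierCoeff_eq_integral_volume] at h
  simp only [neg_zero, UnitAddTorus.mFourier_zero, ContinuousMap.one_apply, one_mul,
    laplaceSymbol, Pi.zero_apply] at h
  rw [integral_complex_ofReal] at h
  have h2 := Complex.ofReal_injective h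
  simpa using h2

theorem integrable_torusHeat {d : ℕ} {τ : ℝ} (hτ : 0 < τ) :
    Integrable (fun x : Torus d => torusHeat τ x) := by
  -- A non-integrable function has integral zero by convention, whereas here the integral is one.
  by_contra h
  exact one_ne_zero ((integral_torusHeat hτ).symm.trans (integral_undef h))

theorem lintegral_torusHeat_le {d : ℕ} (hd : 0 < d) (τ : ℝ) :
    ∫⁻ x : Torus d, ‖torusHeat τ x‖ₑ ≤ 1 := by
  rcases le_or_gt τ 0 with h | h
  · simp [torusHeat_of_nonpos hd h]
  · simp_rw [Real.enorm_of_nonneg (torusHeat_nonneg τ _)]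
    rw [← ofReal_integral_eq_lintegral_ofReal (integrable_torusHeat h)
      (Eventually.of_forall fun x => torusHeat_nonneg τ x), integral_torusHeat h]
    simp

theorem lintegral_torusHeatDeriv_le {d : ℕ} (hd : 0 < d) (j : Fin d) {τ : ℝ} (hτ : 0 < τ) :
    ∫⁻ x : Torus d, ‖torusHeatDeriv j τ x‖ₑ ≤ ENNReal.ofReal (8 ^ d * τ ^ (-(1 / 2) : ℝ)) := by
  calc ∫⁻ x : Torus d, ‖torusHeatDeriv j τ x‖ₑ
      ≤ ∫⁻ x : Torus d, ENNReal.ofReal (8 ^ d * τ ^ (-(1 / 2) : ℝ)) * ‖torusHeat (2 * τ) x‖ₑ := by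
        refine lintegral_mono fun x => ?_
        rw [Real.enorm_eq_ofReal_abs, Real.enorm_of_nonneg (torusHeat_nonneg _ _),
          ← ENNReal.ofReal_mul (by positivity)]
        exact ENNReal.ofReal_le_ofReal (abs_torusHeatDeriv_le j hτ x)
    _ = ENNReal.ofReal (8 ^ d * τ ^ (-(1 / 2) : ℝ)) * ∫⁻ x : Torus d, ‖torusHeat (2 * τ) x‖ₑ :=
        lintegral_const_mul' _ _ ENNReal.ofReal_ne_top
    _ ≤ _ := mul_le_of_le_one_right' (lintegral_torusHeat_le hd _)

theorem lintegral_rpow_Ioo_lt_top {α : ℝ} (hα : α < 1) (T : ℝ) :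
    ∫⁻ τ in Ioo 0 T, ENNReal.ofReal (τ ^ (-α)) < ⊤ := by
  rcases le_or_gt T 0 with hT | hT
  · simp [Ioo_eq_empty_of_le hT]
  · have h := (intervalIntegral.intervalIntegrable_rpow' (r := -α) (a := 0) (b := T)
      (by linarith)).1
    have h2 : IntegrableOn (fun τ : ℝ => τ ^ (-α)) (Ioo 0 T) := h.mono_set Ioo_subset_Ioc_self
    exact h2.lintegral_lt_top

/-! ### Space-time convolutions. -/

/-- The measure `dt ⊗ dx` on `(0,T) × 𝕋ᵈ`. -/
noncomputable abbrev parabolicMeasure (d : ℕ) (T : ℝ) : Measure (ℝ × Torus d) :=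
  (volume.restrict (Ioo 0 T)).prod volume

/-- The space-time convolution of `g` on `(0,T) × 𝕋ᵈ` with the kernel `k`. -/
noncomputable def duhamel {d : ℕ} (T : ℝ) (k g : ℝ → Torus d → ℝ) (t : ℝ) (x : Torus d) : ℝ :=
  ∫ z, k (t - z.1) (x - z.2) * g z.1 z.2 ∂(parabolicMeasure d T)

/-- After the shift, times before `s` contribute nothing by causality and later ones land in `(0,
T)`. This is the time part of Young's inequality in `L¹`. -/
theorem lintegral_sub_left_Ioo_le {κ : ℝ → ENNReal} (hκ : ∀ τ ≤ 0, κ τ = 0) {T s : ℝ}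
    (hs : 0 < s) : ∫⁻ t in Ioo 0 T, κ (t - s) ≤ ∫⁻ τ in Ioo 0 T, κ τ := by
  calc ∫⁻ t in Ioo 0 T, κ (t - s) = ∫⁻ t, (Ioo 0 T).indicator (fun t => κ (t - s)) t :=
        (lintegral_indicator measurableSet_Ioo _).symm
    _ ≤ ∫⁻ t, (Ioo 0 T).indicator κ (t - s) := by
        refine lintegral_mono fun t => ?_
        by_cases ht : t ∈ Ioo 0 T
        · rw [indicator_of_mem ht]
          by_cases h0 : 0 < t - s
          · rw [indicator_of_mem (show t - s ∈ Ioo 0 T from ⟨h0, by linarith [ht.2]⟩)]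
          · rw [hκ _ (not_lt.1 h0)]; exact zero_le
        · rw [indicator_of_notMem ht]; exact zero_le
    _ = ∫⁻ t, (Ioo 0 T).indicator κ t := lintegral_sub_right_eq_self _ s
    _ = _ := lintegral_indicator measurableSet_Ioo _

section Duhamel

variable {d : ℕ} {T : ℝ} {k g : ℝ → Torus d → ℝ}

/-- Young's inequality in `L¹`, stated before integrating out any variable. Joint integrability in
`(t, x, s, y)` justifies the Fubini exchanges in the convolution theorem. -/
theorem integrable_duhamel_kernel
    (hkm : Measurable fun z : ℝ × Torus d => k z.1 z.2) (hk0 : ∀ τ ≤ 0, ∀ x, k τ x = 0)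
    (hk : ∫⁻ τ in Ioo 0 T, ∫⁻ x, ‖k τ x‖ₑ < ⊤)
    (hg : Integrable (Function.uncurry g) (parabolicMeasure d T)) :
    Integrable (fun w : ℝ × (Torus d × (ℝ × Torus d)) =>
      k (w.1 - w.2.2.1) (w.2.1 - w.2.2.2) * g w.2.2.1 w.2.2.2)
      ((volume.restrict (Ioo 0 T)).prod (volume.prod (parabolicMeasure d T))) := by
  have hgm : AEStronglyMeasurable (fun w : ℝ × (Torus d × (ℝ × Torus d)) => g w.2.2.1 w.2.2.2)
      ((volume.restrict (Ioo 0 T)).prod (volume.prod (parabolicMeasure d T))) :=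
    (hg.1.comp_snd (μ := (volume : Measure (Torus d)))).comp_snd
  have hm : AEStronglyMeasurable (fun w : ℝ × (Torus d × (ℝ × Torus d)) =>
      k (w.1 - w.2.2.1) (w.2.1 - w.2.2.2) * g w.2.2.1 w.2.2.2)
      ((volume.restrict (Ioo 0 T)).prod (volume.prod (parabolicMeasure d T))) :=
    (hkm.comp (f := fun w : ℝ × (Torus d × (ℝ × Torus d)) => (w.1 - w.2.2.1, w.2.1 - w.2.2.2))
      (by fun_prop)).aestronglyMeasurable.mul hgm
  refine ⟨hm, ?_⟩
  set κ : ℝ → ENNReal := fun τ => ∫⁻ x, ‖k τ x‖ₑ with hκ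
  have hκm : Measurable κ := Measurable.lintegral_prod_right' hkm.enorm
  have hκ0 : ∀ τ ≤ 0, κ τ = 0 := fun τ hτ => by simp [hκ, hk0 τ hτ]
  have h1 : ∀ t, ∫⁻ p : Torus d × (ℝ × Torus d),
      ‖k (t - p.2.1) (p.1 - p.2.2) * g p.2.1 p.2.2‖ₑ ∂(volume.prod (parabolicMeasure d T)) =
      ∫⁻ z, κ (t - z.1) * ‖g z.1 z.2‖ₑ ∂(parabolicMeasure d T) := by
    intro t
    rw [lintegral_prod_symm]
    · refine lintegral_congr fun z => ?_
      simp only [enorm_mul]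
      rw [lintegral_mul_const'' _ ?_]
      · congr 1
        exact lintegral_sub_right_eq_self (fun x => ‖k (t - z.1) x‖ₑ) z.2
      · exact (hkm.comp (f := fun x : Torus d => (t - z.1, x - z.2))
          (by fun_prop)).enorm.aemeasurable
    · exact ((hkm.comp (f := fun p : Torus d × (ℝ × Torus d) => (t - p.2.1, p.1 - p.2.2))
        (by fun_prop)).aestronglyMeasurable.mul hg.1.comp_snd).enorm
  rw [HasFiniteIntegral, lintegral_prod _ hm.enorm]
  simp only [h1]
  rw [lintegral_lintegral_swap]
  · calc ∫⁻ z, (∫⁻ t in Ioo 0 T, κ (t - z.1) * ‖g z.1 z.2‖ₑ) ∂(parabolicMeasure d T)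
        ≤ ∫⁻ z, (∫⁻ τ in Ioo 0 T, κ τ) * ‖g z.1 z.2‖ₑ ∂(parabolicMeasure d T) := by
          refine lintegral_mono_ae ?_
          have : ∀ᵐ z ∂(parabolicMeasure d T), z.1 ∈ Ioo (0 : ℝ) T :=
            Measure.quasiMeasurePreserving_fst.ae (ae_restrict_mem measurableSet_Ioo)
          filter_upwards [this] with z hz
          rw [lintegral_mul_const _ (by fun_prop)]
          exact mul_le_mul' (lintegral_sub_left_Ioo_le hκ0 hz.1) le_rfl
      _ = (∫⁻ τ in Ioo 0 T, κ τ) * ∫⁻ z, ‖g z.1 z.2‖ₑ ∂(parabolicMeasure d T) :=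
          lintegral_const_mul'' _ hg.1.enorm
      _ < ⊤ := ENNReal.mul_lt_top hk hg.2
  · exact AEMeasurable.mul (by fun_prop) hg.1.enorm.comp_snd

/-- The convolution theorem applied in `x` alone: translating by `y` splits off the coefficient of
the kernel, while the time convolution remains. -/
theorem duhamel_integrable_and_mFourierCoeff
    (hkm : Measurable fun z : ℝ × Torus d => k z.1 z.2) (hk0 : ∀ τ ≤ 0, ∀ x, k τ x = 0)
    (hk : ∫⁻ τ in Ioo 0 T, ∫⁻ x, ‖k τ x‖ₑ < ⊤)
    (hg : Integrable (Function.uncurry g) (parabolicMeasure d T)) :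
    ∀ᵐ t ∂(volume.restrict (Ioo 0 T)), Integrable (duhamel T k g t) ∧
      ∀ n, Integrable (fun s => UnitAddTorus.mFourierCoeff (fun x => (k (t - s) x : ℂ)) n *
          UnitAddTorus.mFourierCoeff (fun x => (g s x : ℂ)) n) (volume.restrict (Ioo 0 T)) ∧
        UnitAddTorus.mFourierCoeff (fun x => (duhamel T k g t x : ℂ)) n =
        ∫ s in Ioo 0 T, UnitAddTorus.mFourierCoeff (fun x => (k (t - s) x : ℂ)) n *
          UnitAddTorus.mFourierCoeff (fun x => (g s x : ℂ)) n := by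
  filter_upwards [(integrable_duhamel_kernel hkm hk0 hk hg).prod_right_ae] with t ht
  refine ⟨ht.integral_prod_left, fun n => ?_⟩
  have hint : Integrable (fun p : Torus d × (ℝ × Torus d) => UnitAddTorus.mFourier (-n) p.1 *
      ((k (t - p.2.1) (p.1 - p.2.2) * g p.2.1 p.2.2 : ℝ) : ℂ))
      (volume.prod (parabolicMeasure d T)) := by
    refine ht.ofReal.bdd_mul (c := 1) ?_ ?_
    · exact ((UnitAddTorus.mFourier (-n)).continuous.comp continuous_fst).aestronglyMeasurable
    · exact Eventually.of_forall fun p => (norm_mFourier_apply _ _).le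
  have hinner : ∀ z : ℝ × Torus d, ∫ x, UnitAddTorus.mFourier (-n) x *
      ((k (t - z.1) (x - z.2) * g z.1 z.2 : ℝ) : ℂ) =
      UnitAddTorus.mFourierCoeff (fun x => (k (t - z.1) x : ℂ)) n *
        (UnitAddTorus.mFourier (-n) z.2 * (g z.1 z.2 : ℂ)) := by
    intro z
    rw [← integral_add_right_eq_self _ z.2, mFourierCoeff_eq_integral_volume, ← integral_mul_const]
    refine integral_congr_ae (Eventually.of_forall fun x => ?_)
    simp only [add_sub_cancel_right, mFourier_add_apply]
    push_cast
    ring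
  have hint2 := hint.integral_prod_right
  simp only [hinner] at hint2
  have hin : ∀ s, ∫ y : Torus d, UnitAddTorus.mFourierCoeff (fun x => (k (t - s) x : ℂ)) n *
        (UnitAddTorus.mFourier (-n) y * (g s y : ℂ)) =
      UnitAddTorus.mFourierCoeff (fun x => (k (t - s) x : ℂ)) n *
          UnitAddTorus.mFourierCoeff (fun x => (g s x : ℂ)) n := fun s => by
    rw [integral_const_mul, ← mFourierCoeff_eq_integral_volume]
  refine ⟨?_, ?_⟩
  · have := hint2.integral_prod_left
    simpa only [hin] using this
  · rw [mFourierCoeff_eq_integral_volume]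
    have h1 : ∀ x, UnitAddTorus.mFourier (-n) x * (duhamel T k g t x : ℂ) =
        ∫ z, UnitAddTorus.mFourier (-n) x *
          ((k (t - z.1) (x - z.2) * g z.1 z.2 : ℝ) : ℂ) ∂(parabolicMeasure d T) := fun x => by
      rw [integral_const_mul, integral_complex_ofReal, duhamel]
    simp only [h1]
    rw [integral_integral_swap hint]
    simp only [hinner]
    rw [integral_prod _ hint2]
    simp only [hin]

end Duhamel

/-! ### From Fourier coefficients to Duhamel's formula. -/

/-- Variation of constants for a scalar linear equation in integrated form. -/
theorem variation_of_constants {T lam : ℝ} {a b : ℝ → ℂ}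
    (ha : Integrable a (volume.restrict (Ioo 0 T))) (hb : Integrable b (volume.restrict (Ioo 0 T)))
    (h : ∀ᵐ t ∂(volume.restrict (Ioo 0 T)), a t = ∫ s in Ioo 0 t, (-lam * a s + b s)) :
    ∀ᵐ t ∂(volume.restrict (Ioo 0 T)),
      a t = ∫ s in Ioo 0 t, (Real.exp (-(lam * (t - s))) : ℝ) * b s := by
  filter_upwards [h, ae_restrict_mem measurableSet_Ioo] with t hat ht
  have hsub : Ioo 0 t ⊆ Ioo 0 T := Ioo_subset_Ioo_right ht.2.le
  set ν : Measure ℝ := volume.restrict (Ioo 0 t) with hν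
  have ha' : Integrable a ν := ha.mono_measure (Measure.restrict_mono hsub le_rfl)
  have hb' : Integrable b ν := hb.mono_measure (Measure.restrict_mono hsub le_rfl)
  have h' : ∀ᵐ s ∂ν, a s = ∫ r in Ioo 0 s, (-lam * a r + b r) :=
    ae_mono (Measure.restrict_mono hsub le_rfl) h
  set c : ℝ → ℂ := fun s => -lam * a s + b s with hc
  have hci : Integrable c ν := (ha'.const_mul _).add hb'
  set e : ℝ → ℂ := fun s => (Real.exp (-(lam * (t - s))) : ℝ) with he
  have hec : Continuous e := by fun_prop
  have hebd : ∃ M, ∀ᵐ s ∂ν, ‖e s‖ ≤ M := by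
    obtain ⟨M, hM⟩ := isCompact_Icc.exists_bound_of_continuousOn (hec.continuousOn (s := Icc 0 t))
    exact ⟨M, (ae_restrict_mem measurableSet_Ioo).mono fun s hs => hM s (Ioo_subset_Icc_self hs)⟩
  obtain ⟨M, hM⟩ := hebd
  have hei : Integrable e ν := Integrable.of_bound hec.aestronglyMeasurable M hM
  have hmul : ∀ {u : ℝ → ℂ}, Integrable u ν → Integrable (fun s => e s * u s) ν := fun hu =>
    hu.bdd_mul hec.aestronglyMeasurable hM
  have hF : Integrable (fun p : ℝ × ℝ => (({p : ℝ × ℝ | p.2 < p.1}).indicator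
      (fun p => (lam : ℂ) * e p.1 * c p.2) p)) (ν.prod ν) :=
    ((hei.const_mul _).mul_prod hci).indicator (measurableSet_lt measurable_snd measurable_fst)
  -- Insert `a s = ∫₀ˢ c` and exchange integrals on the triangle `r < s < t`. The inner integral of
  -- `lam * e` over `(r, t)` is `1 - e r`, so no differentiability of `a` is needed.
  have h1 : ∫ s, (lam : ℂ) * e s * a s ∂ν = ∫ r, c r * (1 - e r) ∂ν := by
    calc ∫ s, (lam : ℂ) * e s * a s ∂ν
        = ∫ s, ∫ r, (({p : ℝ × ℝ | p.2 < p.1}).indicator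
          (fun p => (lam : ℂ) * e p.1 * c p.2) (s, r)) ∂ν ∂ν := by
          refine integral_congr_ae ?_
          filter_upwards [h', ae_restrict_mem measurableSet_Ioo] with s hs hst
          have : ∀ r, ({p : ℝ × ℝ | p.2 < p.1}).indicator
              (fun p => (lam : ℂ) * e p.1 * c p.2) (s, r) =
              (Iio s).indicator (fun r => (lam : ℂ) * e s * c r) r := fun r => by
            by_cases hr : r < s
            · simp [indicator, hr]
            · simp [indicator, hr]
          simp only [this]
          rw [integral_indicator measurableSet_Iio, integral_const_mul, hs, hν,
            Measure.restrict_restrict measurableSet_Iio]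
          congr 4
          ext r
          simp only [mem_inter_iff, mem_Iio, mem_Ioo]
          constructor
          · rintro ⟨h1, h2⟩; exact ⟨h2, h1, h2.trans hst.2⟩
          · rintro ⟨h1, h2, -⟩; exact ⟨h2, h1⟩
      _ = ∫ r, ∫ s, (({p : ℝ × ℝ | p.2 < p.1}).indicator
          (fun p => (lam : ℂ) * e p.1 * c p.2) (s, r)) ∂ν ∂ν := integral_integral_swap hF
      _ = ∫ r, c r * (1 - e r) ∂ν := by
          refine integral_congr_ae ?_
          filter_upwards [ae_restrict_mem measurableSet_Ioo] with r hr
          have : ∀ s, ({p : ℝ × ℝ | p.2 < p.1}).indicator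
              (fun p => (lam : ℂ) * e p.1 * c p.2) (s, r) =
              (Ioi r).indicator (fun s => c r * (lam * e s)) s := fun s => by
            by_cases hr : r < s
            · simp only [indicator, mem_ofPred_eq, mem_Ioi, hr, if_true]; ring
            · simp [indicator, hr]
          simp only [this]
          rw [integral_indicator measurableSet_Ioi, integral_const_mul, hν,
            Measure.restrict_restrict measurableSet_Ioi]
          congr 1
          have hset : Ioi r ∩ Ioo 0 t = Ioo r t := by
            ext s
            simp only [mem_inter_iff, mem_Ioi, mem_Ioo]
            constructor
            · rintro ⟨h1, h2, h3⟩; exact ⟨h1, h3⟩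
            · rintro ⟨h1, h2⟩; exact ⟨h1, hr.1.trans h1, h2⟩
          rw [hset, ← integral_Ioc_eq_integral_Ioo, ← intervalIntegral.integral_of_le hr.2.le]
          have hderiv : ∀ s ∈ uIcc r t, HasDerivAt e (lam * e s) s := by
            intro s _
            have h0 : HasDerivAt (fun s : ℝ => Real.exp (-(lam * (t - s))))
                (Real.exp (-(lam * (t - s))) * (-(lam * (-1)))) s :=
              ((((hasDerivAt_id s).const_sub t).const_mul lam).neg).exp
            have := h0.ofReal_comp
            convert this using 1
            simp only [he]
            push_cast
            ring
          rw [intervalIntegral.integral_eq_sub_of_hasDerivAt hderiv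
            ((by fun_prop : Continuous fun s => (lam : ℂ) * e s).intervalIntegrable _ _)]
          simp [he]
  have h2 : ∀ s, e s * b s = e s * c s + lam * e s * a s := fun s => by simp only [hc]; ring
  have h3 : Integrable (fun s => (lam : ℂ) * e s * a s) ν := by
    simpa only [mul_assoc] using (hmul ha').const_mul (lam : ℂ)
  change a t = ∫ s, e s * b s ∂ν
  simp only [h2]
  rw [integral_add (hmul hci) h3, h1, ← integral_add (hmul hci), hat]
  · refine integral_congr_ae (Eventually.of_forall fun s => ?_)
    simp only [hc]; ring
  · exact (hci.sub (hmul hci)).congr (Eventually.of_forall fun s => by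
      simp only [Pi.sub_apply]; ring)

theorem integrable_mFourierCoeff {d : ℕ} {T : ℝ} {g : ℝ → Torus d → ℝ}
    (hg : Integrable (Function.uncurry g) (parabolicMeasure d T)) (n : Fin d → ℤ) :
    Integrable (fun s => UnitAddTorus.mFourierCoeff (fun x => (g s x : ℂ)) n)
      (volume.restrict (Ioo 0 T)) := by
  simp only [mFourierCoeff_eq_integral_volume]
  have : Integrable (fun p : ℝ × Torus d => UnitAddTorus.mFourier (-n) p.2 * (g p.1 p.2 : ℂ))
      (parabolicMeasure d T) := by
    refine (Integrable.ofReal hg).bdd_mul (c := 1) ?_ ?_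
    · exact ((UnitAddTorus.mFourier (-n)).continuous.comp continuous_snd).aestronglyMeasurable
    · exact Eventually.of_forall fun p => (norm_mFourier_apply _ _).le
  exact this.integral_prod_left

theorem mFourierCoeff_const_zero {d : ℕ} (n : Fin d → ℤ) :
    UnitAddTorus.mFourierCoeff (fun _ : Torus d => ((0 : ℝ) : ℂ)) n = 0 := by
  simp [mFourierCoeff_eq_integral_volume]

/-- Convolution with a kernel whose Fourier multiplier is `m · exp(-λτ)`. -/
theorem duhamel_mFourierCoeff_eq {d : ℕ} {T : ℝ} {k g : ℝ → Torus d → ℝ}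
    {m : (Fin d → ℤ) → ℂ} {lam : (Fin d → ℤ) → ℝ}
    (hkm : Measurable fun z : ℝ × Torus d => k z.1 z.2) (hk0 : ∀ τ ≤ 0, ∀ x, k τ x = 0)
    (hk : ∫⁻ τ in Ioo 0 T, ∫⁻ x, ‖k τ x‖ₑ < ⊤)
    (hkm' : ∀ τ, 0 < τ → ∀ n, UnitAddTorus.mFourierCoeff (fun x => (k τ x : ℂ)) n =
      m n * (Real.exp (-(lam n * τ)) : ℝ))
    (hg : Integrable (Function.uncurry g) (parabolicMeasure d T)) :
    ∀ᵐ t ∂(volume.restrict (Ioo 0 T)), Integrable (duhamel T k g t) ∧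
      ∀ n, Integrable (fun s => (Real.exp (-(lam n * (t - s))) : ℝ) *
          (m n * UnitAddTorus.mFourierCoeff (fun x => (g s x : ℂ)) n))
          (volume.restrict (Ioo 0 t)) ∧
        UnitAddTorus.mFourierCoeff (fun x => (duhamel T k g t x : ℂ)) n =
        ∫ s in Ioo 0 t, (Real.exp (-(lam n * (t - s))) : ℝ) *
          (m n * UnitAddTorus.mFourierCoeff (fun x => (g s x : ℂ)) n) := by
  filter_upwards [duhamel_integrable_and_mFourierCoeff hkm hk0 hk hg,
    ae_restrict_mem measurableSet_Ioo] with t ht htT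
  refine ⟨ht.1, fun n => ?_⟩
  obtain ⟨h1, h2⟩ := ht.2 n
  have heq : EqOn (fun s => UnitAddTorus.mFourierCoeff (fun x => (k (t - s) x : ℂ)) n *
          UnitAddTorus.mFourierCoeff (fun x => (g s x : ℂ)) n)
      (fun s => (Real.exp (-(lam n * (t - s))) : ℝ) *
          (m n * UnitAddTorus.mFourierCoeff (fun x => (g s x : ℂ)) n)) (Ioo 0 t) := by
    intro s hs
    simp only
    rw [hkm' (t - s) (by linarith [hs.2]) n]
    ring
  have hsub : Ioo 0 t ⊆ Ioo 0 T := Ioo_subset_Ioo_right htT.2.le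
  refine ⟨(IntegrableOn.mono_set h1 hsub).congr_fun heq measurableSet_Ioo, ?_⟩
  rw [h2, ← setIntegral_congr_fun measurableSet_Ioo heq]
  -- For `s ≥ t` the kernel vanishes, which shrinks `(0, T)` to `(0, t)`.
  refine setIntegral_eq_of_subset_of_forall_sdiff_eq_zero measurableSet_Ioo hsub fun s hs => ?_
  have : t ≤ s := by
    by_contra h
    exact hs.2 ⟨hs.1.1, not_le.1 h⟩
  simp only [hk0 (t - s) (by linarith)]
  rw [mFourierCoeff_const_zero, zero_mul]

theorem lintegral_torusHeat_time_lt_top {d : ℕ} (hd : 0 < d) (ν T : ℝ) :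
    ∫⁻ τ in Ioo 0 T, ∫⁻ x : Torus d, ‖torusHeat (ν * τ) x‖ₑ < ⊤ := by
  calc _ ≤ ∫⁻ τ in Ioo 0 T, 1 := lintegral_mono fun τ => lintegral_torusHeat_le hd _
    _ < ⊤ := by simp

theorem lintegral_torusHeatDeriv_time_lt_top {d : ℕ} (hd : 0 < d) (j : Fin d) {ν : ℝ} (hν : 0 < ν)
    (T : ℝ) : ∫⁻ τ in Ioo 0 T, ∫⁻ x : Torus d, ‖torusHeatDeriv j (ν * τ) x‖ₑ < ⊤ := by
  calc _ ≤ ∫⁻ τ in Ioo 0 T, ENNReal.ofReal (8 ^ d * ν ^ (-(1 / 2) : ℝ)) *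
        ENNReal.ofReal (τ ^ (-(1 / 2) : ℝ)) := by
        refine setLIntegral_mono' measurableSet_Ioo fun τ hτ => ?_
        refine (lintegral_torusHeatDeriv_le hd j (mul_pos hν hτ.1)).trans_eq ?_
        rw [← ENNReal.ofReal_mul (by positivity), Real.mul_rpow hν.le hτ.1.le, mul_assoc]
    _ = ENNReal.ofReal (8 ^ d * ν ^ (-(1 / 2) : ℝ)) *
        ∫⁻ τ in Ioo 0 T, ENNReal.ofReal (τ ^ (-(1 / 2) : ℝ)) :=
        lintegral_const_mul' _ _ ENNReal.ofReal_ne_top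
    _ < ⊤ := ENNReal.mul_lt_top ENNReal.ofReal_lt_top (lintegral_rpow_Ioo_lt_top (by norm_num) T)

/-- Mild formulation: a function whose Fourier coefficients solve the integrated linear equation
`∂ₜu = νΔu + g + div G`, `u(0) = 0`, is given by the heat-kernel representation. -/
theorem ae_eq_duhamel {d : ℕ} (hd : 0 < d) {T ν : ℝ} (hν : 0 < ν) {u g : ℝ → Torus d → ℝ}
    {G : Fin d → ℝ → Torus d → ℝ}
    (hu : Integrable (Function.uncurry u) (parabolicMeasure d T))
    (hg : Integrable (Function.uncurry g) (parabolicMeasure d T))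
    (hG : ∀ j, Integrable (Function.uncurry (G j)) (parabolicMeasure d T))
    (h : ∀ n, ∀ᵐ t ∂(volume.restrict (Ioo 0 T)),
      UnitAddTorus.mFourierCoeff (fun x => (u t x : ℂ)) n =
        ∫ s in Ioo 0 t, (-((ν * laplaceSymbol n : ℝ) : ℂ) *
            UnitAddTorus.mFourierCoeff (fun x => (u s x : ℂ)) n +
          (UnitAddTorus.mFourierCoeff (fun x => (g s x : ℂ)) n + ∑ j, 2 * Real.pi * Complex.I * n j *
            UnitAddTorus.mFourierCoeff (fun x => (G j s x : ℂ)) n))) :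
    ∀ᵐ t ∂(volume.restrict (Ioo 0 T)), ∀ᵐ x,
      u t x = duhamel T (fun τ => torusHeat (ν * τ)) g t x +
        ∑ j, duhamel T (fun τ => torusHeatDeriv j (ν * τ)) (G j) t x := by
  have hmeas : Measurable fun z : ℝ × Torus d => (ν * z.1, z.2) := by fun_prop
  have h1 := duhamel_mFourierCoeff_eq (T := T) (k := fun τ => torusHeat (ν * τ)) (g := g)
    (m := fun _ => 1) (lam := fun n => ν * laplaceSymbol n) (measurable_torusHeat.comp hmeas)
    (fun τ hτ x => torusHeat_of_nonpos hd (mul_nonpos_of_nonneg_of_nonpos hν.le hτ) x)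
    (lintegral_torusHeat_time_lt_top hd ν T)
    (fun τ hτ n => by
      rw [mFourierCoeff_torusHeat (mul_pos hν hτ), one_mul]
      ring_nf) hg
  have h2 := fun j => duhamel_mFourierCoeff_eq (T := T) (k := fun τ => torusHeatDeriv j (ν * τ))
    (g := G j) (m := fun n => 2 * Real.pi * Complex.I * n j)
    (lam := fun n => ν * laplaceSymbol n) ((measurable_torusHeatDeriv j).comp hmeas)
    (fun τ hτ x => torusHeatDeriv_of_nonpos j (mul_nonpos_of_nonneg_of_nonpos hν.le hτ) x)
    (lintegral_torusHeatDeriv_time_lt_top hd j hν T)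
    (fun τ hτ n => by
      rw [mFourierCoeff_torusHeatDeriv j (mul_pos hν hτ)]
      ring_nf) (hG j)
  -- There are countably many frequencies, so one null set of times serves all of them.
  have h3 := ae_all_iff.2 fun n => variation_of_constants (lam := ν * laplaceSymbol n)
    (integrable_mFourierCoeff hu n)
    ((integrable_mFourierCoeff hg n).add (integrable_finsetSum _ fun j _ =>
      (integrable_mFourierCoeff (hG j) n).const_mul (2 * Real.pi * Complex.I * n j))) (by
        filter_upwards [h n] with t ht
        rw [ht]
        refine integral_congr_ae (Eventually.of_forall fun s => ?_)
        simp only [Pi.add_apply]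
        push_cast
        ring)
  filter_upwards [h1, ae_all_iff.2 h2, h3, hu.prod_right_ae] with t h1 h2 h3 hut
  have hsum : Integrable (fun x => ∑ j, duhamel T (fun τ => torusHeatDeriv j (ν * τ)) (G j) t x) :=
    integrable_finsetSum _ fun j _ => (h2 j).1
  have hall : Integrable (fun x => u t x - (duhamel T (fun τ => torusHeat (ν * τ)) g t x +
        ∑ j, duhamel T (fun τ => torusHeatDeriv j (ν * τ)) (G j) t x)) := hut.sub (h1.1.add hsum)
  have := ae_eq_zero_of_mFourierCoeff_eq_zero hall fun n => ?_
  · filter_upwards [this] with x hx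
    exact sub_eq_zero.1 hx
  · push_cast
    have hut' : Integrable (fun x => (u t x : ℂ)) := hut.ofReal
    have h1' : Integrable (fun x => (duhamel T (fun τ => torusHeat (ν * τ)) g t x : ℂ)) :=
      h1.1.ofReal
    have h2' : ∀ j ∈ Finset.univ, Integrable
        (fun x => (duhamel T (fun τ => torusHeatDeriv j (ν * τ)) (G j) t x : ℂ)) :=
      fun j _ => (h2 j).1.ofReal
    have hsum' : Integrable (fun x =>
        ∑ j, (duhamel T (fun τ => torusHeatDeriv j (ν * τ)) (G j) t x : ℂ)) :=
      integrable_finsetSum _ h2'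
    have hadd : Integrable (fun x => (duhamel T (fun τ => torusHeat (ν * τ)) g t x : ℂ) +
        ∑ j, (duhamel T (fun τ => torusHeatDeriv j (ν * τ)) (G j) t x : ℂ)) := h1'.add hsum'
    rw [mFourierCoeff_sub hut' hadd, mFourierCoeff_add h1' hsum', mFourierCoeff_sum _ h2',
      sub_eq_zero]
    rw [h3 n, (h1.2 n).2]
    rw [Finset.sum_congr rfl fun j _ => ((h2 j).2 n).2, ← integral_finsetSum _
      fun j _ => ((h2 j).2 n).1, ← integral_add (h1.2 n).1
      (integrable_finsetSum _ fun j _ => ((h2 j).2 n).1)]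
    refine integral_congr_ae (Eventually.of_forall fun s => ?_)
    simp only [Pi.add_apply, one_mul, mul_add, Finset.mul_sum]

theorem enorm_duhamel_le {d : ℕ} {T : ℝ} (k g : ℝ → Torus d → ℝ) (t : ℝ) (x : Torus d) :
    ‖duhamel T k g t x‖ₑ ≤
      ∫⁻ z, ‖k (t - z.1) (x - z.2)‖ₑ * ‖g z.1 z.2‖ₑ ∂(parabolicMeasure d T) := by
  refine (enorm_integral_le_lintegral_enorm _).trans_eq ?_
  simp only [enorm_mul]

/-! ### The singular Gronwall lemma. -/

/-- By the Gamma integral this equals `Γ(1-α) lam^{α-1}` for `lam > 0`. An exponential weight thus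
makes a weakly singular kernel as small as desired. -/
theorem tendsto_lintegral_rpow_mul_exp {α : ℝ} (hα : α < 1) :
    Tendsto (fun lam : ℝ => ∫⁻ τ in Ioi (0 : ℝ),
      ENNReal.ofReal (τ ^ (-α) * Real.exp (-(lam * τ)))) atTop (𝓝 0) := by
  have h1 : ∀ lam : ℝ, 0 < lam → ∫⁻ τ in Ioi (0 : ℝ),
      ENNReal.ofReal (τ ^ (-α) * Real.exp (-(lam * τ))) =
      ENNReal.ofReal ((1 / lam) ^ (1 - α) * Real.Gamma (1 - α)) := by
    intro lam hlam
    have h := Real.integral_rpow_mul_exp_neg_mul_Ioi (a := 1 - α) (by linarith) hlam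
    simp only [sub_sub_cancel_left] at h
    rw [← h, ofReal_integral_eq_lintegral_ofReal]
    · by_contra hni
      rw [integral_undef hni] at h
      have : 0 < (1 / lam) ^ (1 - α) * Real.Gamma (1 - α) :=
        mul_pos (by positivity) (Real.Gamma_pos_of_pos (by linarith))
      linarith
    · filter_upwards [ae_restrict_mem measurableSet_Ioi] with τ hτ
      have : (0 : ℝ) < τ := hτ
      positivity
  have h2 : Tendsto (fun lam : ℝ => ENNReal.ofReal ((1 / lam) ^ (1 - α) * Real.Gamma (1 - α)))
      atTop (𝓝 0) := by
    have h3 : Tendsto (fun lam : ℝ => (1 / lam) ^ (1 - α) * Real.Gamma (1 - α)) atTop (𝓝 0) := by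
      have h4 : Tendsto (fun lam : ℝ => (1 / lam) ^ (1 - α)) atTop (𝓝 0) := by
        have := (tendsto_rpow_neg_atTop (y := 1 - α) (by linarith))
        refine this.congr' ?_
        filter_upwards [eventually_gt_atTop 0] with lam hlam
        rw [one_div, Real.inv_rpow hlam.le, Real.rpow_neg hlam.le]
      simpa using h4.mul_const (Real.Gamma (1 - α))
    simpa using ENNReal.tendsto_ofReal h3
  refine h2.congr' ?_
  filter_upwards [eventually_gt_atTop 0] with lam hlam
  exact (h1 lam hlam).symm

/-- Singular Gronwall lemma. -/
theorem ae_eq_zero_of_le_singular_convolution {T C α : ℝ} (hα : α < 1) (hC : 0 ≤ C)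
    {Y : ℝ → ENNReal} (hYm : Measurable Y) (hY : ∫⁻ s in Ioo 0 T, Y s < ⊤)
    (h : ∀ᵐ t ∂(volume.restrict (Ioo 0 T)),
      Y t ≤ ∫⁻ s in Ioo 0 t, ENNReal.ofReal (C * (t - s) ^ (-α)) * Y s) :
    ∀ᵐ t ∂(volume.restrict (Ioo 0 T)), Y t = 0 := by
  -- Choose `lam` so that the weighted kernel has mass at most one half; the convolution becomes a
  -- contraction on `L¹(0,T)`.
  obtain ⟨lam, hlam0, hlam⟩ : ∃ lam : ℝ, 0 < lam ∧ ENNReal.ofReal C * ∫⁻ τ in Ioi (0 : ℝ),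
      ENNReal.ofReal (τ ^ (-α) * Real.exp (-(lam * τ))) ≤ 1 / 2 := by
    have h1 := ENNReal.Tendsto.const_mul (tendsto_lintegral_rpow_mul_exp hα)
      (Or.inr (ENNReal.ofReal_ne_top (r := C)))
    rw [mul_zero] at h1
    have h2 := h1.eventually (Iic_mem_nhds (show (0 : ENNReal) < 1 / 2 by simp))
    obtain ⟨lam, h3, h4⟩ := (h2.and (eventually_gt_atTop 0)).exists
    exact ⟨lam, h4, h3⟩
  set κ : ℝ → ENNReal := (Ioi (0 : ℝ)).indicator fun τ =>
    ENNReal.ofReal C * ENNReal.ofReal (τ ^ (-α) * Real.exp (-(lam * τ))) with hκ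
  have hκm : Measurable κ :=
    Measurable.indicator (by fun_prop) measurableSet_Ioi
  set y : ℝ → ENNReal := fun t => ENNReal.ofReal (Real.exp (-(lam * t))) * Y t with hy
  have hym : Measurable y := by fun_prop
  have hκint : ∫⁻ τ in Ioo 0 T, κ τ ≤ 1 / 2 := by
    calc ∫⁻ τ in Ioo 0 T, κ τ ≤ ∫⁻ τ, κ τ := setLIntegral_le_lintegral _ _
      _ = ENNReal.ofReal C * ∫⁻ τ in Ioi (0 : ℝ),
          ENNReal.ofReal (τ ^ (-α) * Real.exp (-(lam * τ))) := by
          rw [hκ, lintegral_indicator measurableSet_Ioi,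
            lintegral_const_mul' _ _ ENNReal.ofReal_ne_top]
      _ ≤ 1 / 2 := hlam
  have hκ0 : ∀ τ ≤ 0, κ τ = 0 := fun τ hτ => by simp [hκ, hτ]
  have hyle : ∀ᵐ t ∂(volume.restrict (Ioo 0 T)), y t ≤ ∫⁻ s in Ioo 0 T, κ (t - s) * y s := by
    filter_upwards [h, ae_restrict_mem measurableSet_Ioo] with t ht htT
    calc y t ≤ ENNReal.ofReal (Real.exp (-(lam * t))) *
          ∫⁻ s in Ioo 0 t, ENNReal.ofReal (C * (t - s) ^ (-α)) * Y s := by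
          simp only [hy]; gcongr
      _ = ∫⁻ s in Ioo 0 t, ENNReal.ofReal (Real.exp (-(lam * t))) *
          (ENNReal.ofReal (C * (t - s) ^ (-α)) * Y s) :=
          (lintegral_const_mul' _ _ ENNReal.ofReal_ne_top).symm
      _ = ∫⁻ s in Ioo 0 t, κ (t - s) * y s := by
          refine setLIntegral_congr_fun measurableSet_Ioo fun s hs => ?_
          have hts : 0 < t - s := by linarith [hs.2]
          simp only [hκ, hy]
          rw [indicator_of_mem (mem_Ioi.2 hts), ENNReal.ofReal_mul hC,
            ENNReal.ofReal_mul (Real.rpow_nonneg hts.le _),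
            show -(lam * t) = -(lam * (t - s)) + -(lam * s) by ring, Real.exp_add,
            ENNReal.ofReal_mul (Real.exp_pos _).le]
          ring
      _ ≤ _ := lintegral_mono_set (Ioo_subset_Ioo_right htT.2.le)
  set I := ∫⁻ t in Ioo 0 T, y t with hI
  -- Finiteness is what allows `I ≤ I/2` to force `I = 0`.
  have hItop : I ≠ ⊤ := by
    refine ne_top_of_le_ne_top hY.ne (setLIntegral_mono' measurableSet_Ioo fun t ht => ?_)
    refine mul_le_of_le_one_left' ?_
    rw [← ENNReal.ofReal_one]
    refine ENNReal.ofReal_le_ofReal (Real.exp_le_one_iff.2 ?_)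
    have := mul_pos hlam0 ht.1
    linarith
  have hIle : I ≤ 1 / 2 * I := by
    calc I ≤ ∫⁻ t in Ioo 0 T, ∫⁻ s in Ioo 0 T, κ (t - s) * y s := lintegral_mono_ae hyle
      _ = ∫⁻ s in Ioo 0 T, ∫⁻ t in Ioo 0 T, κ (t - s) * y s :=
          lintegral_lintegral_swap (Measurable.aemeasurable (by fun_prop))
      _ ≤ ∫⁻ s in Ioo 0 T, 1 / 2 * y s := by
          refine setLIntegral_mono' measurableSet_Ioo fun s hs => ?_
          rw [lintegral_mul_const _ (by fun_prop)]
          exact mul_le_mul' ((lintegral_sub_left_Ioo_le hκ0 hs.1).trans hκint) le_rfl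
      _ = 1 / 2 * I := lintegral_const_mul _ hym
  have hI0 : I = 0 := by
    by_contra h0
    have : 1 / 2 * I < 1 * I := ENNReal.mul_lt_mul_left h0 hItop (by simp)
    rw [one_mul] at this
    exact absurd hIle (not_le.2 this)
  have := (lintegral_eq_zero_iff hym).1 hI0
  filter_upwards [this] with t ht
  simpa [hy, not_le.2 (Real.exp_pos _)] using ht

/-! ### Convolution estimates in `L^ξ` and uniqueness for integral inequalities. -/

/-- Trilinear Hölder inequality for convolutions with a bounded integrable kernel. -/
theorem lintegral_convolution_mul_le {d : ℕ} {ξ q θ : ℝ} (hξ : 1 < ξ) (hθ : 0 ≤ θ)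
    (hθξ : θ ≤ 1 - 1 / ξ) {k m u W : Torus d → ENNReal} (hk : Measurable k) (hm : Measurable m)
    (hu : Measurable u) (hW : Measurable W) {M L : ENNReal} (hM : ∀ x, k x ≤ M)
    (hL : ∫⁻ x, k x ≤ L) :
    ∫⁻ x, ∫⁻ y, k (x - y) * (m y ^ (q * θ) * u y) * W x ^ (ξ - 1) ≤
      M ^ θ * L ^ (1 - θ) * (∫⁻ y, m y ^ q) ^ θ * (∫⁻ y, u y ^ ξ) ^ (1 / ξ) *
        (∫⁻ x, W x ^ ξ) ^ (1 - 1 / ξ) := by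
  have hξ0 : 0 < ξ := by linarith
  set c := 1 - θ - 1 / ξ with hc
  have hc0 : 0 ≤ c := by linarith
  have hξi : 0 < 1 / ξ := by positivity
  -- Hölder exponents `θ`, `1/ξ`, `c` with sum one, the kernel being split accordingly. The first
  -- factor carries both `m` and `W`, so there the kernel is bounded by its supremum; the other two
  -- use its mass. The hypothesis on `θ` says `0 ≤ c`.
  let f : Fin 3 → Torus d × Torus d → ENNReal :=
    ![fun z => k (z.1 - z.2) * m z.2 ^ q * W z.1 ^ ξ, fun z => k (z.1 - z.2) * u z.2 ^ ξ,
      fun z => k (z.1 - z.2) * W z.1 ^ ξ]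
  let p : Fin 3 → ℝ := ![θ, 1 / ξ, c]
  have hf0 : Measurable (f 0) := by simp only [f, Matrix.cons_val]; fun_prop
  have hf1 : Measurable (f 1) := by simp only [f, Matrix.cons_val]; fun_prop
  have hf2 : Measurable (f 2) := by simp only [f, Matrix.cons_val]; fun_prop
  have hkey := ENNReal.lintegral_prod_norm_pow_le (μ := (volume : Measure (Torus d × Torus d)))
    Finset.univ (f := f) (by
      intro i _
      fin_cases i
      · exact hf0.aemeasurable
      · exact hf1.aemeasurable
      · exact hf2.aemeasurable) (p := p)
    (by simp only [Fin.sum_univ_three, p, Matrix.cons_val]; rw [hc]; ring)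
    (by
      intro i _
      fin_cases i
      · exact hθ
      · exact hξi.le
      · exact hc0)
  simp only [Fin.prod_univ_three, p, Matrix.cons_val] at hkey
  have hpt : ∀ z : Torus d × Torus d, f 0 z ^ θ * f 1 z ^ (1 / ξ) * f 2 z ^ c =
      k (z.1 - z.2) * (m z.2 ^ (q * θ) * u z.2) * W z.1 ^ (ξ - 1) := by
    intro z
    simp only [f, Matrix.cons_val]
    rw [ENNReal.mul_rpow_of_nonneg _ _ hθ, ENNReal.mul_rpow_of_nonneg _ _ hθ,
      ENNReal.mul_rpow_of_nonneg _ _ hξi.le, ENNReal.mul_rpow_of_nonneg _ _ hc0,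
      ← ENNReal.rpow_mul, ← ENNReal.rpow_mul, ← ENNReal.rpow_mul, ← ENNReal.rpow_mul,
      mul_one_div_cancel hξ0.ne', ENNReal.rpow_one]
    have e1 : k (z.1 - z.2) = k (z.1 - z.2) ^ θ * k (z.1 - z.2) ^ (1 / ξ) * k (z.1 - z.2) ^ c := by
      rw [← ENNReal.rpow_add_of_nonneg _ _ hθ hξi.le,
        ← ENNReal.rpow_add_of_nonneg _ _ (by positivity) hc0,
        show θ + 1 / ξ + c = 1 by rw [hc]; ring, ENNReal.rpow_one]
    have e2 : W z.1 ^ (ξ - 1) = W z.1 ^ (ξ * θ) * W z.1 ^ (ξ * c) := by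
      rw [← ENNReal.rpow_add_of_nonneg _ _ (by positivity) (by positivity)]
      congr 1
      rw [hc]
      field_simp
      ring
    conv_rhs => rw [e1, e2]
    ring
  have hlhs : ∫⁻ x, ∫⁻ y, k (x - y) * (m y ^ (q * θ) * u y) * W x ^ (ξ - 1) =
      ∫⁻ z : Torus d × Torus d, f 0 z ^ θ * f 1 z ^ (1 / ξ) * f 2 z ^ c := by
    simp only [hpt]
    rw [Measure.volume_eq_prod, lintegral_prod _ (Measurable.aemeasurable (by fun_prop))]
  have hkx : ∀ x, ∫⁻ y, k (x - y) = ∫⁻ y, k y := fun x => lintegral_sub_left_eq_self k x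
  have hky : ∀ y, ∫⁻ x, k (x - y) = ∫⁻ y, k y := fun y => lintegral_sub_right_eq_self k y
  have i0 : ∫⁻ z, f 0 z ≤ M * (∫⁻ y, m y ^ q) * ∫⁻ x, W x ^ ξ := by
    calc ∫⁻ z, f 0 z ≤ ∫⁻ z : Torus d × Torus d, M * (W z.1 ^ ξ * m z.2 ^ q) := by
          refine lintegral_mono fun z => ?_
          simp only [f, Matrix.cons_val]
          rw [mul_assoc, mul_comm (W _ ^ _)]
          exact mul_le_mul' (hM _) le_rfl
      _ = _ := by
          rw [lintegral_const_mul _ (by fun_prop), Measure.volume_eq_prod,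
            lintegral_prod_mul (f := fun x => W x ^ ξ) (g := fun y => m y ^ q) (by fun_prop)
              (by fun_prop)]
          ring
  have i1 : ∫⁻ z, f 1 z ≤ L * ∫⁻ y, u y ^ ξ := by
    rw [Measure.volume_eq_prod, lintegral_prod_symm _ hf1.aemeasurable]
    calc _ = ∫⁻ y, (∫⁻ x, k x) * u y ^ ξ := by
          refine lintegral_congr fun y => ?_
          simp only [f, Matrix.cons_val]
          rw [lintegral_mul_const _ (by fun_prop), hky]
      _ = (∫⁻ x, k x) * ∫⁻ y, u y ^ ξ := lintegral_const_mul _ (by fun_prop)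
      _ ≤ _ := mul_le_mul' hL le_rfl
  have i2 : ∫⁻ z, f 2 z ≤ L * ∫⁻ x, W x ^ ξ := by
    rw [Measure.volume_eq_prod, lintegral_prod _ hf2.aemeasurable]
    calc _ = ∫⁻ x, (∫⁻ x, k x) * W x ^ ξ := by
          refine lintegral_congr fun x => ?_
          simp only [f, Matrix.cons_val]
          rw [lintegral_mul_const _ (by fun_prop), hkx]
      _ = (∫⁻ x, k x) * ∫⁻ x, W x ^ ξ := lintegral_const_mul _ (by fun_prop)
      _ ≤ _ := mul_le_mul' hL le_rfl
  rw [hlhs]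
  refine hkey.trans ?_
  calc (∫⁻ z, f 0 z) ^ θ * (∫⁻ z, f 1 z) ^ (1 / ξ) * (∫⁻ z, f 2 z) ^ c
      ≤ (M * (∫⁻ y, m y ^ q) * ∫⁻ x, W x ^ ξ) ^ θ * (L * ∫⁻ y, u y ^ ξ) ^ (1 / ξ) *
        (L * ∫⁻ x, W x ^ ξ) ^ c := by gcongr
    _ = _ := by
        rw [ENNReal.mul_rpow_of_nonneg _ _ hθ, ENNReal.mul_rpow_of_nonneg _ _ hθ,
          ENNReal.mul_rpow_of_nonneg _ _ hξi.le, ENNReal.mul_rpow_of_nonneg _ _ hc0,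
          show 1 - θ = 1 / ξ + c by rw [hc]; ring, show 1 - 1 / ξ = θ + c by rw [hc]; ring,
          ENNReal.rpow_add_of_nonneg _ _ hξi.le hc0, ENNReal.rpow_add_of_nonneg _ _ hθ hc0]
        ring

/-- Kernels on the torus with the short-time size of `2β` space derivatives of the heat kernel. -/
structure HeatTypeKernel {d : ℕ} (T C β : ℝ) (k : ℝ → Torus d → ℝ) : Prop where
  measurable : Measurable fun z : ℝ × Torus d => k z.1 z.2
  eq_zero : ∀ τ ≤ 0, ∀ x, k τ x = 0
  lintegral_le : ∀ τ ∈ Ioo 0 T, ∫⁻ x, ‖k τ x‖ₑ ≤ ENNReal.ofReal (C * τ ^ (-β))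
  le : ∀ τ ∈ Ioo 0 T, ∀ x, ‖k τ x‖ₑ ≤ ENNReal.ofReal (C * τ ^ (-β - d / 2))

theorem lintegral_parabolic_eq {d : ℕ} {T : ℝ} {H : ℝ × Torus d → ENNReal} (hH : Measurable H) :
    ∫⁻ z, H z ∂(parabolicMeasure d T) = ∫⁻ s in Ioo 0 T, ∫⁻ y, H (s, y) :=
  lintegral_prod _ hH.aemeasurable

/-- The dual form of an `L^ξ` bound: after Tonelli the trilinear inequality applies on each time
slice. Interpolating `τ^{-β-d/2}` and `τ^{-β}` with weights `θ` and `1-θ` gives `τ^{-(β+dθ/2)}`.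
Replacing this by `τ^{-α}`, one singularity common to all kernels, costs a power of `T`. -/
theorem HeatTypeKernel.lintegral_convolution_mul_le {d : ℕ} {T C β α ξ q θ : ℝ}
    {k : ℝ → Torus d → ℝ} (hk : HeatTypeKernel T C β k) (hC : 0 ≤ C)
    (hξ : 1 < ξ) (hθ : 0 ≤ θ) (hθξ : θ ≤ 1 - 1 / ξ) (hα : β + d / 2 * θ ≤ α)
    {m W : ℝ × Torus d → ENNReal} (hm : Measurable m) (hW : Measurable W) {A : ENNReal}
    (hA : ∀ᵐ s ∂(volume.restrict (Ioo 0 T)), ∫⁻ y, m (s, y) ^ q ≤ A)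
    {V : Torus d → ENNReal} (hV : Measurable V) {t : ℝ} (ht : t ∈ Ioo 0 T) :
    ∫⁻ x, (∫⁻ z, ‖k (t - z.1) (x - z.2)‖ₑ * (m z ^ (q * θ) * W z) ∂(parabolicMeasure d T)) *
        V x ^ (ξ - 1) ≤
      (∫⁻ s in Ioo 0 t, ENNReal.ofReal (C * T ^ (α - (β + d / 2 * θ)) * (t - s) ^ (-α)) * A ^ θ *
        (∫⁻ y, W (s, y) ^ ξ) ^ (1 / ξ)) * (∫⁻ x, V x ^ ξ) ^ (1 - 1 / ξ) := by
  have hT : 0 < T := ht.1.trans ht.2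
  have hkm := hk.measurable
  have hsub : Ioo 0 t ⊆ Ioo 0 T := Ioo_subset_Ioo_right ht.2.le
  have hk1 : Measurable fun p : Torus d × (ℝ × Torus d) => k (t - p.2.1) (p.1 - p.2.2) :=
    hkm.comp (f := fun p : Torus d × (ℝ × Torus d) => (t - p.2.1, p.1 - p.2.2)) (by fun_prop)
  have hF : Measurable fun p : Torus d × (ℝ × Torus d) =>
      ‖k (t - p.2.1) (p.1 - p.2.2)‖ₑ * (m p.2 ^ (q * θ) * W p.2) * V p.1 ^ (ξ - 1) := by
    have := hk1.enorm
    fun_prop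
  have hinner : ∀ x, (∫⁻ z, ‖k (t - z.1) (x - z.2)‖ₑ * (m z ^ (q * θ) * W z)
      ∂(parabolicMeasure d T)) * V x ^ (ξ - 1) = ∫⁻ z, ‖k (t - z.1) (x - z.2)‖ₑ *
      (m z ^ (q * θ) * W z) * V x ^ (ξ - 1) ∂(parabolicMeasure d T) := fun x => by
    rw [lintegral_mul_const]
    have := (hkm.comp (f := fun z : ℝ × Torus d => (t - z.1, x - z.2)) (by fun_prop)).enorm
    exact this.mul (by fun_prop)
  simp only [hinner]
  rw [lintegral_lintegral_swap hF.aemeasurable]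
  rw [lintegral_parabolic_eq (hF.lintegral_prod_left' (μ := (volume : Measure (Torus d))))]
  have hzero : ∫⁻ s in Ioo 0 T, ∫⁻ y, ∫⁻ x, ‖k (t - s) (x - y)‖ₑ *
      (m (s, y) ^ (q * θ) * W (s, y)) * V x ^ (ξ - 1) =
      ∫⁻ s in Ioo 0 t, ∫⁻ y, ∫⁻ x, ‖k (t - s) (x - y)‖ₑ *
      (m (s, y) ^ (q * θ) * W (s, y)) * V x ^ (ξ - 1) := by
    rw [← lintegral_indicator measurableSet_Ioo, ← lintegral_indicator measurableSet_Ioo]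
    refine lintegral_congr fun s => ?_
    by_cases hs : s ∈ Ioo 0 t
    · rw [indicator_of_mem hs, indicator_of_mem (hsub hs)]
    · rw [indicator_of_notMem hs]
      by_cases hsT : s ∈ Ioo 0 T
      · rw [indicator_of_mem hsT]
        have : t - s ≤ 0 := by
          by_contra h
          exact hs ⟨hsT.1, by linarith⟩
        simp [hk.eq_zero _ this]
      · rw [indicator_of_notMem hsT]
  refine hzero.le.trans ?_
  rw [← lintegral_mul_const _ ?_]
  swap
  · have : Measurable fun s => ∫⁻ y, W (s, y) ^ ξ :=
      Measurable.lintegral_prod_right' (f := fun z : ℝ × Torus d => W z ^ ξ) (by fun_prop)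
    fun_prop
  refine lintegral_mono_ae ?_
  filter_upwards [ae_mono (Measure.restrict_mono hsub le_rfl) hA,
    ae_restrict_mem measurableSet_Ioo] with s hs hst
  have hτ : 0 < t - s := by linarith [hst.2]
  have hτT : t - s ∈ Ioo 0 T := ⟨hτ, by linarith [hst.1, ht.2]⟩
  have hkτ : Measurable fun x => ‖k (t - s) x‖ₑ := (hkm.comp
    (f := fun x : Torus d => (t - s, x)) (by fun_prop)).enorm
  have hms : Measurable fun y => m (s, y) := by fun_prop
  have hWs : Measurable fun y => W (s, y) := by fun_prop
  have hkey := _root_.lintegral_convolution_mul_le (q := q) (k := fun x => ‖k (t - s) x‖ₑ) hξ hθ hθξ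
    hkτ hms hWs hV (hk.le _ hτT) (hk.lintegral_le _ hτT)
  rw [lintegral_lintegral_swap (Measurable.aemeasurable (by fun_prop))] at hkey
  refine hkey.trans ?_
  refine mul_le_mul' (mul_le_mul' (mul_le_mul' ?_ ?_) le_rfl) le_rfl
  · rw [ENNReal.ofReal_rpow_of_nonneg (by positivity) hθ,
      ENNReal.ofReal_rpow_of_nonneg (by positivity) (by
        have : 0 < 1 / ξ := by positivity
        linarith), ← ENNReal.ofReal_mul (by positivity)]
    refine ENNReal.ofReal_le_ofReal ?_
    rw [Real.mul_rpow hC (by positivity), Real.mul_rpow hC (by positivity), ← Real.rpow_mul hτ.le,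
      ← Real.rpow_mul hτ.le]
    have h1θ : 0 ≤ 1 - θ := by
      have : 0 < 1 / ξ := by positivity
      linarith
    have e1 : C ^ θ * C ^ (1 - θ) = C := by
      rw [← Real.rpow_add_of_nonneg hC hθ h1θ]; simp
    have e2 : (t - s) ^ ((-β - d / 2) * θ) * (t - s) ^ (-β * (1 - θ)) =
        (t - s) ^ (α - (β + d / 2 * θ)) * (t - s) ^ (-α) := by
      rw [← Real.rpow_add hτ, ← Real.rpow_add hτ]
      congr 1
      ring
    calc _ = (C ^ θ * C ^ (1 - θ)) *
          ((t - s) ^ ((-β - d / 2) * θ) * (t - s) ^ (-β * (1 - θ))) := by ring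
      _ = C * (t - s) ^ (α - (β + d / 2 * θ)) * (t - s) ^ (-α) := by rw [e1, e2]; ring
      _ ≤ _ := by
          have : 0 ≤ α - (β + d / 2 * θ) := by linarith
          have h3 := hτT.2.le
          gcongr
  · exact ENNReal.rpow_le_rpow hs hθ

/-- Uniqueness for integral inequalities with heat-type kernels and coefficients bounded in
`L^∞(0,T; L^q)`. -/
theorem ae_eq_zero_of_le_heatTypeKernel {d : ℕ} {ι : Type*} [Fintype ι] {T C α ξ q : ℝ}
    {β θ : ι → ℝ} {k : ι → ℝ → Torus d → ℝ} (hk : ∀ j, HeatTypeKernel T C (β j) (k j))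
    (hC : 0 ≤ C) (hξ : 1 < ξ) (hθ : ∀ j, 0 ≤ θ j) (hθξ : ∀ j, θ j ≤ 1 - 1 / ξ)
    (hα : α < 1) (hβα : ∀ j, β j + d / 2 * θ j ≤ α)
    {m W : ℝ × Torus d → ENNReal} (hm : Measurable m) (hW : Measurable W) {A c : ENNReal}
    (hAtop : A ≠ ⊤) (hc : c ≠ ⊤)
    (hA : ∀ᵐ s ∂(volume.restrict (Ioo 0 T)), ∫⁻ y, m (s, y) ^ q ≤ A)
    (hY : ∫⁻ s in Ioo 0 T, (∫⁻ y, W (s, y) ^ ξ) ^ (1 / ξ) < ⊤)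
    (h : ∀ᵐ t ∂(volume.restrict (Ioo 0 T)), ∀ᵐ x, W (t, x) ≤ ∑ j,
      ∫⁻ z, c * (‖k j (t - z.1) (x - z.2)‖ₑ * (m z ^ (q * θ j) * W z)) ∂(parabolicMeasure d T)) :
    ∀ᵐ t ∂(volume.restrict (Ioo 0 T)), ∫⁻ y, W (t, y) ^ ξ = 0 := by
  have hξ0 : 0 < ξ := by linarith
  set Y : ℝ → ENNReal := fun s => (∫⁻ y, W (s, y) ^ ξ) ^ (1 / ξ) with hYdef
  have hYm : Measurable Y := by
    have : Measurable fun s => ∫⁻ y, W (s, y) ^ ξ :=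
      Measurable.lintegral_prod_right' (f := fun z : ℝ × Torus d => W z ^ ξ) (by fun_prop)
    fun_prop
  set D : ℝ := ∑ j, (c * A ^ θ j * ENNReal.ofReal (C * T ^ (α - (β j + d / 2 * θ j)))).toReal
    with hD
  have hfin : ∀ j, c * A ^ θ j * ENNReal.ofReal (C * T ^ (α - (β j + d / 2 * θ j))) ≠ ⊤ := fun j =>
    ENNReal.mul_ne_top (ENNReal.mul_ne_top hc (ENNReal.rpow_ne_top_of_nonneg (hθ j) hAtop))
      ENNReal.ofReal_ne_top
  have hmain : ∀ᵐ t ∂(volume.restrict (Ioo 0 T)),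
      Y t ≤ ∫⁻ s in Ioo 0 t, ENNReal.ofReal (D * (t - s) ^ (-α)) * Y s := by
    filter_upwards [h, ae_lt_top hYm hY.ne, ae_restrict_mem measurableSet_Ioo] with t ht hYt htT
    set B := ∫⁻ x, W (t, x) ^ ξ with hB
    have hBtop : B ≠ ⊤ := by
      intro hB'
      have : Y t = ⊤ := by
        simp only [hYdef]
        rw [← hB, hB', ENNReal.top_rpow_of_pos (by positivity)]
      exact hYt.ne this
    by_cases hB0 : B = 0
    · have : Y t = 0 := by
        simp only [hYdef]
        rw [← hB, hB0, ENNReal.zero_rpow_of_pos (by positivity)]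
      rw [this]; exact zero_le
    have hWt : Measurable fun x => W (t, x) := by fun_prop
    have hT : 0 < T := htT.1.trans htT.2
    have hkm := fun (j : ι) (x : Torus d) => ((hk j).measurable.comp
      (f := fun z : ℝ × Torus d => (t - z.1, x - z.2)) (by fun_prop)).enorm
    have hkm2 : ∀ j, Measurable fun x => ∫⁻ z, ‖k j (t - z.1) (x - z.2)‖ₑ *
        (m z ^ (q * θ j) * W z) ∂(parabolicMeasure d T) := fun j => by
      have h1 : Measurable fun p : Torus d × (ℝ × Torus d) => k j (t - p.2.1) (p.1 - p.2.2) :=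
        (hk j).measurable.comp (f := fun p : Torus d × (ℝ × Torus d) => (t - p.2.1, p.1 - p.2.2))
          (by fun_prop)
      have h2 : Measurable fun p : Torus d × (ℝ × Torus d) => ‖k j (t - p.2.1) (p.1 - p.2.2)‖ₑ *
          (m p.2 ^ (q * θ j) * W p.2) := by
        have := h1.enorm
        fun_prop
      exact h2.lintegral_prod_right'
    -- Write `B = ∫ W · W^{ξ-1}` and bound only the first factor by the convolutions. The right side
    -- then carries `B^{1-1/ξ}`.
    have hsum : B ≤ (∑ j, c * ∫⁻ s in Ioo 0 t,
        ENNReal.ofReal (C * T ^ (α - (β j + d / 2 * θ j)) * (t - s) ^ (-α)) * A ^ θ j * Y s) *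
        B ^ (1 - 1 / ξ) := by
      calc B = ∫⁻ x, W (t, x) * W (t, x) ^ (ξ - 1) := by
            refine lintegral_congr fun x => ?_
            have := ENNReal.rpow_add_of_nonneg (x := W (t, x)) 1 (ξ - 1) zero_le_one (by linarith)
            rw [ENNReal.rpow_one] at this
            rw [← this]
            congr 1
            ring
        _ ≤ ∫⁻ x, (∑ j, ∫⁻ z, c * (‖k j (t - z.1) (x - z.2)‖ₑ * (m z ^ (q * θ j) * W z))
            ∂(parabolicMeasure d T)) * W (t, x) ^ (ξ - 1) := by
            refine lintegral_mono_ae ?_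
            filter_upwards [ht] with x hx
            gcongr
        _ = ∫⁻ x, ∑ j, c * ((∫⁻ z, ‖k j (t - z.1) (x - z.2)‖ₑ * (m z ^ (q * θ j) * W z)
            ∂(parabolicMeasure d T)) * W (t, x) ^ (ξ - 1)) := by
            refine lintegral_congr fun x => ?_
            rw [Finset.sum_mul]
            refine Finset.sum_congr rfl fun j _ => ?_
            rw [lintegral_const_mul' _ _ hc, mul_assoc]
        _ = ∑ j, c * ∫⁻ x, (∫⁻ z, ‖k j (t - z.1) (x - z.2)‖ₑ * (m z ^ (q * θ j) * W z)
            ∂(parabolicMeasure d T)) * W (t, x) ^ (ξ - 1) := by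
            rw [lintegral_finsetSum _ fun j _ => ?_]
            · refine Finset.sum_congr rfl fun j _ => lintegral_const_mul' _ _ hc
            · have := hkm2 j
              fun_prop
        _ ≤ ∑ j, c * ((∫⁻ s in Ioo 0 t,
            ENNReal.ofReal (C * T ^ (α - (β j + d / 2 * θ j)) * (t - s) ^ (-α)) * A ^ θ j * Y s) *
            B ^ (1 - 1 / ξ)) := by
            refine Finset.sum_le_sum fun j _ => mul_le_mul' le_rfl ?_
            exact (hk j).lintegral_convolution_mul_le hC hξ (hθ j) (hθξ j) (hβα j) hm hW hA hWt
              htT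
        _ = _ := by
            rw [Finset.sum_mul]
            simp only [mul_assoc]
    have hYt' : Y t * B ^ (1 - 1 / ξ) = B := by
      simp only [hYdef]
      rw [← hB, ← ENNReal.rpow_add _ _ hB0 hBtop]
      simp
    have hBp0 : B ^ (1 - 1 / ξ) ≠ 0 := by
      rw [Ne, ENNReal.rpow_eq_zero_iff]
      simp [hB0, hBtop]
    have hBpt : B ^ (1 - 1 / ξ) ≠ ⊤ := by
      rw [Ne, ENNReal.rpow_eq_top_iff]
      simp [hB0, hBtop]
    -- Dividing by `B^{1-1/ξ}`, permitted because `0 < B < ∞`, leaves `Y t = B^{1/ξ}` on the left.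
    have hY2 := (ENNReal.mul_le_mul_iff_left hBp0 hBpt).1 (hYt'.le.trans hsum)
    refine hY2.trans_eq ?_
    rw [Finset.sum_congr rfl fun j _ => (lintegral_const_mul' _ _ hc).symm,
      ← lintegral_finsetSum _ fun j _ => by fun_prop]
    refine setLIntegral_congr_fun measurableSet_Ioo fun s hs => ?_
    have hτ : 0 < t - s := by linarith [hs.2]
    rw [ENNReal.ofReal_mul (Finset.sum_nonneg fun j _ => ENNReal.toReal_nonneg),
      ENNReal.ofReal_sum_of_nonneg fun j _ => ENNReal.toReal_nonneg, Finset.sum_mul,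
      Finset.sum_mul]
    refine Finset.sum_congr rfl fun j _ => ?_
    rw [ENNReal.ofReal_toReal (hfin j), ENNReal.ofReal_mul (by positivity)]
    ring
  have hzero := ae_eq_zero_of_le_singular_convolution hα
    (Finset.sum_nonneg fun j _ => ENNReal.toReal_nonneg) hYm hY hmain
  filter_upwards [hzero] with t ht
  simp only [hYdef] at ht
  rw [ENNReal.rpow_eq_zero_iff] at ht
  rcases ht with ht | ht
  · exact ht.1
  · have : 0 < 1 / ξ := by positivity
    linarith [ht.2]

theorem HeatTypeKernel.mono {d : ℕ} {T C C' β : ℝ} {k : ℝ → Torus d → ℝ}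
    (hk : HeatTypeKernel T C β k) (hC : C ≤ C') : HeatTypeKernel T C' β k where
  measurable := hk.measurable
  eq_zero := hk.eq_zero
  lintegral_le τ hτ := (hk.lintegral_le τ hτ).trans (ENNReal.ofReal_le_ofReal
    (mul_le_mul_of_nonneg_right hC (Real.rpow_nonneg hτ.1.le _)))
  le τ hτ x := (hk.le τ hτ x).trans (ENNReal.ofReal_le_ofReal
    (mul_le_mul_of_nonneg_right hC (Real.rpow_nonneg hτ.1.le _)))

theorem exists_heatTypeKernel_torusHeat {d : ℕ} (hd : 0 < d) {T ν : ℝ} (hT : 0 < T) (hν : 0 < ν) :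
    ∃ C, 0 < C ∧ HeatTypeKernel (d := d) T C 0 (fun τ => torusHeat (ν * τ)) ∧
      ∀ j : Fin d, HeatTypeKernel T C (1 / 2) (fun τ => torusHeatDeriv j (ν * τ)) := by
  -- The derivative at time `ντ` is compared with the heat kernel at time `2ντ`, hence the horizon
  -- `2νT`.
  obtain ⟨C, hC, hle⟩ := exists_torusHeat_le d (2 * (ν * T)) (by positivity)
  have hmeas : Measurable fun z : ℝ × Torus d => (ν * z.1, z.2) := by fun_prop
  set C1 := C * ν ^ (-((d : ℝ) / 2)) with hC1
  set C2 := 8 ^ d * ν ^ (-(1 / 2) : ℝ) with hC2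
  set C3 := C2 * (C * (2 * ν) ^ (-((d : ℝ) / 2))) with hC3
  have p1 : 0 < C1 := by positivity
  have p2 : 0 < C2 := by positivity
  have p3 : 0 < C3 := by positivity
  refine ⟨1 + C1 + C2 + C3, by positivity, ?_, fun j => ?_⟩
  · refine ⟨measurable_torusHeat.comp hmeas, fun τ hτ x => torusHeat_of_nonpos hd
      (mul_nonpos_of_nonneg_of_nonpos hν.le hτ) x, fun τ hτ => ?_, fun τ hτ x => ?_⟩
    · refine (lintegral_torusHeat_le hd _).trans ?_
      rw [neg_zero, Real.rpow_zero, mul_one, ← ENNReal.ofReal_one]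
      exact ENNReal.ofReal_le_ofReal (by linarith)
    · rw [Real.enorm_of_nonneg (torusHeat_nonneg _ _), neg_zero, zero_sub]
      refine ENNReal.ofReal_le_ofReal ?_
      have h1 := hle (ν * τ) (mul_pos hν hτ.1) (by nlinarith [hτ.2, mul_pos hν hτ.1]) x
      rw [Real.mul_rpow hν.le hτ.1.le, ← mul_assoc] at h1
      refine h1.trans (mul_le_mul_of_nonneg_right ?_ (Real.rpow_nonneg hτ.1.le _))
      linarith
  · refine ⟨(measurable_torusHeatDeriv j).comp hmeas, fun τ hτ x => torusHeatDeriv_of_nonpos j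
      (mul_nonpos_of_nonneg_of_nonpos hν.le hτ) x, fun τ hτ => ?_, fun τ hτ x => ?_⟩
    · refine (lintegral_torusHeatDeriv_le hd j (mul_pos hν hτ.1)).trans ?_
      refine ENNReal.ofReal_le_ofReal ?_
      rw [Real.mul_rpow hν.le hτ.1.le, ← mul_assoc]
      refine mul_le_mul_of_nonneg_right ?_ (Real.rpow_nonneg hτ.1.le _)
      linarith
    · rw [Real.enorm_eq_ofReal_abs]
      refine ENNReal.ofReal_le_ofReal ?_
      have h1 := hle (2 * (ν * τ)) (by have := mul_pos hν hτ.1; positivity)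
        (by have := mul_lt_mul_of_pos_left hτ.2 hν; linarith) x
      have h2 := abs_torusHeatDeriv_le j (mul_pos hν hτ.1) x
      have h0 : 0 < τ := hτ.1
      calc _ ≤ 8 ^ d * (ν * τ) ^ (-(1 / 2) : ℝ) * (C * (2 * (ν * τ)) ^ (-((d : ℝ) / 2))) :=
            h2.trans (by gcongr)
        _ = C3 * τ ^ (-(1 / 2) - (d : ℝ) / 2) := by
            rw [Real.mul_rpow hν.le hτ.1.le, ← mul_assoc 2, Real.mul_rpow (by positivity) hτ.1.le,
              sub_eq_add_neg, Real.rpow_add hτ.1, hC3, hC2]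
            ring
        _ ≤ _ := by
            refine mul_le_mul_of_nonneg_right ?_ (Real.rpow_nonneg hτ.1.le _)
            linarith

/-! ### Trigonometric test functions. -/

/-- Real trigonometric monomials `Re (c · e^{2πi n·x})`. -/
noncomputable def trigMonomial {d : ℕ} (n : Fin d → ℤ) (c : ℂ) (x : Torus d) : ℝ :=
  (c * UnitAddTorus.mFourier n x).re

/-- The vector-valued test function whose `i`-th component is a trigonometric monomial. -/
noncomputable def trigTest {d l : ℕ} (n : Fin d → ℤ) (c : ℂ) (i : Fin l) (x : Torus d) : State l :=
  EuclideanSpace.single i (trigMonomial n c x)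

theorem mFourier_coe_apply {d : ℕ} (n : Fin d → ℤ) (y : Fin d → ℝ) :
    UnitAddTorus.mFourier n (fun j => (y j : UnitAddCircle)) =
      ∏ j, Complex.exp (2 * Real.pi * Complex.I * n j * y j) := by
  simp only [UnitAddTorus.mFourier, ContinuousMap.coe_mk]
  refine Finset.prod_congr rfl fun j _ => ?_
  erw [fourier_coe_apply]
  simp

theorem mFourier_single_coe {d : ℕ} (n : Fin d → ℤ) (j : Fin d) (s : ℝ) :
    UnitAddTorus.mFourier n (Pi.single j (s : UnitAddCircle)) =
      Complex.exp (2 * Real.pi * Complex.I * n j * s) := by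
  have : (Pi.single j (s : UnitAddCircle) : Torus d) =
      fun i => (((Pi.single j s : Fin d → ℝ) i : ℝ) : UnitAddCircle) := by
    funext i
    by_cases h : i = j
    · subst h; simp
    · simp [Pi.single_eq_of_ne h]
  rw [this, mFourier_coe_apply, Finset.prod_eq_single j]
  · simp
  · intro i _ hi
    simp [Pi.single_eq_of_ne hi]
  · simp

theorem torusSmooth_trigTest {d l : ℕ} (n : Fin d → ℤ) (c : ℂ) (i : Fin l) :
    TorusSmooth (trigTest (l := l) n c i) := by
  unfold TorusSmooth trigTest trigMonomial
  rw [contDiff_euclidean]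
  intro i'
  simp only [mFourier_coe_apply]
  by_cases h : i' = i
  · subst h
    simp only [PiLp.single_apply, if_true]
    refine Complex.reCLM.contDiff.comp (contDiff_const.mul (contDiff_prod fun j _ => ?_))
    refine ContDiff.cexp (contDiff_const.mul ?_)
    exact Complex.ofRealCLM.contDiff.comp (contDiff_apply ℝ ℝ j)
  · simp only [PiLp.single_apply, h, if_false]
    exact contDiff_const

/-- The complex amplitude `c` is what keeps the family of real test functions closed under
differentiation. -/
theorem torusPartial_trigMonomial {d : ℕ} (n : Fin d → ℤ) (c : ℂ) (j : Fin d) :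
    torusPartial j (trigMonomial n c) = trigMonomial n (2 * Real.pi * Complex.I * n j * c) := by
  funext x
  unfold torusPartial trigMonomial
  have h1 : HasDerivAt (fun s : ℝ => (c * UnitAddTorus.mFourier n (x + Pi.single j (s : UnitAddCircle))))
      (2 * Real.pi * Complex.I * n j * c * UnitAddTorus.mFourier n x) 0 := by
    simp only [mFourier_add_apply, mFourier_single_coe]
    have h2 : HasDerivAt (fun s : ℝ => Complex.exp (2 * Real.pi * Complex.I * n j * s))
        (2 * Real.pi * Complex.I * n j) 0 := by
      have h3 : HasDerivAt (fun s : ℝ => (s : ℂ)) 1 0 := Complex.ofRealCLM.hasDerivAt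
      have h4 := (h3.const_mul (2 * Real.pi * Complex.I * n j)).cexp
      simpa using h4
    have h5 := (h2.const_mul (UnitAddTorus.mFourier n x)).const_mul c
    exact h5.congr_deriv (by ring)
  exact (Complex.reCLM.hasFDerivAt.comp_hasDerivAt (0 : ℝ) h1).deriv

theorem torusLaplacian_trigMonomial {d : ℕ} (n : Fin d → ℤ) (c : ℂ) (x : Torus d) :
    torusLaplacian (trigMonomial n c) x = -laplaceSymbol n * trigMonomial n c x := by
  simp only [torusLaplacian, torusPartial_trigMonomial]
  have : ∀ j, trigMonomial n (2 * Real.pi * Complex.I * n j * (2 * Real.pi * Complex.I * n j * c)) x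
      = -(4 * Real.pi ^ 2) * (n j : ℝ) ^ 2 * trigMonomial n c x := by
    intro j
    unfold trigMonomial
    have : (2 * Real.pi * Complex.I * n j * (2 * Real.pi * Complex.I * n j * c) *
        UnitAddTorus.mFourier n x) = ((-(4 * Real.pi ^ 2) * (n j : ℝ) ^ 2 : ℝ) : ℂ) *
        (c * UnitAddTorus.mFourier n x) := by
      push_cast
      linear_combination (4 * Real.pi ^ 2 * n j ^ 2 * c * UnitAddTorus.mFourier n x) *
        Complex.I_sq
    rw [this, Complex.re_ofReal_mul]
  simp only [this]
  rw [← Finset.sum_mul, ← Finset.mul_sum, laplaceSymbol]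
  ring

theorem integral_mFourier {d : ℕ} (n : Fin d → ℤ) :
    ∫ x : Torus d, UnitAddTorus.mFourier n x = if n = 0 then 1 else 0 := by
  simp only [UnitAddTorus.mFourier, ContinuousMap.coe_mk]
  rw [integral_fintype_prod_volume_eq_prod (𝕜 := ℂ) (fun i (x : UnitAddCircle) => fourier (n i) x)]
  simp only [integral_fourier]
  split_ifs with h
  · subst h; simp
  · obtain ⟨i, hi⟩ := Function.ne_iff.1 h
    exact Finset.prod_eq_zero (Finset.mem_univ i) (by simpa using hi)

theorem integrable_mFourier {d : ℕ} (n : Fin d → ℤ) :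
    Integrable (fun x : Torus d => UnitAddTorus.mFourier n x) :=
  Integrable.of_bound (UnitAddTorus.mFourier n).continuous.aestronglyMeasurable 1
    (Eventually.of_forall fun x => (norm_mFourier_apply n x).le)

/-- From `Re z = (z + conj z)/2`, frequencies `n` and `-n` each carry half. The two conditional
terms are added so that `n = 0`, where both hold, needs no separate case. -/
theorem mFourierCoeff_trigMonomial {d : ℕ} (n k : Fin d → ℤ) (c : ℂ) :
    UnitAddTorus.mFourierCoeff (fun x => (trigMonomial n c x : ℂ)) k =
      (if k = n then c / 2 else 0) + (if k = -n then (starRingEnd ℂ) c / 2 else 0) := by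
  rw [mFourierCoeff_eq_integral_volume]
  have h1 : ∀ x : Torus d, UnitAddTorus.mFourier (-k) x * (trigMonomial n c x : ℂ) =
      c / 2 * UnitAddTorus.mFourier (n - k) x +
        (starRingEnd ℂ) c / 2 * UnitAddTorus.mFourier (-n - k) x := by
    intro x
    rw [trigMonomial, Complex.re_eq_add_conj, map_mul, ← UnitAddTorus.mFourier_neg, sub_eq_add_neg,
      sub_eq_add_neg, UnitAddTorus.mFourier_add, UnitAddTorus.mFourier_add]
    ring
  simp only [h1]
  rw [integral_add ((integrable_mFourier _).const_mul _) ((integrable_mFourier _).const_mul _),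
    integral_const_mul, integral_const_mul, integral_mFourier, integral_mFourier]
  simp only [sub_eq_zero, mul_ite, mul_one, mul_zero, eq_comm]

/-- The symmetry `a(-n) = conj a(n)` of a real distribution merges the contributions of `n` and
`-n`. Letting `c` vary recovers the full complex coefficient. -/
theorem torusPairing_trigTest {d l : ℕ} {s : ℝ} {a : FourierFamily d l}
    (ha : a ∈ torusSobolev d l s) (n : Fin d → ℤ) (c : ℂ) (i : Fin l) :
    torusPairing a (trigTest n c i) = ((starRingEnd ℂ) c * a n i).re := by
  have h1 : ∀ k, inner ℂ (torusFourier (trigTest (l := l) n c i) k) (a k) =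
      (if k = n then (starRingEnd ℂ) c / 2 * a n i else 0) +
        (if k = -n then c / 2 * a (-n) i else 0) := by
    intro k
    rw [PiLp.inner_apply, Finset.sum_eq_single i]
    · have : torusFourier (trigTest (l := l) n c i) k i =
          UnitAddTorus.mFourierCoeff (fun x => (trigMonomial n c x : ℂ)) k := by
        simp [torusFourier, trigTest]
      rw [this, mFourierCoeff_trigMonomial, RCLike.inner_apply, map_add, mul_add]
      congr 1
      · split_ifs with h
        · subst h; simp only [map_div₀, map_ofNat]; ring
        · simp
      · split_ifs with h
        · subst h; simp only [map_div₀, map_ofNat, Complex.conj_conj]; ring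
        · simp
    · intro i' _ hi'
      have : torusFourier (trigTest (l := l) n c i) k i' = 0 := by
        simp [torusFourier, trigTest, hi', mFourierCoeff_eq_integral_volume]
      rw [this, inner_zero_left]
    · simp
  have h2 : HasSum (fun k => inner ℂ (torusFourier (trigTest (l := l) n c i) k) (a k))
      ((starRingEnd ℂ) c / 2 * a n i + c / 2 * a (-n) i) := by
    simp only [h1]
    exact (hasSum_ite_eq n _).add (hasSum_ite_eq (-n) _)
  rw [torusPairing, h2.tsum_eq, ha.1 n i]
  simp only [Complex.add_re, Complex.mul_re, Complex.div_ofNat_re, Complex.div_ofNat_im,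
    Complex.conj_re, Complex.conj_im]
  ring

theorem integral_mul_trigMonomial {d : ℕ} {u : Torus d → ℝ} (hu : Integrable u) (n : Fin d → ℤ)
    (c : ℂ) : ∫ x, u x * trigMonomial n c x =
      ((starRingEnd ℂ) c * UnitAddTorus.mFourierCoeff (fun x => (u x : ℂ)) n).re := by
  rw [mFourierCoeff_eq_integral_volume, ← integral_const_mul]
  have hint : Integrable fun x => (starRingEnd ℂ) c * (UnitAddTorus.mFourier (-n) x * (u x : ℂ)) :=
    (integrable_mFourier_mul _ hu.ofReal).const_mul _
  have := integral_re (𝕜 := ℂ) hint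
  refine Eq.trans ?_ this
  refine integral_congr_ae (Eventually.of_forall fun x => ?_)
  have h1 : (starRingEnd ℂ) c * (UnitAddTorus.mFourier (-n) x * (u x : ℂ)) =
      (u x : ℂ) * (starRingEnd ℂ) (c * UnitAddTorus.mFourier n x) := by
    rw [UnitAddTorus.mFourier_neg, map_mul]; ring
  simp only [trigMonomial]
  rw [h1]
  change _ = Complex.re _
  rw [Complex.re_ofReal_mul, Complex.conj_re]

theorem integrable_mul_trigMonomial {d : ℕ} {u : Torus d → ℝ} (hu : Integrable u) (n : Fin d → ℤ)
    (c : ℂ) : Integrable (fun x => u x * trigMonomial n c x) := by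
  refine hu.mul_bdd (c := ‖c‖) ?_ ?_
  · exact (Complex.continuous_re.comp (continuous_const.mul
      (UnitAddTorus.mFourier n).continuous)).aestronglyMeasurable
  · refine Eventually.of_forall fun x => ?_
    refine (Complex.abs_re_le_norm _).trans ?_
    rw [norm_mul, norm_mFourier_apply, mul_one]

/-- The right-hand side of the weak formulation tested with a trigonometric monomial. -/
theorem integral_weak_trigMonomial {d : ℕ} {T ν : ℝ} {u g : ℝ → Torus d → ℝ}
    {G : ℝ → Torus d → EuclideanSpace ℝ (Fin d)}
    (hu : Integrable (Function.uncurry u) (parabolicMeasure d T))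
    (hg : Integrable (Function.uncurry g) (parabolicMeasure d T))
    (hG : ∀ j, Integrable (fun z => G z.1 z.2 j) (parabolicMeasure d T))
    {ρ : ℝ → ℝ} {t : ℝ} (ht : t ∈ Icc 0 T) (hρ : ∀ s ∈ Ioo 0 t, ρ s = 1) (n : Fin d → ℤ) (c : ℂ) :
    ∫ s in (0 : ℝ)..t, ∫ x : Torus d, (ν * u s x * torusLaplacian (trigMonomial n c) x +
        ρ s * (g s x * trigMonomial n c x - ∑ j, G s x j * torusPartial j (trigMonomial n c) x)) =
      ((starRingEnd ℂ) c * ∫ s in Ioo 0 t, (-((ν * laplaceSymbol n : ℝ) : ℂ) *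
            UnitAddTorus.mFourierCoeff (fun x => (u s x : ℂ)) n +
          (UnitAddTorus.mFourierCoeff (fun x => (g s x : ℂ)) n + ∑ j, 2 * Real.pi * Complex.I * n j *
            UnitAddTorus.mFourierCoeff (fun x => (G s x j : ℂ)) n))).re := by
  have hle : volume.restrict (Ioo 0 t) ≤ volume.restrict (Ioo 0 T) :=
    Measure.restrict_mono (Ioo_subset_Ioo_right ht.2) le_rfl
  set b : ℝ → ℂ := fun s => -((ν * laplaceSymbol n : ℝ) : ℂ) *
            UnitAddTorus.mFourierCoeff (fun x => (u s x : ℂ)) n +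
          (UnitAddTorus.mFourierCoeff (fun x => (g s x : ℂ)) n + ∑ j, 2 * Real.pi * Complex.I * n j *
            UnitAddTorus.mFourierCoeff (fun x => (G s x j : ℂ)) n) with hb
  have hbint : Integrable b (volume.restrict (Ioo 0 t)) := by
    refine Integrable.mono_measure ?_ hle
    exact ((integrable_mFourierCoeff hu n).const_mul _).add ((integrable_mFourierCoeff hg n).add
      (integrable_finsetSum _ fun j _ =>
        (integrable_mFourierCoeff (g := fun s x => G s x j) (hG j) n).const_mul _))
  rw [intervalIntegral.integral_of_le ht.1, integral_Ioc_eq_integral_Ioo, ← integral_const_mul]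
  refine Eq.trans ?_ (integral_re (𝕜 := ℂ) (hbint.const_mul _))
  refine integral_congr_ae ?_
  filter_upwards [ae_mono hle hu.prod_right_ae, ae_mono hle hg.prod_right_ae,
    ae_mono hle (ae_all_iff.2 fun j => (hG j).prod_right_ae), ae_restrict_mem measurableSet_Ioo]
    with s hus hgs hGs hs
  have h1 : ∀ x, ν * u s x * torusLaplacian (trigMonomial n c) x +
        ρ s * (g s x * trigMonomial n c x - ∑ j, G s x j * torusPartial j (trigMonomial n c) x) =
      -(ν * laplaceSymbol n) * (u s x * trigMonomial n c x) + (g s x * trigMonomial n c x -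
        ∑ j, G s x j * trigMonomial n (2 * Real.pi * Complex.I * n j * c) x) := fun x => by
    rw [torusLaplacian_trigMonomial, hρ s hs, one_mul]
    simp only [torusPartial_trigMonomial]
    ring
  simp only [h1]
  have i1 : Integrable fun x => u s x * trigMonomial n c x := integrable_mul_trigMonomial hus n c
  have i2 : Integrable fun x => g s x * trigMonomial n c x := integrable_mul_trigMonomial hgs n c
  have i3 : ∀ j ∈ Finset.univ, Integrable fun x =>
      G s x j * trigMonomial n (2 * Real.pi * Complex.I * n j * c) x := fun j _ =>
    integrable_mul_trigMonomial (hGs j) n _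
  have i4 : Integrable fun x => g s x * trigMonomial n c x -
      ∑ j, G s x j * trigMonomial n (2 * Real.pi * Complex.I * n j * c) x :=
    i2.sub (integrable_finsetSum _ i3)
  rw [integral_add (i1.const_mul _) i4,
    integral_sub i2 (integrable_finsetSum _ i3), integral_finsetSum _ i3, integral_const_mul,
    integral_mul_trigMonomial (u := u s) hus n c,
    integral_mul_trigMonomial (u := g s) hgs n c,
    Finset.sum_congr rfl fun j _ => integral_mul_trigMonomial (hGs j) n _]
  change _ = Complex.re _
  rw [mul_add, mul_add, Complex.add_re, Complex.add_re, Finset.mul_sum, Complex.re_sum]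
  rw [show (starRingEnd ℂ) c * (-((ν * laplaceSymbol n : ℝ) : ℂ) *
      UnitAddTorus.mFourierCoeff (fun x => (u s x : ℂ)) n) = ((-(ν * laplaceSymbol n) : ℝ) : ℂ) *
      ((starRingEnd ℂ) c * UnitAddTorus.mFourierCoeff (fun x => (u s x : ℂ)) n) by
    push_cast; ring, Complex.re_ofReal_mul, sub_eq_add_neg, ← Finset.sum_neg_distrib]
  -- The minus sign of `-F·∇η` is absorbed by `conj(2πi nⱼ) = -2πi nⱼ`, giving the symbol of `div
  -- F`.
  congr 2
  refine Finset.sum_congr rfl fun j _ => ?_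
  rw [← Complex.neg_re]
  congr 1
  simp only [map_mul, Complex.conj_I, Complex.conj_ofReal, map_ofNat, map_intCast]
  ring

/-! ### Measurability and integrability of solutions and nonlinear terms. -/

theorem parabolicMeasure_mono {d : ℕ} {S T : ℝ} (h : S ≤ T) :
    parabolicMeasure d S ≤ parabolicMeasure d T := by
  have h1 : ∀ T : ℝ, parabolicMeasure d T =
      ((volume : Measure ℝ).prod (volume : Measure (Torus d))).restrict (Ioo 0 T ×ˢ univ) := fun T => by
    rw [← Measure.prod_restrict, Measure.restrict_univ]
  rw [h1, h1]
  exact Measure.restrict_mono (prod_mono (Ioo_subset_Ioo_right h) le_rfl) le_rfl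

theorem parabolicMeasure_ae_pos {d : ℕ} {T : ℝ} : ∀ᵐ z ∂(parabolicMeasure d T), 0 < z.1 := by
  have : ∀ᵐ t ∂((volume : Measure ℝ).restrict (Ioo 0 T)), 0 < t :=
    (ae_restrict_mem measurableSet_Ioo).mono fun t ht => ht.1
  exact Measure.quasiMeasurePreserving_fst.ae this

theorem parabolicMeasure_absolutelyContinuous {d : ℕ} {T : ℝ} :
    parabolicMeasure d T ≪
      ((volume : Measure ℝ).restrict (Ioi (0 : ℝ))).prod (volume : Measure (Torus d)) :=
  Measure.AbsolutelyContinuous.prod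
    (Measure.absolutelyContinuous_of_le (Measure.restrict_mono Ioo_subset_Ioi_self le_rfl))
    Measure.AbsolutelyContinuous.rfl

theorem eLpNorm_ofReal_eq {α E : Type*} [MeasurableSpace α] [NormedAddCommGroup E] {μ : Measure α}
    {p : ℝ} (hp : 0 < p) (u : α → E) :
    eLpNorm u (ENNReal.ofReal p) μ = (∫⁻ x, ‖u x‖ₑ ^ p ∂μ) ^ (1 / p) := by
  rw [eLpNorm_eq_lintegral_rpow_enorm_toReal (by simpa using hp) ENNReal.ofReal_ne_top,
    ENNReal.toReal_ofReal hp.le]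

theorem lintegral_rpow_eq_eLpNorm {α E : Type*} [MeasurableSpace α] [NormedAddCommGroup E]
    {μ : Measure α} {p : ℝ} (hp : 0 < p) (u : α → E) :
    ∫⁻ x, ‖u x‖ₑ ^ p ∂μ = eLpNorm u (ENNReal.ofReal p) μ ^ p := by
  rw [eLpNorm_ofReal_eq hp, ← ENNReal.rpow_mul, one_div_mul_cancel hp.ne', ENNReal.rpow_one]

/-- A jointly measurable representative of an element of the solution class, with its bounds. -/
theorem SolutionClass.exists_measurable_rep {d l : ℕ} {T γ q ξ : ℝ} (hq : 1 ≤ q)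
    (v : SolutionClass d l T γ q ξ) :
    ∃ V : ℝ × Torus d → State l, StronglyMeasurable V ∧
      (∀ᵐ z ∂(parabolicMeasure d T), v.toFun z.1 z.2 = V z) ∧
      (∃ A : ENNReal, A ≠ ⊤ ∧ ∀ᵐ s ∂(volume.restrict (Ioo 0 T)),
        eLpNorm (fun y => V (s, y)) (ENNReal.ofReal q) volume ≤ A) ∧
      ∫⁻ s in Ioo 0 T, eLpNorm (fun y => V (s, y)) (ENNReal.ofReal ξ) volume < ⊤ := by
  obtain ⟨V, hVm, hV⟩ := v.aestronglyMeasurable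
  have hV' : ∀ᵐ s ∂(volume.restrict (Ioo 0 T)), v.toFun s =ᵐ[volume] fun y => V (s, y) :=
    Measure.ae_ae_of_ae_prod hV
  refine ⟨V, hVm, hV, ⟨_, v.memLinftyLq.ne, ?_⟩, ?_⟩
  · filter_upwards [hV', ENNReal.ae_le_essSup fun t => eLpNorm (v.toFun t) (ENNReal.ofReal q)
      (volume : Measure (Torus d))] with s hs hle
    rw [← eLpNorm_congr_ae hs]
    exact hle
  · have hfin := v.memLqLxi
    rw [mixedNorm, ENNReal.rpow_lt_top_iff_of_pos (by positivity)] at hfin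
    -- On a bounded time interval, `L^q` in time embeds in `L¹` in time, which is all that Gronwall
    -- needs.
    have hsq : ∀ x : ENNReal, x ≤ 1 + x ^ q := fun x => by
      rcases le_total x 1 with h | h
      · exact h.trans le_self_add
      · refine le_trans ?_ le_add_self
        conv_lhs => rw [← ENNReal.rpow_one x]
        exact ENNReal.rpow_le_rpow_of_exponent_le h hq
    calc ∫⁻ s in Ioo 0 T, eLpNorm (fun y => V (s, y)) (ENNReal.ofReal ξ) volume
        = ∫⁻ s in Ioo 0 T, eLpNorm (v.toFun s) (ENNReal.ofReal ξ) volume := by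
          refine lintegral_congr_ae ?_
          filter_upwards [hV'] with s hs
          exact (eLpNorm_congr_ae hs).symm
      _ ≤ ∫⁻ s in Ioo 0 T, (1 + eLpNorm (v.toFun s) (ENNReal.ofReal ξ) volume ^ q) :=
          lintegral_mono fun s => hsq _
      _ = (∫⁻ _s in Ioo 0 T, 1) +
          ∫⁻ s in Ioo 0 T, eLpNorm (v.toFun s) (ENNReal.ofReal ξ) volume ^ q :=
          lintegral_add_left measurable_const _
      _ < ⊤ := ENNReal.add_lt_top.2 ⟨by simp, hfin⟩

/-- Interpolation: the `h`-th power is integrable in space-time. -/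
theorem lintegral_rpow_lt_top_of_bounds {d l : ℕ} {T q ξ h : ℝ} (hh : 1 < h) (hq : 0 < q)
    (hξ : 1 < ξ) (hθ : (h - 1) / q ≤ 1 - 1 / ξ) {V : ℝ × Torus d → State l}
    (hV : StronglyMeasurable V) {A : ENNReal} (hA : A ≠ ⊤)
    (hVA : ∀ᵐ s ∂(volume.restrict (Ioo 0 T)),
        eLpNorm (fun y => V (s, y)) (ENNReal.ofReal q) volume ≤ A)
    (hVξ : ∫⁻ s in Ioo 0 T, eLpNorm (fun y => V (s, y)) (ENNReal.ofReal ξ) volume < ⊤) :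
    ∫⁻ z, ‖V z‖ₑ ^ h ∂(parabolicMeasure d T) < ⊤ := by
  have hVm := hV.enorm
  have h0 : 0 ≤ (h - 1) / q := div_nonneg (by linarith) hq.le
  rw [lintegral_parabolic_eq (by fun_prop)]
  calc ∫⁻ s in Ioo 0 T, ∫⁻ y, ‖V (s, y)‖ₑ ^ h
      ≤ ∫⁻ s in Ioo 0 T, A ^ (h - 1) * eLpNorm (fun y => V (s, y)) (ENNReal.ofReal ξ) volume := by
        refine lintegral_mono_ae ?_
        filter_upwards [hVA] with s hs
        have hVs : Measurable fun y => ‖V (s, y)‖ₑ := by fun_prop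
        -- With `k = W = 1` on a probability space the trilinear bound reduces to `∫ |V|^{h-1}|V| ≤
        -- ‖V‖_q^{h-1} ‖V‖_ξ`.
        have hkey := lintegral_convolution_mul_le (q := q) (k := fun _ => 1) (W := fun _ => 1)
          (M := 1) (L := 1) hξ h0 hθ measurable_const hVs hVs measurable_const
          (fun _ => le_rfl) (by simp)
        simp only [ENNReal.one_rpow, one_mul, mul_one, lintegral_const, measure_univ] at hkey
        rw [mul_div_cancel₀ _ hq.ne', lintegral_rpow_eq_eLpNorm hq, ← ENNReal.rpow_mul,
          mul_div_cancel₀ _ hq.ne', ← eLpNorm_ofReal_eq (by linarith)] at hkey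
        have e1 : ∀ y, ‖V (s, y)‖ₑ ^ h = ‖V (s, y)‖ₑ ^ (h - 1) * ‖V (s, y)‖ₑ := fun y => by
          conv_rhs => rw [← ENNReal.rpow_one ‖V (s, y)‖ₑ, ← ENNReal.rpow_mul, one_mul,
            ← ENNReal.rpow_add_of_nonneg _ _ (by linarith) zero_le_one, sub_add_cancel]
        simp only [e1]
        refine hkey.trans (mul_le_mul' ?_ le_rfl)
        exact ENNReal.rpow_le_rpow hs (by linarith)
    _ = A ^ (h - 1) * ∫⁻ s in Ioo 0 T, eLpNorm (fun y => V (s, y)) (ENNReal.ofReal ξ) volume :=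
        lintegral_const_mul' _ _ (ENNReal.rpow_ne_top_of_nonneg (by linarith) hA)
    _ < ⊤ := ENNReal.mul_lt_top (ENNReal.rpow_lt_top_of_nonneg (by linarith) hA) hVξ

/-- Measurability of a superposition operator. -/
theorem aestronglyMeasurable_superposition {d l : ℕ} {T : ℝ} {E : Type*} [NormedAddCommGroup E]
    [SecondCountableTopology E] [MeasurableSpace E] [BorelSpace E] {f : ℝ → Torus d → State l → E}
    (hf : Measurable fun z : Ioi (0 : ℝ) × Torus d × State l => f z.1 z.2.1 z.2.2)
    {v : ℝ → Torus d → State l} {V : ℝ × Torus d → State l} (hV : StronglyMeasurable V)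
    (hvV : ∀ᵐ z ∂(parabolicMeasure d T), v z.1 z.2 = V z) :
    AEStronglyMeasurable (fun z => f z.1 z.2 (v z.1 z.2)) (parabolicMeasure d T) := by
  classical
  have hVm := hV.measurable
  have hs : MeasurableSet {z : ℝ × Torus d | 0 < z.1} :=
    measurableSet_lt measurable_const measurable_fst
  have h1 : Measurable fun z : {z : ℝ × Torus d | 0 < z.1} => f z.1.1 z.1.2 (V z.1) := by
    have : Measurable fun z : {z : ℝ × Torus d | 0 < z.1} =>
        ((⟨z.1.1, z.2⟩, z.1.2, V z.1) : Ioi (0 : ℝ) × Torus d × State l) :=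
      Measurable.prodMk (Measurable.subtype_mk (by fun_prop)) (by fun_prop)
    exact hf.comp this
  -- The nonlinearity is measurable only over positive times; extending it by zero changes nothing
  -- on `(0, T)`.
  have h2 : Measurable fun z : ℝ × Torus d =>
      if hz : z ∈ {z : ℝ × Torus d | 0 < z.1} then f z.1 z.2 (V z) else 0 :=
    Measurable.dite h1 measurable_const hs
  refine ⟨_, h2.stronglyMeasurable, ?_⟩
  filter_upwards [hvV, parabolicMeasure_ae_pos] with z hz hpos
  rw [hz]
  split_ifs
  rfl

theorem integrable_of_norm_le_rpow {d l : ℕ} {T h : ℝ} (hh : 1 < h) {E : Type*}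
    [NormedAddCommGroup E] {V : ℝ × Torus d → State l} (hV : StronglyMeasurable V)
    (hVh : ∫⁻ z, ‖V z‖ₑ ^ h ∂(parabolicMeasure d T) < ⊤) {u : ℝ × Torus d → E}
    (hu : AEStronglyMeasurable u (parabolicMeasure d T)) {C p : ℝ} (hp : 0 ≤ p) (hph : p ≤ h)
    (hbd : ∀ᵐ z ∂(parabolicMeasure d T), ‖u z‖ ≤ C * (1 + ‖V z‖ ^ p)) :
    Integrable u (parabolicMeasure d T) := by
  have h1 : Integrable (fun z => ‖V z‖ ^ h) (parabolicMeasure d T) := by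
    have hVm := hV.measurable
    refine ⟨Measurable.aestronglyMeasurable (by fun_prop), ?_⟩
    rw [HasFiniteIntegral]
    refine lt_of_eq_of_lt (lintegral_congr fun z => ?_) hVh
    rw [Real.enorm_rpow_of_nonneg (norm_nonneg _) (by linarith), enorm_norm]
  have h2 : Integrable (fun z => |C| * (2 + ‖V z‖ ^ h)) (parabolicMeasure d T) :=
    ((integrable_const _).add h1).const_mul _
  refine h2.mono' hu ?_
  filter_upwards [hbd] with z hz
  have h3 : ‖V z‖ ^ p ≤ 1 + ‖V z‖ ^ h := by
    rcases le_total ‖V z‖ 1 with h4 | h4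
    · have h5 := Real.rpow_le_one (norm_nonneg _) h4 hp
      have h6 := Real.rpow_nonneg (norm_nonneg (V z)) h
      linarith
    · have := Real.rpow_le_rpow_of_exponent_le h4 hph
      linarith
  have h6 := Real.rpow_nonneg (norm_nonneg (V z)) p
  calc ‖u z‖ ≤ C * (1 + ‖V z‖ ^ p) := hz
    _ ≤ |C| * (1 + ‖V z‖ ^ p) := mul_le_mul_of_nonneg_right (le_abs_self C) (by linarith)
    _ ≤ _ := mul_le_mul_of_nonneg_left (by linarith) (abs_nonneg C)

theorem torusPartial_zero {d : ℕ} (j : Fin d) : torusPartial j (fun _ : Torus d => (0 : ℝ)) = 0 := by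
  funext x
  simp [torusPartial]

theorem torusLaplacian_zero {d : ℕ} (x : Torus d) :
    torusLaplacian (fun _ : Torus d => (0 : ℝ)) x = 0 := by
  simp only [torusLaplacian, torusPartial_zero]
  refine Finset.sum_eq_zero fun j _ => ?_
  exact congrFun (torusPartial_zero j) x

/-- A test function supported in component `i` decouples the system into one scalar equation per
frequency. The datum is left as an integral since it cancels between two solutions. -/
theorem WeakFormulation.re_conj_mul_trace_eq {d l : ℕ} {T γ q ξ : ℝ} {μ : Fin l → ℝ}
    {f : Fin l → ℝ → Torus d → State l → ℝ}
    {F : Fin l → ℝ → Torus d → State l → EuclideanSpace ℝ (Fin d)}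
    {v₀ : Torus d → State l} {ρ : ℝ → ℝ} {v : SolutionClass d l T γ q ξ}
    (hw : WeakFormulation μ f F v₀ ρ v) (i : Fin l)
    (hv : Integrable (fun z => v.toFun z.1 z.2 i) (parabolicMeasure d T))
    (hf : Integrable (fun z => f i z.1 z.2 (v.toFun z.1 z.2)) (parabolicMeasure d T))
    (hF : ∀ j, Integrable (fun z => F i z.1 z.2 (v.toFun z.1 z.2) j) (parabolicMeasure d T))
    {t : ℝ} (ht : t ∈ Icc 0 T) (hρ : ∀ s ∈ Ioo 0 t, ρ s = 1) (n : Fin d → ℤ) (c : ℂ) :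
    ((starRingEnd ℂ) c * v.trace t n i).re =
      (∫ x, inner ℝ (v₀ x) (trigTest n c i x)) +
      ((starRingEnd ℂ) c * ∫ s in Ioo 0 t, (-((μ i * laplaceSymbol n : ℝ) : ℂ) *
            UnitAddTorus.mFourierCoeff (fun x => (v.toFun s x i : ℂ)) n +
          (UnitAddTorus.mFourierCoeff (fun x => (f i s x (v.toFun s x) : ℂ)) n +
            ∑ j, 2 * Real.pi * Complex.I * n j *
            UnitAddTorus.mFourierCoeff (fun x => (F i s x (v.toFun s x) j : ℂ)) n))).re := by
  have h1 := hw (trigTest n c i) (torusSmooth_trigTest n c i) t ht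
  rw [torusPairing_trigTest (v.trace_mem t ht)] at h1
  rw [h1]
  congr 1
  rw [Finset.sum_eq_single i]
  · have hη : (fun z : Torus d => trigTest n c i z i) = trigMonomial n c := by
      funext z; simp [trigTest]
    have hη' : ∀ z : Torus d, trigTest n c i z i = trigMonomial n c z := congrFun hη
    simp only [hη']
    exact integral_weak_trigMonomial (u := fun s x => v.toFun s x i)
      (g := fun s x => f i s x (v.toFun s x)) (G := fun s x => F i s x (v.toFun s x)) hv hf hF ht hρ
      n c
  · intro i' _ hi'
    have hη' : ∀ z : Torus d, trigTest n c i z i' = 0 := fun z => by simp [trigTest, hi']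
    simp only [hη', torusLaplacian_zero, torusPartial_zero]
    simp
  · simp

theorem eq_of_forall_re_conj_mul_eq {a b : ℂ}
    (h : ∀ c : ℂ, ((starRingEnd ℂ) c * a).re = ((starRingEnd ℂ) c * b).re) : a = b := by
  have h1 := h 1
  have h2 := h Complex.I
  simp only [map_one, one_mul] at h1
  simp [Complex.mul_re] at h2
  exact Complex.ext h1 h2

/-- Each of the three summands is at most `(1 + ‖a‖ + ‖b‖)^p`. A single weight, raised to different
powers, then serves both reaction and flux. -/
theorem enorm_le_of_locally_lipschitz {E E' : Type*} [NormedAddCommGroup E]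
    [NormedAddCommGroup E'] {C p : ℝ} (hp : 0 ≤ p) {a b : E} {u : E'}
    (h : ‖u‖ ≤ C * (1 + ‖a‖ ^ p + ‖b‖ ^ p) * ‖a - b‖) :
    ‖u‖ₑ ≤ ENNReal.ofReal (3 * |C|) * ((1 + ‖a‖ₑ + ‖b‖ₑ) ^ p * ‖a - b‖ₑ) := by
  have e1 : 1 + ‖a‖ₑ + ‖b‖ₑ = ENNReal.ofReal (1 + ‖a‖ + ‖b‖) := by
    rw [ENNReal.ofReal_add (by positivity) (norm_nonneg _), ENNReal.ofReal_add zero_le_one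
      (norm_nonneg _), ENNReal.ofReal_one, ofReal_norm, ofReal_norm]
  rw [e1, ← ofReal_norm u, ← ofReal_norm (a - b), ENNReal.ofReal_rpow_of_nonneg (by positivity) hp,
    ← ENNReal.ofReal_mul (by positivity), ← ENNReal.ofReal_mul (by positivity)]
  refine ENNReal.ofReal_le_ofReal (h.trans ?_)
  have ha := norm_nonneg a
  have hb := norm_nonneg b
  have h1 : (1 : ℝ) ≤ (1 + ‖a‖ + ‖b‖) ^ p := Real.one_le_rpow (by linarith) hp
  have h2 : ‖a‖ ^ p ≤ (1 + ‖a‖ + ‖b‖) ^ p := Real.rpow_le_rpow ha (by linarith) hp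
  have h3 : ‖b‖ ^ p ≤ (1 + ‖a‖ + ‖b‖) ^ p := Real.rpow_le_rpow hb (by linarith) hp
  have h4 : 0 ≤ 1 + ‖a‖ ^ p + ‖b‖ ^ p := by positivity
  calc C * (1 + ‖a‖ ^ p + ‖b‖ ^ p) * ‖a - b‖ ≤ |C| * (3 * (1 + ‖a‖ + ‖b‖) ^ p) * ‖a - b‖ := by
        refine mul_le_mul_of_nonneg_right ?_ (norm_nonneg _)
        exact mul_le_mul (le_abs_self C) (by linarith) h4 (abs_nonneg C)
    _ = _ := by ring

theorem lintegral_one_add_enorm_rpow_le {d : ℕ} {E : Type*} [NormedAddCommGroup E]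
    {q : ℝ} (hq : 1 ≤ q) {a b : Torus d → E} (ha : AEStronglyMeasurable a volume)
    (hb : AEStronglyMeasurable b volume) {A B : ENNReal}
    (hA : eLpNorm a (ENNReal.ofReal q) volume ≤ A) (hB : eLpNorm b (ENNReal.ofReal q) volume ≤ B) :
    ∫⁻ x, (1 + ‖a x‖ₑ + ‖b x‖ₑ) ^ q ≤ (1 + A + B) ^ q := by
  have hq0 : 0 < q := by linarith
  have h1 := ENNReal.lintegral_Lp_add_le (μ := (volume : Measure (Torus d)))
    (f := fun _ => 1) (g := fun x => ‖a x‖ₑ) aemeasurable_const ha.enorm hq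
  have h2 := ENNReal.lintegral_Lp_add_le (μ := (volume : Measure (Torus d)))
    (f := fun x => 1 + ‖a x‖ₑ) (g := fun x => ‖b x‖ₑ) (aemeasurable_const.add ha.enorm) hb.enorm hq
  simp only [Pi.add_apply] at h1 h2
  rw [← eLpNorm_ofReal_eq hq0 a] at h1
  rw [← eLpNorm_ofReal_eq hq0 b] at h2
  have h3 : (∫⁻ x : Torus d, (1 : ENNReal) ^ q) ^ (1 / q) = 1 := by simp
  rw [h3] at h1
  have h4 := h2.trans (add_le_add (h1.trans (add_le_add le_rfl hA)) hB)
  have h5 := ENNReal.rpow_le_rpow h4 hq0.le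
  rwa [← ENNReal.rpow_mul, one_div_mul_cancel hq0.ne', ENNReal.rpow_one] at h5

theorem enorm_le_sum_enorm {l : ℕ} (y : State l) : ‖y‖ₑ ≤ ∑ i, ‖y i‖ₑ := by
  have h1 : ‖y‖ ≤ ∑ i, ‖y i‖ := by
    rw [EuclideanSpace.norm_eq]
    refine Real.sqrt_le_iff.2 ⟨Finset.sum_nonneg fun i _ => norm_nonneg _, ?_⟩
    exact Finset.sum_sq_le_sq_sum_of_nonneg fun i _ => norm_nonneg _
  rw [← ofReal_norm]
  refine (ENNReal.ofReal_le_ofReal h1).trans_eq ?_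
  rw [ENNReal.ofReal_sum_of_nonneg fun i _ => norm_nonneg _]
  simp only [ofReal_norm]

/-- Joint integrability of a solution and of its reaction and flux terms. -/
theorem SolutionClass.integrable_terms {d l : ℕ} {T γ q ξ h : ℝ} (hh : 1 < h) (hq : 1 ≤ q)
    (hξ : 1 < ξ) (hθ : (h - 1) / q ≤ 1 - 1 / ξ) {f : Fin l → ℝ → Torus d → State l → ℝ}
    {F : Fin l → ℝ → Torus d → State l → EuclideanSpace ℝ (Fin d)}
    (hfF : ReactionAssumption h f F) (v : SolutionClass d l T γ q ξ) (i : Fin l) :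
    Integrable (fun z => v.toFun z.1 z.2 i) (parabolicMeasure d T) ∧
    Integrable (fun z => f i z.1 z.2 (v.toFun z.1 z.2)) (parabolicMeasure d T) ∧
    ∀ j, Integrable (fun z => F i z.1 z.2 (v.toFun z.1 z.2) j) (parabolicMeasure d T) := by
  obtain ⟨V, hVm, hV, ⟨A, hA, hVA⟩, hVξ⟩ := v.exists_measurable_rep hq
  have hVh := lintegral_rpow_lt_top_of_bounds hh (by linarith) hξ hθ hVm hA hVA hVξ
  obtain ⟨C, hC⟩ := hfF.growth
  have hC' := parabolicMeasure_absolutelyContinuous (T := T) |>.ae_le hC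
  have hpos : 0 ≤ (h + 1) / 2 := by linarith
  have hFi : Integrable (fun z => F i z.1 z.2 (v.toFun z.1 z.2)) (parabolicMeasure d T) := by
    refine integrable_of_norm_le_rpow hh hVm hVh
      (aestronglyMeasurable_superposition (hfF.measurable_F i) hVm hV) hpos
      (by linarith : (h + 1) / 2 ≤ h) (C := C) ?_
    filter_upwards [hC', hV] with z hz hzV
    rw [hzV]
    exact (hz i (V z) 0).2.1
  refine ⟨?_, ?_, fun j => ?_⟩
  · have hvi : Integrable (fun z => v.toFun z.1 z.2) (parabolicMeasure d T) := by
      refine integrable_of_norm_le_rpow hh hVm hVh v.aestronglyMeasurable zero_le_one hh.le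
        (C := 1) ?_
      filter_upwards [hV] with z hzV
      rw [hzV, Real.rpow_one]
      linarith
    exact (EuclideanSpace.proj (𝕜 := ℝ) i).integrable_comp hvi
  · refine integrable_of_norm_le_rpow hh hVm hVh
      (aestronglyMeasurable_superposition (hfF.measurable_f i) hVm hV) (by linarith : 0 ≤ h)
      le_rfl (C := C) ?_
    filter_upwards [hC', hV] with z hz hzV
    rw [hzV]
    exact (hz i (V z) 0).1
  · exact (EuclideanSpace.proj (𝕜 := ℝ) j).integrable_comp hFi

/-! ### Uniqueness while the cut-off equals one. -/

/-- The Fourier coefficients of the difference of two weak solutions. -/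
theorem trace_sub_trace_eq {d l : ℕ} {T S γ q ξ h : ℝ} (hST : S ≤ T) (hh : 1 < h) (hq : 1 ≤ q)
    (hξ : 1 < ξ) (hθ : (h - 1) / q ≤ 1 - 1 / ξ) {μ : Fin l → ℝ}
    {f : Fin l → ℝ → Torus d → State l → ℝ}
    {F : Fin l → ℝ → Torus d → State l → EuclideanSpace ℝ (Fin d)}
    (hfF : ReactionAssumption h f F) {v₀ : Torus d → State l} {v₁ v₂ : SolutionClass d l T γ q ξ}
    {ρ₁ ρ₂ : ℝ → ℝ} (hw₁ : WeakFormulation μ f F v₀ ρ₁ v₁) (hw₂ : WeakFormulation μ f F v₀ ρ₂ v₂)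
    (hρ₁ : ∀ s ∈ Ioo 0 S, ρ₁ s = 1) (hρ₂ : ∀ s ∈ Ioo 0 S, ρ₂ s = 1) (i : Fin l)
    (n : Fin d → ℤ) {t : ℝ} (ht : t ∈ Icc 0 S) :
    v₁.trace t n i - v₂.trace t n i = ∫ s in Ioo 0 t, (-((μ i * laplaceSymbol n : ℝ) : ℂ) *
        UnitAddTorus.mFourierCoeff (fun x => ((v₁.toFun s x i - v₂.toFun s x i : ℝ) : ℂ)) n +
      (UnitAddTorus.mFourierCoeff
          (fun x => ((f i s x (v₁.toFun s x) - f i s x (v₂.toFun s x) : ℝ) : ℂ)) n +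
        ∑ j, 2 * Real.pi * Complex.I * n j * UnitAddTorus.mFourierCoeff
          (fun x => ((F i s x (v₁.toFun s x) j - F i s x (v₂.toFun s x) j : ℝ) : ℂ)) n)) := by
  obtain ⟨iv₁, if₁, iF₁⟩ := v₁.integrable_terms hh hq hξ hθ hfF i
  obtain ⟨iv₂, if₂, iF₂⟩ := v₂.integrable_terms hh hq hξ hθ hfF i
  have htT : t ∈ Icc 0 T := ⟨ht.1, ht.2.trans hST⟩
  have hsub : Ioo 0 t ⊆ Ioo 0 S := Ioo_subset_Ioo_right ht.2
  have hle : volume.restrict (Ioo 0 t) ≤ volume.restrict (Ioo 0 T) :=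
    Measure.restrict_mono (Ioo_subset_Ioo_right htT.2) le_rfl
  have hint : ∀ v : SolutionClass d l T γ q ξ,
      Integrable (fun s => -((μ i * laplaceSymbol n : ℝ) : ℂ) *
        UnitAddTorus.mFourierCoeff (fun x => (v.toFun s x i : ℂ)) n +
      (UnitAddTorus.mFourierCoeff (fun x => (f i s x (v.toFun s x) : ℂ)) n +
        ∑ j, 2 * Real.pi * Complex.I * n j * UnitAddTorus.mFourierCoeff
          (fun x => (F i s x (v.toFun s x) j : ℂ)) n)) (volume.restrict (Ioo 0 t)) := by
    intro v
    obtain ⟨iv, hf, iF⟩ := v.integrable_terms hh hq hξ hθ hfF i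
    refine Integrable.mono_measure ?_ hle
    exact ((integrable_mFourierCoeff (g := fun s x => v.toFun s x i) iv n).const_mul _).add
      ((integrable_mFourierCoeff (g := fun s x => f i s x (v.toFun s x)) hf n).add
      (integrable_finsetSum _ fun j _ =>
        (integrable_mFourierCoeff (g := fun s x => F i s x (v.toFun s x) j) (iF j) n).const_mul _))
  have h1 := fun c => hw₁.re_conj_mul_trace_eq i iv₁ if₁ iF₁ htT (fun s hs => hρ₁ s (hsub hs)) n c
  have h2 := fun c => hw₂.re_conj_mul_trace_eq i iv₂ if₂ iF₂ htT (fun s hs => hρ₂ s (hsub hs)) n c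
  refine eq_of_forall_re_conj_mul_eq fun c => ?_
  have h3 : ∀ a b : ℂ, ((starRingEnd ℂ) c * (a - b)).re =
      ((starRingEnd ℂ) c * a).re - ((starRingEnd ℂ) c * b).re := fun a b => by
    rw [mul_sub, Complex.sub_re]
  rw [h3, h1 c, h2 c, add_sub_add_left_eq_sub, ← h3, ← integral_sub (hint v₁) (hint v₂)]
  congr 2
  refine integral_congr_ae ?_
  filter_upwards [ae_mono hle iv₁.prod_right_ae, ae_mono hle iv₂.prod_right_ae,
    ae_mono hle if₁.prod_right_ae, ae_mono hle if₂.prod_right_ae,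
    ae_mono hle (ae_all_iff.2 fun j => (iF₁ j).prod_right_ae),
    ae_mono hle (ae_all_iff.2 fun j => (iF₂ j).prod_right_ae)] with s a1 a2 a3 a4 a5 a6
  push_cast
  rw [mFourierCoeff_sub (f := fun x => (v₁.toFun s x i : ℂ)) (g := fun x => (v₂.toFun s x i : ℂ))
      a1.ofReal a2.ofReal,
    mFourierCoeff_sub (f := fun x => (f i s x (v₁.toFun s x) : ℂ))
      (g := fun x => (f i s x (v₂.toFun s x) : ℂ)) a3.ofReal a4.ofReal]
  have hF := fun j => mFourierCoeff_sub (f := fun x => (F i s x (v₁.toFun s x) j : ℂ))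
      (g := fun x => (F i s x (v₂.toFun s x) j : ℂ)) (a5 j).ofReal (a6 j).ofReal n
  simp only [hF, mul_sub, Finset.sum_sub_distrib]
  ring

/-- Duhamel's formula for the difference of two weak solutions. -/
theorem sub_ae_eq_duhamel {d l : ℕ} (hd : 0 < d) {T S γ q ξ h : ℝ} (hST : S ≤ T) (hh : 1 < h)
    (hq : 1 ≤ q) (hξ : 1 < ξ) (hθ : (h - 1) / q ≤ 1 - 1 / ξ) {μ : Fin l → ℝ}
    {f : Fin l → ℝ → Torus d → State l → ℝ}
    {F : Fin l → ℝ → Torus d → State l → EuclideanSpace ℝ (Fin d)}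
    (hfF : ReactionAssumption h f F) {v₀ : Torus d → State l} {v₁ v₂ : SolutionClass d l T γ q ξ}
    {ρ₁ ρ₂ : ℝ → ℝ} (hw₁ : WeakFormulation μ f F v₀ ρ₁ v₁) (hw₂ : WeakFormulation μ f F v₀ ρ₂ v₂)
    (hρ₁ : ∀ s ∈ Ioo 0 S, ρ₁ s = 1) (hρ₂ : ∀ s ∈ Ioo 0 S, ρ₂ s = 1) (i : Fin l)
    (hμ : 0 < μ i) :
    ∀ᵐ t ∂(volume.restrict (Ioo 0 S)), ∀ᵐ x, v₁.toFun t x i - v₂.toFun t x i =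
      duhamel S (fun τ => torusHeat (μ i * τ))
        (fun s x => f i s x (v₁.toFun s x) - f i s x (v₂.toFun s x)) t x +
      ∑ j, duhamel S (fun τ => torusHeatDeriv j (μ i * τ))
        (fun s x => F i s x (v₁.toFun s x) j - F i s x (v₂.toFun s x) j) t x := by
  obtain ⟨iv₁, if₁, iF₁⟩ := v₁.integrable_terms hh hq hξ hθ hfF i
  obtain ⟨iv₂, if₂, iF₂⟩ := v₂.integrable_terms hh hq hξ hθ hfF i
  have hle : volume.restrict (Ioo 0 S) ≤ volume.restrict (Ioo 0 T) :=
    Measure.restrict_mono (Ioo_subset_Ioo_right hST) le_rfl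
  have hpm := parabolicMeasure_mono (d := d) hST
  refine ae_eq_duhamel hd hμ (u := fun s x => v₁.toFun s x i - v₂.toFun s x i)
    (G := fun j s x => F i s x (v₁.toFun s x) j - F i s x (v₂.toFun s x) j)
    ((iv₁.sub iv₂).mono_measure hpm) ((if₁.sub if₂).mono_measure hpm)
    (fun j => ((iF₁ j).sub (iF₂ j)).mono_measure hpm) fun n => ?_
  filter_upwards [ae_mono hle v₁.trace_eq, ae_mono hle v₂.trace_eq,
    ae_mono hle iv₁.prod_right_ae, ae_mono hle iv₂.prod_right_ae,
    ae_restrict_mem measurableSet_Ioo] with t e1 e2 a1 a2 ht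
  rw [← trace_sub_trace_eq hST hh hq hξ hθ hfF hw₁ hw₂ hρ₁ hρ₂ i n ⟨ht.1.le, ht.2.le⟩, e1, e2]
  push_cast
  rw [mFourierCoeff_sub (f := fun x => (v₁.toFun t x i : ℂ)) (g := fun x => (v₂.toFun t x i : ℂ))
    a1.ofReal a2.ofReal]
  rfl

/-- Equality of the traces of two weak solutions which agree almost everywhere. -/
theorem trace_eq_of_ae_eq {d l : ℕ} {T S γ q ξ h : ℝ} (hST : S ≤ T) (hh : 1 < h) (hq : 1 ≤ q)
    (hξ : 1 < ξ) (hθ : (h - 1) / q ≤ 1 - 1 / ξ) {μ : Fin l → ℝ}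
    {f : Fin l → ℝ → Torus d → State l → ℝ}
    {F : Fin l → ℝ → Torus d → State l → EuclideanSpace ℝ (Fin d)}
    (hfF : ReactionAssumption h f F) {v₀ : Torus d → State l} {v₁ v₂ : SolutionClass d l T γ q ξ}
    {ρ₁ ρ₂ : ℝ → ℝ} (hw₁ : WeakFormulation μ f F v₀ ρ₁ v₁) (hw₂ : WeakFormulation μ f F v₀ ρ₂ v₂)
    (hρ₁ : ∀ s ∈ Ioo 0 S, ρ₁ s = 1) (hρ₂ : ∀ s ∈ Ioo 0 S, ρ₂ s = 1)
    (hv : ∀ᵐ z ∂(parabolicMeasure d S), v₁.toFun z.1 z.2 = v₂.toFun z.1 z.2) {t : ℝ}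
    (ht : t ∈ Icc 0 S) : v₁.trace t = v₂.trace t := by
  funext n
  ext i
  rw [← sub_eq_zero, trace_sub_trace_eq hST hh hq hξ hθ hfF hw₁ hw₂ hρ₁ hρ₂ i n ht]
  refine integral_eq_zero_of_ae ?_
  have hle : volume.restrict (Ioo 0 t) ≤ volume.restrict (Ioo 0 S) :=
    Measure.restrict_mono (Ioo_subset_Ioo_right ht.2) le_rfl
  filter_upwards [ae_mono hle (Measure.ae_ae_of_ae_prod hv)] with s hs
  have h0 : ∀ u : Torus d → ℂ, u =ᵐ[volume] 0 → UnitAddTorus.mFourierCoeff u n = 0 := by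
    intro u hu
    rw [mFourierCoeff_eq_integral_volume]
    refine integral_eq_zero_of_ae ?_
    filter_upwards [hu] with x hx
    simp [hx]
  rw [h0 _ (by filter_upwards [hs] with x hx; simp [hx]),
    h0 _ (by filter_upwards [hs] with x hx; simp [hx]),
    Finset.sum_eq_zero fun j _ => by
      rw [h0 _ (by filter_upwards [hs] with x hx; simp [hx]), mul_zero]]
  simp

/-- Two weak solutions with cut-off functions equal to one on `(0, S)` agree on `[0, S]`. -/
theorem ae_eq_of_weakFormulation {d l : ℕ} (hd : 0 < d) {T S γ q ξ h : ℝ} (hS : 0 < S)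
    (hST : S ≤ T) (hh : 1 < h) (hq : 1 ≤ q) (hdq : d * (h - 1) / 2 < q)
    (hξ : 1 < ξ) (hθ : (h - 1) / q ≤ 1 - 1 / ξ) {μ : Fin l → ℝ} (hμ : ∀ i, 0 < μ i)
    {f : Fin l → ℝ → Torus d → State l → ℝ}
    {F : Fin l → ℝ → Torus d → State l → EuclideanSpace ℝ (Fin d)}
    (hfF : ReactionAssumption h f F) {v₀ : Torus d → State l} {v₁ v₂ : SolutionClass d l T γ q ξ}
    {ρ₁ ρ₂ : ℝ → ℝ} (hw₁ : WeakFormulation μ f F v₀ ρ₁ v₁) (hw₂ : WeakFormulation μ f F v₀ ρ₂ v₂)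
    (hρ₁ : ∀ s ∈ Ioo 0 S, ρ₁ s = 1) (hρ₂ : ∀ s ∈ Ioo 0 S, ρ₂ s = 1) :
    ∀ᵐ z ∂(parabolicMeasure d S), v₁.toFun z.1 z.2 = v₂.toFun z.1 z.2 := by
  have hq0 : 0 < q := by linarith
  have hξ0 : 0 < ξ := by linarith
  have hle : volume.restrict (Ioo 0 S) ≤ volume.restrict (Ioo 0 T) :=
    Measure.restrict_mono (Ioo_subset_Ioo_right hST) le_rfl
  have hpm := parabolicMeasure_mono (d := d) hST
  obtain ⟨V₁, hVm₁, hV₁, ⟨A₁, hA₁, hVA₁⟩, hVξ₁⟩ := v₁.exists_measurable_rep hq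
  obtain ⟨V₂, hVm₂, hV₂, ⟨A₂, hA₂, hVA₂⟩, hVξ₂⟩ := v₂.exists_measurable_rep hq
  have hVmeas₁ := hVm₁.measurable
  have hVmeas₂ := hVm₂.measurable
  obtain ⟨C, hC⟩ := hfF.growth
  have hC' := (parabolicMeasure_absolutelyContinuous (T := S)).ae_le hC
  choose K hK hk₀ hk₁ using fun i => exists_heatTypeKernel_torusHeat hd hS (hμ i)
  have hKle : ∀ i, K i ≤ ∑ i, K i := fun i =>
    Finset.single_le_sum (f := K) (fun i _ => (hK i).le) (Finset.mem_univ i)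
  set m : ℝ × Torus d → ENNReal := fun z => 1 + ‖V₁ z‖ₑ + ‖V₂ z‖ₑ with hm
  set W : ℝ × Torus d → ENNReal := fun z => ‖V₁ z - V₂ z‖ₑ with hW
  have hmm : Measurable m := by fun_prop
  have hWm : Measurable W := by fun_prop
  -- For each component, `none` indexes the reaction (heat kernel, `β = 0`) and `some j` the `j`-th
  -- flux entry (derivative kernel, `β = 1/2`). The exponents `θ` are such that `q * θ` is the
  -- Lipschitz growth `h-1`, respectively `(h-1)/2`.
  set k : Fin l × Option (Fin d) → ℝ → Torus d → ℝ := fun p =>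
    p.2.elim (fun τ => torusHeat (μ p.1 * τ)) (fun j τ => torusHeatDeriv j (μ p.1 * τ)) with hkdef
  set β : Fin l × Option (Fin d) → ℝ := fun p => p.2.elim 0 (fun _ => 1 / 2) with hβ
  set θ : Fin l × Option (Fin d) → ℝ := fun p =>
    p.2.elim ((h - 1) / q) (fun _ => (h - 1) / 2 / q) with hθdef
  set c : ENNReal := ENNReal.ofReal (3 * |C|) with hc
  have hpos : 0 ≤ (h - 1) / q := div_nonneg (by linarith) hq0.le
  have hhalf : (h - 1) / 2 / q = (h - 1) / q / 2 := by ring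
  -- Subcriticality: with `x = d(h-1)/(2q) < 1` the singularities are `x` for the reaction and
  -- `(1+x)/2` for the flux. The latter is the larger and is taken as `α`.
  have hdθ : d / 2 * ((h - 1) / q) < 1 := by
    rw [show (d : ℝ) / 2 * ((h - 1) / q) = (d * (h - 1) / 2) / q by ring, div_lt_one hq0]
    exact hdq
  have hzero : ∀ᵐ t ∂(volume.restrict (Ioo 0 S)), ∫⁻ y, W (t, y) ^ ξ = 0 := by
    refine ae_eq_zero_of_le_heatTypeKernel (k := k) (β := β) (θ := θ) (C := ∑ i, K i)
      (α := 1 / 2 + d / 2 * ((h - 1) / q) / 2) (q := q) (m := m) (c := c)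
      (A := (1 + A₁ + A₂) ^ q) ?_
      (Finset.sum_nonneg fun i _ => (hK i).le) hξ ?_ ?_ (by linarith) ?_ hmm hWm ?_
      ENNReal.ofReal_ne_top ?_ ?_ ?_
    · rintro ⟨i, _ | j⟩
      · exact (hk₀ i).mono (hKle i)
      · exact (hk₁ i j).mono (hKle i)
    · rintro ⟨i, _ | j⟩
      · exact hpos
      · change 0 ≤ (h - 1) / 2 / q
        linarith
    · rintro ⟨i, _ | j⟩
      · exact hθ
      · change (h - 1) / 2 / q ≤ _
        linarith
    · rintro ⟨i, _ | j⟩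
      · change 0 + (d : ℝ) / 2 * ((h - 1) / q) ≤ _
        linarith
      · change 1 / 2 + (d : ℝ) / 2 * ((h - 1) / 2 / q) ≤ _
        rw [hhalf]
        linarith
    · exact ENNReal.rpow_ne_top_of_nonneg hq0.le (by simp [hA₁, hA₂])
    · filter_upwards [ae_mono hle hVA₁, ae_mono hle hVA₂] with s h1 h2
      exact lintegral_one_add_enorm_rpow_le hq
        (hVmeas₁.comp measurable_prodMk_left).aestronglyMeasurable
        (hVmeas₂.comp measurable_prodMk_left).aestronglyMeasurable h1 h2
    · calc ∫⁻ s in Ioo 0 S, (∫⁻ y, W (s, y) ^ ξ) ^ (1 / ξ)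
          ≤ ∫⁻ s in Ioo 0 T, (eLpNorm (fun y => V₁ (s, y)) (ENNReal.ofReal ξ) volume +
              eLpNorm (fun y => V₂ (s, y)) (ENNReal.ofReal ξ) volume) := by
            refine lintegral_mono' hle fun s => ?_
            rw [hW, ← eLpNorm_ofReal_eq hξ0 (fun y => V₁ (s, y) - V₂ (s, y))]
            exact eLpNorm_sub_le (hVmeas₁.comp measurable_prodMk_left).aestronglyMeasurable
              (hVmeas₂.comp measurable_prodMk_left).aestronglyMeasurable
              (by simpa using hξ.le)
        _ = _ := lintegral_add_left (by
            have : Measurable fun s => ∫⁻ y, ‖V₁ (s, y)‖ₑ ^ ξ :=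
              Measurable.lintegral_prod_right' (f := fun z : ℝ × Torus d => ‖V₁ z‖ₑ ^ ξ)
                (by fun_prop)
            simp only [eLpNorm_ofReal_eq hξ0]
            fun_prop) _
        _ < ⊤ := ENNReal.add_lt_top.2 ⟨hVξ₁, hVξ₂⟩
    · have hduh := ae_all_iff.2 fun i =>
        sub_ae_eq_duhamel hd hST hh hq hξ hθ hfF hw₁ hw₂ hρ₁ hρ₂ i (hμ i)
      have hf : ∀ i, ∀ᵐ z ∂(parabolicMeasure d S),
          ‖f i z.1 z.2 (v₁.toFun z.1 z.2) - f i z.1 z.2 (v₂.toFun z.1 z.2)‖ₑ ≤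
            c * (m z ^ (h - 1) * W z) := fun i => by
        filter_upwards [hC', ae_mono hpm hV₁, ae_mono hpm hV₂] with z hz e1 e2
        rw [e1, e2]
        exact enorm_le_of_locally_lipschitz (by linarith) (hz i (V₁ z) (V₂ z)).2.2.1
      have hF : ∀ i j, ∀ᵐ z ∂(parabolicMeasure d S),
          ‖F i z.1 z.2 (v₁.toFun z.1 z.2) j - F i z.1 z.2 (v₂.toFun z.1 z.2) j‖ₑ ≤
            c * (m z ^ ((h - 1) / 2) * W z) := fun i j => by
        filter_upwards [hC', ae_mono hpm hV₁, ae_mono hpm hV₂] with z hz e1 e2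
        rw [e1, e2]
        refine enorm_le_of_locally_lipschitz (by linarith)
          (le_trans ?_ (hz i (V₁ z) (V₂ z)).2.2.2)
        exact PiLp.norm_apply_le (F i z.1 z.2 (V₁ z) - F i z.1 z.2 (V₂ z)) j
      have hduh_le : ∀ (κ : ℝ → Torus d → ℝ) (g : ℝ → Torus d → ℝ) (p : ℝ) (t : ℝ) (x : Torus d),
          (∀ᵐ z ∂(parabolicMeasure d S), ‖g z.1 z.2‖ₑ ≤ c * (m z ^ p * W z)) →
          ‖duhamel S κ g t x‖ₑ ≤ ∫⁻ z, c * (‖κ (t - z.1) (x - z.2)‖ₑ * (m z ^ p * W z))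
            ∂(parabolicMeasure d S) := by
        intro κ g p t x hg
        refine (enorm_duhamel_le κ g t x).trans (lintegral_mono_ae ?_)
        filter_upwards [hg] with z hz
        calc _ ≤ ‖κ (t - z.1) (x - z.2)‖ₑ * (c * (m z ^ p * W z)) := mul_le_mul_right hz _
          _ = _ := by ring
      filter_upwards [hduh, ae_mono hle (Measure.ae_ae_of_ae_prod hV₁),
        ae_mono hle (Measure.ae_ae_of_ae_prod hV₂)] with t ht e1 e2
      filter_upwards [ae_all_iff.2 ht, e1, e2] with x hx e1 e2
      refine (enorm_le_sum_enorm _).trans ?_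
      rw [Fintype.sum_prod_type]
      refine Finset.sum_le_sum fun i _ => ?_
      rw [Fintype.sum_option]
      have hx' := hx i
      rw [e1, e2] at hx'
      rw [PiLp.sub_apply, hx']
      refine (enorm_add_le _ _).trans (add_le_add ?_ ((enorm_sum_le _ _).trans
        (Finset.sum_le_sum fun j _ => ?_)))
      · have : q * θ (i, none) = h - 1 := mul_div_cancel₀ _ hq0.ne'
        rw [this]
        exact hduh_le _ _ _ t x (hf i)
      · have : q * θ (i, some j) = (h - 1) / 2 := mul_div_cancel₀ _ hq0.ne'
        rw [this]
        exact hduh_le _ _ _ t x (hF i j)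
  have hWzero : ∀ᵐ z ∂(parabolicMeasure d S), W z = 0 := by
    have h1 : ∫⁻ z, W z ^ ξ ∂(parabolicMeasure d S) = 0 := by
      rw [lintegral_parabolic_eq (by fun_prop), lintegral_congr_ae hzero, lintegral_zero]
    rw [lintegral_eq_zero_iff (by fun_prop)] at h1
    filter_upwards [h1] with z hz
    exact (ENNReal.rpow_eq_zero_iff_of_pos hξ0).1 hz
  filter_upwards [hWzero, ae_mono hpm hV₁, ae_mono hpm hV₂] with z hz e1 e2
  rw [e1, e2, ← sub_eq_zero, ← enorm_eq_zero]
  exact hz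

/-! ### Continuation in time and removal of the cut-off. -/

theorem mixedNorm_rpow {d l : ℕ} {r : ℝ} (hr : 0 < r) (q t : ℝ) (v : ℝ → Torus d → State l) :
    mixedNorm r q t v ^ r =
      ∫⁻ s in Ioo 0 t, eLpNorm (v s) (ENNReal.ofReal q) volume ^ r := by
  rw [mixedNorm, ← ENNReal.rpow_mul, one_div_mul_cancel hr.ne', ENNReal.rpow_one]

/-- Before time `S` the norm of `v₂` is that of `v₁`; afterwards only the `L^∞` bound in time is
known, over a length of at most `δ`. The loss does not depend on `S`, so the continuation step has a
uniform length. -/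
theorem mixedNorm_rpow_le_of_ae_eq {d l : ℕ} {T S δ r q t : ℝ} (hr : 0 < r) (hST : S + δ ≤ T)
    {v₁ v₂ : ℝ → Torus d → State l}
    (hv : ∀ᵐ z ∂(parabolicMeasure d S), v₁ z.1 z.2 = v₂ z.1 z.2) {E : ENNReal}
    (hE : ∀ᵐ s ∂(volume.restrict (Ioo 0 T)), eLpNorm (v₂ s) (ENNReal.ofReal q) volume ≤ E)
    (ht : t ≤ S + δ) :
    mixedNorm r q t v₂ ^ r ≤ mixedNorm r q T v₁ ^ r + E ^ r * ENNReal.ofReal δ := by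
  rw [mixedNorm_rpow hr, mixedNorm_rpow hr]
  have hle : ∀ {a b : ℝ}, a ≤ b →
      (volume : Measure ℝ).restrict (Ioo 0 a) ≤ volume.restrict (Ioo 0 b) := fun hab =>
    Measure.restrict_mono (Ioo_subset_Ioo_right hab) le_rfl
  have hS := (ae_restrict_iff' measurableSet_Ioo).1 (Measure.ae_ae_of_ae_prod hv)
  calc ∫⁻ s in Ioo 0 t, eLpNorm (v₂ s) (ENNReal.ofReal q) volume ^ r
      ≤ ∫⁻ s in Ioo 0 (S + δ), (eLpNorm (v₁ s) (ENNReal.ofReal q) volume ^ r +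
          (Ico S (S + δ)).indicator (fun _ => E ^ r) s) := by
        refine (lintegral_mono' (hle ht) le_rfl).trans (lintegral_mono_ae ?_)
        filter_upwards [ae_restrict_of_ae hS, ae_mono (hle hST) hE,
          ae_restrict_mem measurableSet_Ioo] with s h1 h2 h3
        rcases lt_or_ge s S with hs | hs
        · refine le_trans (le_of_eq ?_) le_self_add
          have h4 : v₁ s =ᵐ[volume] v₂ s := h1 ⟨h3.1, hs⟩
          rw [eLpNorm_congr_ae h4]
        · refine le_trans ?_ le_add_self
          rw [indicator_of_mem (show s ∈ Ico S (S + δ) from ⟨hs, h3.2⟩)]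
          exact ENNReal.rpow_le_rpow h2 hr.le
    _ = (∫⁻ s in Ioo 0 (S + δ), eLpNorm (v₁ s) (ENNReal.ofReal q) volume ^ r) +
          ∫⁻ s in Ioo 0 (S + δ), (Ico S (S + δ)).indicator (fun _ => E ^ r) s :=
        lintegral_add_right _ (measurable_const.indicator measurableSet_Ico)
    _ ≤ _ := by
        refine add_le_add (lintegral_mono' (hle hST) le_rfl) ?_
        refine (lintegral_mono' Measure.restrict_le_self le_rfl).trans_eq ?_
        rw [lintegral_indicator_const measurableSet_Ico, Real.volume_Ico, add_sub_cancel_left]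

theorem cutoff_eq_one {d l : ℕ} {φ : ℝ → ℝ} (hφ : IsCutoffProfile φ) {R r q t : ℝ} (hR : 0 < R)
    (hr : 0 < r) {v : ℝ → Torus d → State l}
    (h : mixedNorm r q t v ^ r ≤ ENNReal.ofReal (R ^ r)) : cutoff φ R r q v t = 1 := by
  rw [← ENNReal.ofReal_rpow_of_pos hR, ENNReal.rpow_le_rpow_iff hr] at h
  refine hφ.2.1 _ ⟨by positivity, ?_⟩
  rw [inv_mul_le_one₀ hR]
  exact ENNReal.toReal_le_of_le_ofReal hR.le h

/-- Weak–strong uniqueness for given exponents. -/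
theorem eq_of_isWeakSolution_of_isCutoffWeakSolution {d l : ℕ} (hd : 0 < d) {T γ q ξ h R r : ℝ}
    (hT : 0 < T) (hh : 1 < h) (hq : 1 ≤ q) (hdq : d * (h - 1) / 2 < q) (hξ : 1 < ξ)
    (hθ : (h - 1) / q ≤ 1 - 1 / ξ) (hR : 1 < R) (hr : 1 < r) {φ : ℝ → ℝ}
    (hφ : IsCutoffProfile φ) {μ : Fin l → ℝ} (hμ : ∀ i, 0 < μ i)
    {f : Fin l → ℝ → Torus d → State l → ℝ}
    {F : Fin l → ℝ → Torus d → State l → EuclideanSpace ℝ (Fin d)}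
    (hfF : ReactionAssumption h f F) {v₀ : Torus d → State l} {v₁ v₂ : SolutionClass d l T γ q ξ}
    (hw₁ : IsWeakSolution μ f F v₀ v₁) (hv₁ : mixedNorm r q T v₁.toFun ≤ ENNReal.ofReal (R - 1))
    (hw₂ : IsCutoffWeakSolution φ R r μ f F v₀ v₂) :
    (∀ᵐ z ∂(parabolicMeasure d T), v₁.toFun z.1 z.2 = v₂.toFun z.1 z.2) ∧
      ∀ t ∈ Icc 0 T, v₁.trace t = v₂.trace t := by
  have hr0 : 0 < r := by linarith
  have hR0 : 0 < R := by linarith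
  obtain ⟨e, he0, he⟩ : ∃ e : ℝ, 0 ≤ e ∧ ∀ᵐ s ∂(volume.restrict (Ioo 0 T)),
      eLpNorm (v₂.toFun s) (ENNReal.ofReal q) volume ≤ ENNReal.ofReal e :=
    ⟨_, ENNReal.toReal_nonneg, by
      rw [ENNReal.ofReal_toReal v₂.memLinftyLq.ne]; exact ENNReal.ae_le_essSup _⟩
  -- The room left by the assumption that `v₁` has norm at most `R - 1`.
  have hgap : 0 < R ^ r - (R - 1) ^ r :=
    sub_pos.2 (Real.rpow_lt_rpow (by linarith) (by linarith) hr0)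
  have hcut : ∀ S δ : ℝ, 0 ≤ δ → S + δ ≤ T → e ^ r * δ ≤ R ^ r - (R - 1) ^ r →
      (∀ᵐ z ∂(parabolicMeasure d S), v₁.toFun z.1 z.2 = v₂.toFun z.1 z.2) →
      ∀ s ∈ Ioo 0 (S + δ), cutoff φ R r q v₂.toFun s = 1 := by
    intro S δ hδ hSδ hle hv s hs
    refine cutoff_eq_one hφ hR0 hr0
      ((mixedNorm_rpow_le_of_ae_eq hr0 hSδ hv he hs.2.le).trans ?_)
    calc _ ≤ ENNReal.ofReal (R - 1) ^ r + ENNReal.ofReal e ^ r * ENNReal.ofReal δ := by gcongr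
      _ = ENNReal.ofReal ((R - 1) ^ r + e ^ r * δ) := by
          rw [ENNReal.ofReal_rpow_of_nonneg (by linarith) hr0.le,
            ENNReal.ofReal_rpow_of_nonneg he0 hr0.le, ← ENNReal.ofReal_mul (by positivity),
            ← ENNReal.ofReal_add (Real.rpow_nonneg (by linarith) _) (by positivity)]
      _ ≤ _ := ENNReal.ofReal_le_ofReal (by linarith)
  -- With `N` equal steps, each of length `T/N` consumes at most the gap. The gap is not used up
  -- cumulatively, since after each step the norm before `S` is again that of `v₁`.
  obtain ⟨N, hN⟩ := exists_nat_gt (e ^ r * T / (R ^ r - (R - 1) ^ r))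
  have hN0 : (0 : ℝ) < N := lt_of_le_of_lt (by positivity) hN
  have hδ : e ^ r * (T / N) ≤ R ^ r - (R - 1) ^ r := by
    rw [div_lt_iff₀ hgap] at hN
    rw [← mul_div_assoc, div_le_iff₀ hN0]
    linarith
  have hstep : ∀ k : ℕ, k ≤ N →
      ∀ᵐ z ∂(parabolicMeasure d (k * (T / N))), v₁.toFun z.1 z.2 = v₂.toFun z.1 z.2 := by
    intro k
    induction k with
    | zero => intro _; simp [parabolicMeasure]
    | succ k ih =>
      intro hk
      have e1 : ((k + 1 : ℕ) : ℝ) * (T / N) = k * (T / N) + T / N := by push_cast; ring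
      have e2 : ((k + 1 : ℕ) : ℝ) * (T / N) ≤ T := by
        rw [← mul_div_assoc, div_le_iff₀ hN0, mul_comm]
        exact mul_le_mul_of_nonneg_left (by exact_mod_cast hk) hT.le
      refine ae_eq_of_weakFormulation hd (by positivity) e2 hh hq hdq hξ hθ hμ hfF hw₁ hw₂
        (fun _ _ => rfl) ?_
      rw [e1]
      exact hcut _ _ (by positivity) (e1 ▸ e2) hδ (ih (by omega))
  have hae : ∀ᵐ z ∂(parabolicMeasure d T), v₁.toFun z.1 z.2 = v₂.toFun z.1 z.2 := by
    have := hstep N le_rfl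
    rwa [mul_div_cancel₀ _ hN0.ne'] at this
  refine ⟨hae, fun t ht => trace_eq_of_ae_eq le_rfl hh hq hξ hθ hfF hw₁ hw₂ (fun _ _ => rfl) ?_
    hae ht⟩
  -- Taking `S = T` and `δ = 0` shows that the cut-off is one on all of `(0, T)`.
  have := hcut T 0 le_rfl (by simp) (by simpa using hgap.le) hae
  rwa [add_zero] at this

theorem mainTheorem8 (d : ℕ) (hd : 2 ≤ d) (h q : ℝ) (hh : 1 < h)
    (hq : max ((d : ℝ) * (h - 1) / 2) 2 < q) :
    ∃ ξ₀ : ℝ, q < ξ₀ ∧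
      ∀ ξ : ℝ, ((3 ≤ d ∧ ξ = (d : ℝ) * q / ((d : ℝ) - 2)) ∨ (d = 2 ∧ ξ₀ ≤ ξ)) →
      ∀ (l : ℕ) (_ : 1 ≤ l) (T γ R r : ℝ) (_ : 0 < T) (_ : 0 < γ) (_ : γ < 1)
        (_ : 1 < R) (_ : 1 < r)
        (φ : ℝ → ℝ) (_ : IsCutoffProfile φ)
        (μ : Fin l → ℝ) (_ : ∀ i, 0 < μ i)
        (f : Fin l → ℝ → Torus d → State l → ℝ)
        (F : Fin l → ℝ → Torus d → State l → EuclideanSpace ℝ (Fin d))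
        (_ : ReactionAssumption h f F)
        (v₀ : Torus d → State l) (_ : MemLp v₀ (ENNReal.ofReal q) volume)
        (v₁ v₂ : SolutionClass d l T γ q ξ)
        (_ : IsWeakSolution μ f F v₀ v₁)
        (_ : mixedNorm r q T v₁.toFun ≤ ENNReal.ofReal (R - 1))
        (_ : IsCutoffWeakSolution φ R r μ f F v₀ v₂),
        (∀ᵐ z ∂((volume.restrict (Ioo 0 T)).prod (volume : Measure (Torus d))),
            v₁.toFun z.1 z.2 = v₂.toFun z.1 z.2) ∧
          ∀ t ∈ Icc 0 T, v₁.trace t = v₂.trace t := by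
  obtain ⟨hdq, hq2⟩ := max_lt_iff.1 hq
  have hd2 : (2 : ℝ) ≤ d := by exact_mod_cast hd
  -- Since `d ≥ 2`, one has `q > d(h-1)/2 ≥ h-1`.
  have hqh : 0 < q - (h - 1) := by nlinarith
  -- The inequality `(h-1)/q ≤ 1 - 1/ξ` is equivalent to `ξ ≥ q/(q-(h-1))`; the entry `q + 1`
  -- ensures `ξ₀ > q`.
  refine ⟨max (q + 1) (q / (q - (h - 1))), lt_max_of_lt_left (by linarith), ?_⟩
  intro ξ hξ l _ T γ R r hT _ _ hR hr φ hφ μ hμ f F hfF v₀ _ v₁ v₂ hw₁ hv₁ hw₂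
  obtain ⟨hξ1, hθ⟩ : 1 < ξ ∧ (h - 1) / q ≤ 1 - 1 / ξ := by
    rcases hξ with ⟨hd3, rfl⟩ | ⟨-, hξ⟩
    · have hd3' : (3 : ℝ) ≤ d := by exact_mod_cast hd3
      refine ⟨by rw [one_lt_div (by linarith)]; nlinarith, ?_⟩
      rw [one_div_div, le_sub_iff_add_le, div_add_div _ _ (by linarith) (by positivity),
        div_le_one (by positivity)]
      -- This is the Hölder condition for `1/ξ = (d-2)/(dq)`. It is the sum of `d(h-1) < 2q` and `d
      -- - 2 ≤ q(d-2)`.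
      have h1 : (h - 1) * d + (d - 2) ≤ q * d := by nlinarith
      nlinarith [mul_le_mul_of_nonneg_left h1 (by linarith : 0 ≤ q)]
    · have h1 : q + 1 ≤ ξ := (le_max_left _ _).trans hξ
      have h2 : q / (q - (h - 1)) ≤ ξ := (le_max_right _ _).trans hξ
      refine ⟨by linarith, ?_⟩
      rw [div_le_iff₀ hqh] at h2
      have hξ0 : 0 < ξ := by linarith
      rw [le_sub_iff_add_le, div_add_div _ _ (by linarith) hξ0.ne', div_le_one (by positivity)]
      linarith
  exact eq_of_isWeakSolution_of_isCutoffWeakSolution (by omega) hT hh (by linarith) hdq hξ1 hθ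
    hR hr hφ hμ hfF hw₁ hv₁ hw₂
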